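/- Let $K$ be an imaginary quadratic field with ring of integers $\mathcal{O}_K$, and let $w_K$ be the number of roots of unity in $K$. Fix an algebraic closure of $K$; for a nonzero ideal $\mathfrak{u}$ of $\mathcal{O}_K$ let $K_{\mathfrak{u}}$ be the ray class field of $K$ modulo $\mathfrak{u}$ inside it, i.e. the finite abelian extension of $K$, unramified at the primes not dividing $\mathfrak{u}$, for which the Artin map induces an isomorphism $I_{\mathfrak{u}}/\mathcal{R}_{\mathfrak{u}}\simeq \mathrm{Gal}(K_{\mathfrak{u}}/K)$; here $I_{\mathfrak{u}}$ is the group of fractional ideals prime to $\mathfrak{u}$ and $\mathcal{R}_{\mathfrak{u}}$ the subgroup of principal ideals $x\mathcal{O}_K$ with $x\equiv 1 \bmod^{\times}\mathfrak{u}$. Let $H=K_{(1)}$ be the Hilbert class field. Let $\mathfrak{n}$ be a nonzero ideal of $\mathcal{O}_K$ prime to $w_K$, and let $|\mathfrak{n}|$ be the number of prime ideals dividing $\mathfrak{n}$. For each prime $\mathfrak{p}\mid\mathfrak{n}$ let $T_{\mathfrak{p}}(\mathfrak{n})\subseteq\mathrm{Gal}(K_{\mathfrak{n}}/H)$ be the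 inertia group of $\mathfrak{p}$ in $K_{\mathfrak{n}}/K$, and let $\widetilde{S}(\mathfrak{n})$ be the ideal of $\mathbb{Z}[\mathrm{Gal}(K_{\mathfrak{n}}/H)]$ generated by the elements $\sum_{\sigma\in T_{\mathfrak{p}}(\mathfrak{n})}\sigma$, $\mathfrak{p}\mid\mathfrak{n}$. Then the torsion subgroup of the abelian group $\mathbb{Z}[\mathrm{Gal}(K_{\mathfrak{n}}/H)]/\widetilde{S}(\mathfrak{n})$ satisfies $$\mathrm{Tor}\bigl(\mathbb{Z}[\mathrm{Gal}(K_{\mathfrak{n}}/H)]/\widetilde{S}(\mathfrak{n})\bigr)\simeq\begin{cases}0 & \text{if } |\mathfrak{n}|=1 \text{ or } |\mathfrak{n}| \text{ is even},\\ \mathbb{Z}/w_K\mathbb{Z} & \text{otherwise.}\end{cases}$$ -/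

import Mathlib

open NumberField IsDedekindDomain
open scoped nonZeroDivisors

noncomputable section

/-- The group `I_n` of fractional ideals of `K` prime to `n`. -/
def idealsPrimeTo (K : Type*) [Field K] [NumberField K] (n : Ideal (𝓞 K)) :
    Subgroup (FractionalIdeal (𝓞 K)⁰ K)ˣ where
  carrier := {J | ∀ v : HeightOneSpectrum (𝓞 K), v.asIdeal ∣ n →
    FractionalIdeal.count K v (J : FractionalIdeal (𝓞 K)⁰ K) = 0}
  one_mem' := fun v _ => by simpa using FractionalIdeal.count_one K v
  mul_mem' := fun {a b} ha hb v hv => by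
    rw [Units.val_mul, FractionalIdeal.count_mul K v a.ne_zero b.ne_zero, ha v hv, hb v hv,
      add_zero]
  inv_mem' := fun {a} ha v hv => by
    rw [Units.val_inv_eq_inv_val, FractionalIdeal.count_inv, ha v hv, neg_zero]

/-- `x ≡ 1 mod^× n`: `x = a / b` with `a`, `b` integers of `K` prime to `n` and `a ≡ b mod n`. -/
def ModEqOne {K : Type*} [Field K] [NumberField K] (n : Ideal (𝓞 K)) (x : K) : Prop :=
  ∃ a b : 𝓞 K, b ≠ 0 ∧ IsCoprime (Ideal.span {a}) n ∧ IsCoprime (Ideal.span {b}) n ∧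
    a - b ∈ n ∧ x = (a : K) / (b : K)

/-- `R_n`: the principal fractional ideals `(x)` with `x ≡ 1 mod^× n` and `x` positive at every
real embedding. -/
def rayIdeals (K : Type*) [Field K] [NumberField K] (n : Ideal (𝓞 K)) :
    Set (FractionalIdeal (𝓞 K)⁰ K)ˣ :=
  {J | ∃ x : Kˣ, J = toPrincipalIdeal (𝓞 K) K x ∧ ModEqOne n (x : K) ∧
    ∀ σ : K →+* ℝ, 0 < σ x}

instance galSMulCommClass {K L : Type*} [Field K] [Field L] [Algebra K L] :
    SMulCommClass Gal(L/K) (𝓞 K) (𝓞 L) where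
  smul_comm σ r x := by
    apply RingOfIntegers.ext
    rw [Algebra.smul_def, Algebra.smul_def]
    change σ (algebraMap K L r * x) = algebraMap K L r * σ x
    rw [map_mul, σ.commutes]

/-- `L` is the ray class field of `K` modulo `n` times all real places: `L / K` is finite abelian,
unramified (trivial inertia groups) at the primes not dividing `n`, and the Artin map, which sends
a prime not dividing `n` to its Frobenius, induces an isomorphism from `I_n / R_n` onto
`Gal(L/K)`. -/
structure IsRayClassField (K : Type*) [Field K] [NumberField K] (n : Ideal (𝓞 K))
    (L : Type*) [Field L] [Algebra K L] : Prop where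
  finite : FiniteDimensional K L
  abelian : IsAbelianGalois K L
  unramified : ∀ Q : Ideal (𝓞 L), Q.IsMaximal → ¬ Q.under (𝓞 K) ∣ n → Q.inertia Gal(L/K) = ⊥
  artin : ∃ φ : idealsPrimeTo K n →* Gal(L/K),
    (∀ (J : idealsPrimeTo K n) (v : HeightOneSpectrum (𝓞 K)),
      (((J : (FractionalIdeal (𝓞 K)⁰ K)ˣ) : FractionalIdeal (𝓞 K)⁰ K) =
        (v.asIdeal : FractionalIdeal (𝓞 K)⁰ K)) →
      ∀ Q : Ideal (𝓞 L), Q.IsMaximal → Q.under (𝓞 K) = v.asIdeal →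
        IsArithFrobAt (𝓞 K) (φ J) Q) ∧
    Function.Surjective φ ∧
    ∀ J : idealsPrimeTo K n, φ J = 1 ↔ (J : (FractionalIdeal (𝓞 K)⁰ K)ˣ) ∈ rayIdeals K n

/-- `s(X)`, the sum in `ℤ[G]` of the elements of a (finite) subset `X` of `G`. -/
def elementSum {G : Type*} [Group G] (X : Set G) : MonoidAlgebra ℤ G :=
  ∑ᶠ g ∈ X, MonoidAlgebra.of ℤ G g

/-- `Gal(F/H)` as a subgroup of `Gal(F/K)`, for subextensions `H ⊆ F` of `Ω / K`. -/
def galOver {K Ω : Type*} [Field K] [Field Ω] [Algebra K Ω] (H F : IntermediateField K Ω) :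
    Subgroup Gal(F/K) :=
  (H.comap F.val).fixingSubgroup

/-- The ideal of `ℤ[Γ]` generated by the sums `s(T_p)`, where `p` runs over the primes of `K`
dividing `n` and `T_p ⊆ Γ ⊆ Gal(L/K)` is the inertia group of (any prime `Q` of `L` above) `p`
in `L / K`. -/
def inertiaTraceIdeal {K L : Type*} [Field K] [Field L] [Algebra K L]
    (n : Ideal (𝓞 K)) (Γ : Subgroup Gal(L/K)) : Ideal (MonoidAlgebra ℤ Γ) :=
  Ideal.span {x | ∃ Q : Ideal (𝓞 L), Q.IsMaximal ∧ Q.under (𝓞 K) ∣ n ∧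
    x = elementSum {g : Γ | (g : Gal(L/K)) ∈ Q.inertia Gal(L/K)}}

/-- The number `|n|` of prime ideals dividing `n`. -/
def numPrimeDivisors {K : Type*} [Field K] [NumberField K] (n : Ideal (𝓞 K)) : ℕ :=
  {v : HeightOneSpectrum (𝓞 K) | v.asIdeal ∣ n}.ncard

end

/-!
Write `w` for the number of roots of unity of `K`, `n = ∏ v i ^ e i`, `A i = (𝓞 K ⧸ v i ^ e i)ˣ`
and `Γ` for the Galois group of the ray class field modulo `n` over the Hilbert class field. The
argument has an algebraic half and an arithmetic half.

*Arithmetic.* The Artin map on principal ideals identifies `Γ` with `(∏ A i) / ⟨γ⟩`, where `γ` is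
the image of a generator `ζ` of the unit group, and every component of `γ` has order exactly `w`
because `1 - ζ ^ k` divides `w`, which is prime to `n`. Under this identification the inertia group
at `v i` is the image of `A i` (`IsRayClassField.exists_presentation`). Two facts of class field
theory are needed beyond the definition of a ray class field.

* For `m ∣ n` the Artin map modulo `n` has kernel `R_m` on the ray class field modulo `m`, which
  lies in the one modulo `n` (`IsRayClassField.le_and_mem_galOver_iff`). In the compositum of the
  two fields, the automorphisms given on both by the Artin symbol of one ideal form a subgroup, in whose
  fixed field almost all primes split completely. This field is `K`: otherwise its zeta function
  would have a double pole at `1` (`not_forall_exists_two_primes_absNorm_eq`). Taking `m` to be `n`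
  without its `v i`-part, this bounds the inertia group at `v i` from above.
* Conversely, for `c ≡ 1` modulo that `m`, the Artin symbol of `(c)` lies in the inertia group at
  `v i`. In the fixed field `M` of this group `v i` is unramified, so that `c` is congruent modulo
  `n` to the norm of an integer of `M`
  (`Ideal.exists_prod_smul_eq_of_inertia_eq_bot_of_isCoprime`), and norms from `M` have trivial
  Artin symbol on `M` (`IsArtinMap.map_relNorm_eq_one`).

*Algebra.* Let `X` be the quotient of `ℤ[∏ A i]` by the ideal generated by the traces of the factors
`A i`, that is, `⨂ ℤ[A i] / (∑ a)`. It is torsion-free, and `ℤ[Γ]` modulo the traces of the inertia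
groups is the module of coinvariants of `⟨γ⟩` on `X`, so that its torsion is the Tate cohomology of
the cyclic group `⟨γ⟩` of order `w` in degree `-1` with values in `X`
(`nonempty_torsion_coinvariants_equiv`). Passing from `t` to `t + 1` factors, `X` becomes the
quotient of the functions `A → X` by the constants, and these functions are acyclic, as `γ` acts
freely on `A`. The cohomology is thus that of `ℤ` shifted by `t` degrees, namely `0` for even `t`
and `ℤ / w` for odd `t`. For `t = 1` the map from `A 0` to `Γ` is not injective, and the answer is
different: the inertia group is `Γ` itself, and `ℤ[Γ]` modulo its trace is torsion-free.
-/

/-! ### Two-periodic cohomology of a cyclic group -/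

/-- The module `ker α / (ker α ∩ im β)`. For `α` and `β` the norm `∑ i < w, g ^ i` and `g - 1`, in
one order or the other, these are the Tate cohomology groups in odd and even degrees of a cyclic
group of order `w` with generator `g`. -/
abbrev kerModRange {R X : Type*} [CommRing R] [AddCommGroup X] [Module R X]
    (α β : Module.End R X) : Type _ :=
  LinearMap.ker α ⧸ (LinearMap.range β).submoduleOf (LinearMap.ker α)

/-- The connecting isomorphism of a short exact sequence `0 → X → Y → Z → 0` whose middle term is
acyclic. -/
theorem nonempty_kerModRange_equiv_of_exact {R X Y Z : Type*} [CommRing R]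
    [AddCommGroup X] [AddCommGroup Y] [AddCommGroup Z] [Module R X] [Module R Y] [Module R Z]
    {ι : X →ₗ[R] Y} {π : Y →ₗ[R] Z} (hι : Function.Injective ι)
    (hπ : Function.Surjective π) (hex : LinearMap.ker π = LinearMap.range ι)
    {αX βX : Module.End R X} {αY βY : Module.End R Y} {αZ βZ : Module.End R Z}
    (hια : ∀ x, αY (ι x) = ι (αX x)) (hιβ : ∀ x, βY (ι x) = ι (βX x))
    (hπα : ∀ y, π (αY y) = αZ (π y)) (hπβ : ∀ y, π (βY y) = βZ (π y))
    (hα : LinearMap.ker αY = LinearMap.range βY)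
    (hβ : LinearMap.ker βY = LinearMap.range αY) :
    Nonempty (kerModRange αZ βZ ≃ₗ[R] kerModRange βX αX) := by
  -- Both sides are quotients, with the same kernel, of the module of `y` with `α y ∈ X`.
  let P : Submodule R Y := (LinearMap.range ι).comap αY
  have hex' : ∀ y, π y = 0 ↔ ∃ x, ι x = y := fun y => by
    rw [← LinearMap.mem_ker, hex, LinearMap.mem_range]
  have hα' : ∀ y, αY y = 0 ↔ ∃ y', βY y' = y := fun y => by
    rw [← LinearMap.mem_ker, hα, LinearMap.mem_range]
  have hβ' : ∀ y, βY y = 0 ↔ ∃ y', αY y' = y := fun y => by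
    rw [← LinearMap.mem_ker, hβ, LinearMap.mem_range]
  let e : X ≃ₗ[R] LinearMap.range ι := LinearEquiv.ofInjective ι hι
  let toX : P →ₗ[R] X := e.symm.toLinearMap ∘ₗ
    ((αY ∘ₗ P.subtype).codRestrict (LinearMap.range ι) fun y => y.2)
  have htoX : ∀ y : P, ι (toX y) = αY y := fun y => by
    have h : e (toX y) = (αY ∘ₗ P.subtype).codRestrict (LinearMap.range ι) (fun y => y.2) y :=
      e.apply_symm_apply _
    exact congrArg Subtype.val h
  let f₁ : P →ₗ[R] LinearMap.ker αZ := (π ∘ₗ P.subtype).codRestrict _ fun y => by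
    obtain ⟨x, hx⟩ := y.2
    rw [LinearMap.mem_ker, LinearMap.comp_apply, ← hπα, hex']
    exact ⟨x, hx⟩
  let f₂ : P →ₗ[R] LinearMap.ker βX := toX.codRestrict _ fun y => by
    rw [LinearMap.mem_ker]
    apply hι
    rw [← hιβ, htoX, map_zero, hβ']
    exact ⟨_, rfl⟩
  let q₁ := ((LinearMap.range βZ).submoduleOf (LinearMap.ker αZ)).mkQ ∘ₗ f₁
  let q₂ := ((LinearMap.range αX).submoduleOf (LinearMap.ker βX)).mkQ ∘ₗ f₂
  have hq₁ : Function.Surjective q₁ := by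
    refine (Submodule.mkQ_surjective _).comp ?_
    rintro ⟨z, hz⟩
    obtain ⟨y, rfl⟩ := hπ z
    have hz' : π (αY y) = 0 := by rw [hπα]; exact hz
    exact ⟨⟨y, (hex' _).1 hz'⟩, rfl⟩
  have hq₂ : Function.Surjective q₂ := by
    refine (Submodule.mkQ_surjective _).comp ?_
    rintro ⟨x, hx⟩
    have : βY (ι x) = 0 := by rw [hιβ, LinearMap.mem_ker.1 hx, map_zero]
    obtain ⟨y, hy⟩ := (hβ' _).1 this
    refine ⟨⟨y, x, hy.symm⟩, Subtype.ext (hι ?_)⟩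
    change ι (toX _) = ι x
    rw [htoX, hy]
  have hker : LinearMap.ker q₁ = LinearMap.ker q₂ := by
    ext y
    have h1 : y ∈ LinearMap.ker q₁ ↔ ∃ z, βZ z = π y := by
      rw [LinearMap.mem_ker, LinearMap.comp_apply, Submodule.mkQ_apply,
        Submodule.Quotient.mk_eq_zero, Submodule.submoduleOf, Submodule.mem_comap]
      rfl
    have h2 : y ∈ LinearMap.ker q₂ ↔ ∃ x, αX x = toX y := by
      rw [LinearMap.mem_ker, LinearMap.comp_apply, Submodule.mkQ_apply,
        Submodule.Quotient.mk_eq_zero, Submodule.submoduleOf, Submodule.mem_comap]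
      rfl
    rw [h1, h2]
    constructor
    · rintro ⟨z, hz⟩
      obtain ⟨u, rfl⟩ := hπ z
      have : π (y - βY u) = 0 := by rw [map_sub, hπβ, hz, sub_self]
      obtain ⟨x, hx⟩ := (hex' _).1 this
      refine ⟨x, hι ?_⟩
      rw [← hια, htoX, hx, map_sub, (hα' (βY u)).2 ⟨u, rfl⟩, sub_zero]
    · rintro ⟨x, hx⟩
      have : αY (y - ι x) = 0 := by rw [map_sub, hια, hx, htoX, sub_self]
      obtain ⟨u, hu⟩ := (hα' _).1 this
      refine ⟨π u, ?_⟩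
      rw [← hπβ, hu, map_sub, (hex' (ι x)).2 ⟨x, rfl⟩, sub_zero]
  exact ⟨((LinearMap.quotKerEquivOfSurjective q₁ hq₁).symm.trans
    (Submodule.quotEquivOfEq _ _ hker)).trans (LinearMap.quotKerEquivOfSurjective q₂ hq₂)⟩

/-- The norm `1 + g + ⋯ + g ^ (w - 1)`. -/
def cyclicNorm {R X : Type*} [CommRing R] [AddCommGroup X] [Module R X]
    (g : Module.End R X) (w : ℕ) : Module.End R X :=
  ∑ i ∈ Finset.range w, g ^ i

section cyclicNorm

variable {R X : Type*} [CommRing R] [AddCommGroup X] [Module R X] {g : Module.End R X} {w : ℕ}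

theorem cyclicNorm_mul_sub_one (hg : g ^ w = 1) : cyclicNorm g w * (g - 1) = 0 := by
  rw [cyclicNorm, geom_sum_mul, hg, sub_self]

theorem sub_one_mul_cyclicNorm (hg : g ^ w = 1) : (g - 1) * cyclicNorm g w = 0 := by
  rw [cyclicNorm, mul_geom_sum, hg, sub_self]

theorem pow_sub_self_mem_range (g : Module.End R X) (n : ℕ) (x : X) :
    (g ^ n) x - x ∈ LinearMap.range (g - 1) := by
  refine ⟨(∑ i ∈ Finset.range n, g ^ i : Module.End R X) x, ?_⟩
  have : (g - 1) * (∑ i ∈ Finset.range n, g ^ i) = g ^ n - 1 := mul_geom_sum g n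
  exact DFunLike.congr_fun this x

theorem cyclicNorm_apply (x : X) : cyclicNorm g w x = ∑ i ∈ Finset.range w, (g ^ i) x := by
  rw [cyclicNorm, LinearMap.sum_apply]

/-- A decomposition `1 = ∑ g ^ i e g ^ (-i)` makes both cohomology groups vanish. -/
theorem ker_eq_range_of_sum_conj_eq_one (hg : g ^ w = 1) {e : Module.End R X}
    (he : ∑ i ∈ Finset.range w, g ^ i * e * g ^ (w - i) = 1) :
    LinearMap.ker (cyclicNorm g w) = LinearMap.range (g - 1) ∧
    LinearMap.ker (g - 1) = LinearMap.range (cyclicNorm g w) := by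
  have hN : ∑ i ∈ Finset.range w, g ^ (w - i) = g * cyclicNorm g w := by
    rw [cyclicNorm, Finset.mul_sum, ← Finset.sum_range_reflect]
    refine Finset.sum_congr rfl fun i hi => ?_
    rw [Finset.mem_range] at hi
    rw [← pow_succ']
    congr 1
    omega
  have he' : ∀ x, ∑ i ∈ Finset.range w, (g ^ i) (e ((g ^ (w - i)) x)) = x := fun x => by
    have := DFunLike.congr_fun he x
    rwa [LinearMap.sum_apply] at this
  constructor
  · refine le_antisymm (fun x hx => ?_) ?_
    · have h0 : ∑ i ∈ Finset.range w, e ((g ^ (w - i)) x) = 0 := by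
        rw [← map_sum, ← LinearMap.sum_apply, hN, Module.End.mul_apply, LinearMap.mem_ker.1 hx,
          map_zero, map_zero]
      have h1 : x = ∑ i ∈ Finset.range w,
          ((g ^ i) (e ((g ^ (w - i)) x)) - e ((g ^ (w - i)) x)) := by
        rw [Finset.sum_sub_distrib, h0, sub_zero, he']
      rw [h1]
      exact sum_mem fun i _ => pow_sub_self_mem_range g _ _
    · rintro _ ⟨y, rfl⟩
      exact DFunLike.congr_fun (cyclicNorm_mul_sub_one hg) y
  · refine le_antisymm (fun x hx => ?_) ?_
    · have hx1 : g x = x := sub_eq_zero.1 hx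
      have hxn : ∀ n : ℕ, (g ^ n) x = x := fun n => by
        induction n with
        | zero => rfl
        | succ n ih => rw [pow_succ, Module.End.mul_apply, hx1, ih]
      refine ⟨e x, ?_⟩
      rw [cyclicNorm_apply]
      refine Eq.trans (Finset.sum_congr rfl fun i _ => ?_) (he' x)
      rw [hxn]
    · rintro _ ⟨y, rfl⟩
      exact DFunLike.congr_fun (sub_one_mul_cyclicNorm hg) y

/-- The torsion of the coinvariants of a torsion-free module is its Tate cohomology in
degree `-1`. -/
theorem nonempty_torsion_coinvariants_equiv [IsAddTorsionFree X] (hg : g ^ w = 1) (hw : w ≠ 0)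
    {Q : Type*} [AddCommGroup Q] {q : X →+ Q} (hq : Function.Surjective q)
    (hker : ∀ x, q x = 0 ↔ x ∈ LinearMap.range (g - 1)) :
    Nonempty (AddCommGroup.torsion Q ≃+ kerModRange (cyclicNorm g w) (g - 1)) := by
  have key : ∀ x, q x ∈ AddCommGroup.torsion Q ↔ cyclicNorm g w x = 0 := by
    intro x
    rw [show q x ∈ AddCommGroup.torsion Q ↔ IsOfFinAddOrder (q x) from Iff.rfl,
      isOfFinAddOrder_iff_nsmul_eq_zero]
    constructor
    · rintro ⟨n, hn, h⟩
      rw [← map_nsmul, hker] at h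
      obtain ⟨y, hy⟩ := h
      have : n • cyclicNorm g w x = 0 := by
        rw [← map_nsmul, ← hy]
        exact DFunLike.congr_fun (cyclicNorm_mul_sub_one hg) y
      exact (nsmul_eq_zero_iff_right hn.ne').1 this
    · intro h
      refine ⟨w, hw.bot_lt, ?_⟩
      rw [← map_nsmul, hker]
      have : w • x = - ∑ i ∈ Finset.range w, ((g ^ i) x - x) := by
        rw [Finset.sum_sub_distrib, ← cyclicNorm_apply, h]
        simp
      rw [this]
      exact neg_mem (sum_mem fun i _ => pow_sub_self_mem_range g _ _)
  let f : LinearMap.ker (cyclicNorm g w) →+ AddCommGroup.torsion Q :=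
    (q.comp (LinearMap.ker (cyclicNorm g w)).subtype.toAddMonoidHom).codRestrict _
      fun x => (key _).2 x.2
  have hf : Function.Surjective f := by
    rintro ⟨y, hy⟩
    obtain ⟨x, rfl⟩ := hq y
    exact ⟨⟨x, (key x).1 hy⟩, rfl⟩
  have hfk : f.ker = ((LinearMap.range (g - 1)).submoduleOf
      (LinearMap.ker (cyclicNorm g w))).toAddSubgroup := by
    ext x
    rw [AddMonoidHom.mem_ker, Submodule.mem_toAddSubgroup, Submodule.submoduleOf,
      Submodule.mem_comap, ← hker, ← Subtype.coe_inj]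
    rfl
  exact ⟨((QuotientAddGroup.quotientAddEquivOfEq hfk.symm).trans
    (QuotientAddGroup.quotientKerEquivOfSurjective f hf)).symm⟩

end cyclicNorm

section twistedShift

variable {R X A : Type*} [CommRing R] [AddCommGroup X] [Module R X] [CommGroup A]

/-- The action on functions `A → X` of translation by `γ` on `A` and of `g` on `X`. -/
def twistedShift (γ : A) (g : Module.End R X) : Module.End R (A → X) :=
  LinearMap.pi fun a => g ∘ₗ LinearMap.proj (γ⁻¹ * a)

/-- The constant functions `A → X`. -/
def constLinear (R X A : Type*) [CommRing R] [AddCommGroup X] [Module R X] : X →ₗ[R] (A → X) :=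
  LinearMap.pi fun _ => LinearMap.id

theorem twistedShift_apply (γ : A) (g : Module.End R X) (y : A → X) (a : A) :
    twistedShift γ g y a = g (y (γ⁻¹ * a)) := rfl

theorem twistedShift_pow_apply (γ : A) (g : Module.End R X) (n : ℕ) (y : A → X) (a : A) :
    (twistedShift γ g ^ n) y a = (g ^ n) (y ((γ ^ n)⁻¹ * a)) := by
  induction n generalizing a with
  | zero => simp
  | succ n ih =>
    rw [pow_succ', Module.End.mul_apply, twistedShift_apply, ih, pow_succ', Module.End.mul_apply,
      pow_succ, mul_inv, mul_assoc]

/-- A transversal of the orbits of translation by an element of finite order. -/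
theorem exists_orbit_transversal {γ : A} {w : ℕ} (hw : w ≠ 0) (hγ : orderOf γ = w) :
    ∃ T : Set A, ∀ a : A, ∃ i < w, (γ ^ i)⁻¹ * a ∈ T ∧
      ∀ j < w, (γ ^ j)⁻¹ * a ∈ T → j = i := by
  refine ⟨Set.range fun q : A ⧸ Subgroup.zpowers γ => q.out, fun a => ?_⟩
  have hmk : ∀ j : ℕ, (((γ ^ j)⁻¹ * a : A) : A ⧸ Subgroup.zpowers γ) = (a : A ⧸ _) := fun j => by
    rw [QuotientGroup.eq]
    exact ⟨j, by simp⟩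
  have hfin : IsOfFinOrder γ := by rw [← orderOf_pos_iff, hγ]; omega
  obtain ⟨k, hk⟩ : (a⁻¹ * ((a : A ⧸ Subgroup.zpowers γ)).out)⁻¹ ∈ Submonoid.powers γ := by
    rw [hfin.mem_powers_iff_mem_zpowers]
    exact inv_mem (QuotientGroup.eq.1 (QuotientGroup.out_eq' _).symm)
  have hk' : (γ ^ (k % w))⁻¹ * a = ((a : A ⧸ Subgroup.zpowers γ)).out := by
    rw [← hγ, pow_mod_orderOf, show γ ^ k = _ from hk]
    simp [mul_comm]
  refine ⟨k % w, Nat.mod_lt _ (by omega), ⟨_, hk'.symm⟩, ?_⟩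
  rintro j hj ⟨q, hq⟩
  have hqa : q = (a : A ⧸ Subgroup.zpowers γ) := by
    rw [← hmk j, ← hq, QuotientGroup.out_eq']
  have h2 : (γ ^ j)⁻¹ * a = (γ ^ (k % w))⁻¹ * a := by
    rw [hk', ← hqa]; exact hq.symm
  have h3 : γ ^ j = γ ^ (k % w) := inv_injective (mul_right_cancel h2)
  refine pow_injOn_Iio_orderOf ?_ ?_ h3
  · simpa [hγ] using hj
  · simpa [hγ] using Nat.mod_lt _ (by omega)

theorem twistedShift_pow_eq_one {γ : A} {g : Module.End R X} {w : ℕ} (hγ : orderOf γ = w)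
    (hg : g ^ w = 1) : twistedShift γ g ^ w = 1 := by
  ext y a
  rw [twistedShift_pow_apply, hg, ← hγ, pow_orderOf_eq_one]
  simp

/-- Functions on a group on which the cyclic group acts freely are acyclic. -/
theorem twistedShift_acyclic {γ : A} {g : Module.End R X} {w : ℕ} (hw : w ≠ 0)
    (hγ : orderOf γ = w) (hg : g ^ w = 1) :
    LinearMap.ker (cyclicNorm (twistedShift γ g) w) = LinearMap.range (twistedShift γ g - 1) ∧
    LinearMap.ker (twistedShift γ g - 1) = LinearMap.range (cyclicNorm (twistedShift γ g) w) := by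
  classical
  obtain ⟨T, hT⟩ := exists_orbit_transversal hw hγ
  let e : Module.End R (A → X) :=
    LinearMap.pi fun a => if a ∈ T then LinearMap.proj a else 0
  have he : ∀ y a, e y a = if a ∈ T then y a else 0 := fun y a => by
    simp only [e, LinearMap.pi_apply]
    split_ifs <;> rfl
  refine ker_eq_range_of_sum_conj_eq_one (e := e) (twistedShift_pow_eq_one hγ hg) ?_
  refine LinearMap.ext fun y => funext fun a => ?_
  have hterm : ∀ i ∈ Finset.range w,
      ((twistedShift γ g ^ i * e * twistedShift γ g ^ (w - i)) y) a =
        if (γ ^ i)⁻¹ * a ∈ T then y a else 0 := by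
    intro i hi
    rw [Finset.mem_range] at hi
    rw [Module.End.mul_apply, Module.End.mul_apply, twistedShift_pow_apply, he]
    split_ifs
    · rw [twistedShift_pow_apply, ← Module.End.mul_apply, ← pow_add, ← mul_assoc, ← mul_inv,
        ← pow_add, Nat.sub_add_cancel hi.le, Nat.add_sub_cancel' hi.le, hg, ← hγ,
        pow_orderOf_eq_one]
      simp
    · simp
  rw [LinearMap.sum_apply, Finset.sum_apply, Finset.sum_congr rfl hterm]
  obtain ⟨i, hi, hiT, huniq⟩ := hT a
  rw [Finset.sum_eq_single i]
  · rw [if_pos hiT]; rfl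
  · intro j hj hji
    rw [if_neg fun h => hji (huniq j (Finset.mem_range.1 hj) h)]
  · intro h
    exact absurd (Finset.mem_range.2 hi) h

end twistedShift

/-! ### The tensor product of the quotients `ℤ[A i] / (∑ a)` -/

/-- The functions on a product that are sums of functions each of which does not depend on one of
the coordinates. -/
def IsCylinderSum {R : Type*} [AddCommMonoid R] {t : ℕ} {A : Fin t → Type*}
    (f : (∀ i, A i) → R) : Prop :=
  ∃ d : Fin t → (∀ i, A i) → R,
    (∀ i a x, d i (Function.update a i x) = d i a) ∧ f = ∑ i, d i

universe u v

/-- Data `(X, g, π)` presenting the quotient `X` of the functions on `∏ A i` by the cylinder sums,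
together with the action `g` of translation by `γ`, the periodic cohomology of which is that of the
trivial module `R` shifted `t` times. -/
structure CylinderQuotient (R : Type v) [CommRing R] {t : ℕ} (A : Fin t → Type u)
    [∀ i, CommGroup (A i)] (γ : ∀ i, A i) (w : ℕ) (X : Type (max u v)) [AddCommGroup X]
    [Module R X] where
  /-- The action of translation by `γ`. -/
  g : Module.End R X
  /-- The quotient map. -/
  π : ((∀ i, A i) → R) →ₗ[R] X
  torsionFree : IsAddTorsionFree X
  surjective : Function.Surjective π
  map_shift : ∀ f, π (fun a => f (γ⁻¹ * a)) = g (π f)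
  map_eq_zero : ∀ f, π f = 0 ↔ IsCylinderSum f
  pow_eq_one : g ^ w = 1
  odd_equiv : Nonempty (kerModRange (cyclicNorm g w) (g - 1) ≃+
    R ⧸ Ideal.span {if Even t then (1 : R) else (w : R)})
  even_equiv : Nonempty (kerModRange (g - 1) (cyclicNorm g w) ≃+
    R ⧸ Ideal.span {if Even (t + 1) then (1 : R) else (w : R)})

/-- Without factors the quotient is `R` itself, with trivial action. -/
theorem exists_cylinderQuotient_zero (R : Type v) [CommRing R] [IsAddTorsionFree R]
    (A : Fin 0 → Type u) [∀ i, CommGroup (A i)] (γ : ∀ i, A i) {w : ℕ} (hw : w ≠ 0) :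
    Nonempty (CylinderQuotient R A γ w ((∀ i, A i) → R)) := by
  have hN : ∀ x : (∀ i, A i) → R, cyclicNorm (1 : Module.End R ((∀ i, A i) → R)) w x = w • x :=
    fun x => by simp [cyclicNorm_apply]
  refine ⟨{ g := 1, π := LinearMap.id, torsionFree := inferInstance,
            surjective := Function.surjective_id, map_shift := ?_, map_eq_zero := ?_,
            pow_eq_one := one_pow w, odd_equiv := ?_, even_equiv := ?_ }⟩
  · intro f
    refine funext fun a => congrArg f (Subsingleton.elim _ _)
  · intro f
    rw [LinearMap.id_apply]
    constructor
    · rintro rfl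
      exact ⟨fun i => i.elim0, fun i => i.elim0, by simp⟩
    · rintro ⟨d, -, rfl⟩
      simp
  · have h1 : Subsingleton (LinearMap.ker
        (cyclicNorm (1 : Module.End R ((∀ i, A i) → R)) w)) := by
      refine ⟨fun x y => Subtype.ext ?_⟩
      have h : ∀ z : LinearMap.ker (cyclicNorm (1 : Module.End R ((∀ i, A i) → R)) w),
          (z : (∀ i, A i) → R) = 0 := fun z => by
        have := z.2
        rw [LinearMap.mem_ker, hN] at this
        exact (nsmul_eq_zero_iff_right hw).1 this
      rw [h x, h y]
    have h2 : Subsingleton (R ⧸ Ideal.span {(1 : R)}) :=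
      Ideal.Quotient.subsingleton_iff.2 (Ideal.span_singleton_one)
    have h3 : Subsingleton (kerModRange (cyclicNorm (1 : Module.End R ((∀ i, A i) → R)) w)
        (1 - 1)) := (Submodule.mkQ_surjective _).subsingleton
    rw [if_pos (by simp)]
    exact ⟨{ (0 : kerModRange (cyclicNorm (1 : Module.End R ((∀ i, A i) → R)) w) (1 - 1) →+
              R ⧸ Ideal.span {(1 : R)}) with
            invFun := 0
            left_inv := fun _ => Subsingleton.elim _ _
            right_inv := fun _ => Subsingleton.elim _ _ }⟩
  · rw [if_neg (by simp)]
    let f : LinearMap.ker ((1 : Module.End R ((∀ i, A i) → R)) - 1) →ₗ[R]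
        R ⧸ Ideal.span {(w : R)} :=
      (Ideal.span {(w : R)}).mkQ ∘ₗ LinearMap.proj default ∘ₗ Submodule.subtype _
    have hf : Function.Surjective f := by
      refine (Submodule.mkQ_surjective _).comp fun r => ⟨⟨fun _ => r, by simp⟩, rfl⟩
    have hk : LinearMap.ker f = (LinearMap.range
        (cyclicNorm (1 : Module.End R ((∀ i, A i) → R)) w)).submoduleOf _ := by
      ext x
      rw [LinearMap.mem_ker, LinearMap.comp_apply, Submodule.mkQ_apply,
        Submodule.Quotient.mk_eq_zero, Ideal.mem_span_singleton', Submodule.submoduleOf,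
        Submodule.mem_comap, LinearMap.mem_range]
      constructor
      · rintro ⟨r, hr⟩
        refine ⟨fun _ => r, funext fun a => ?_⟩
        rw [hN, Subsingleton.elim a default]
        simpa [mul_comm] using hr
      · rintro ⟨r, hr⟩
        refine ⟨r default, ?_⟩
        have := congrFun hr default
        rw [hN] at this
        simpa [mul_comm] using this
    exact ⟨((Submodule.quotEquivOfEq _ _ hk.symm).trans
      (LinearMap.quotKerEquivOfSurjective f hf)).toAddEquiv⟩

/-- Passing from `X` to `(A → X) / X` shifts the degree of the cohomology by one. -/
theorem CylinderQuotient.exists_succ {R : Type v} [CommRing R] {t : ℕ} {A : Fin (t + 1) → Type u}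
    [∀ i, CommGroup (A i)] {γ : ∀ i, A i} {w : ℕ} (hw : w ≠ 0) (hγ : orderOf (γ 0) = w)
    {X : Type (max u v)} [AddCommGroup X] [Module R X]
    (c : CylinderQuotient R (fun i => A i.succ) (fun i => γ i.succ) w X) :
    Nonempty (CylinderQuotient R A γ w ((A 0 → X) ⧸ LinearMap.range (constLinear R X (A 0)))) := by
  have := c.torsionFree
  set S := LinearMap.range (constLinear R X (A 0)) with hS
  have hSmem : ∀ y : A 0 → X, y ∈ S ↔ ∃ x, ∀ a, y a = x := fun y => by
    rw [hS, LinearMap.mem_range]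
    exact exists_congr fun x => ⟨fun h a => (congrFun h a).symm, fun h => (funext h).symm⟩
  let G := twistedShift (γ 0) c.g
  have hGS : S ≤ S.comap G := by
    intro y hy
    obtain ⟨x, hx⟩ := (hSmem y).1 hy
    exact (hSmem _).2 ⟨c.g x, fun a => by rw [twistedShift_apply, hx]⟩
  let g' : Module.End R ((A 0 → X) ⧸ S) := S.mapQ S G hGS
  have hg' : ∀ y, g' (S.mkQ y) = S.mkQ (G y) := fun y => rfl
  have hg'n : ∀ (n : ℕ) y, (g' ^ n) (S.mkQ y) = S.mkQ ((G ^ n) y) := fun n => by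
    induction n with
    | zero => intro y; rfl
    | succ n ih => intro y; rw [pow_succ, Module.End.mul_apply, hg', ih, pow_succ]; rfl
  have hNq : ∀ y, S.mkQ (cyclicNorm G w y) = cyclicNorm g' w (S.mkQ y) := fun y => by
    rw [cyclicNorm_apply, cyclicNorm_apply, map_sum]
    exact Finset.sum_congr rfl fun i _ => (hg'n i y).symm
  have hDq : ∀ y, S.mkQ ((G - 1) y) = (g' - 1) (S.mkQ y) := fun y => by
    rw [LinearMap.sub_apply, LinearMap.sub_apply, map_sub, hg']; rfl
  have hGn : ∀ (n : ℕ) x, (G ^ n) (constLinear R X (A 0) x) = constLinear R X (A 0) ((c.g ^ n) x) :=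
    fun n x => funext fun a => by rw [twistedShift_pow_apply]; rfl
  have hNc : ∀ x, cyclicNorm G w (constLinear R X (A 0) x) =
      constLinear R X (A 0) (cyclicNorm c.g w x) := fun x => by
    rw [cyclicNorm_apply, cyclicNorm_apply, map_sum]
    exact Finset.sum_congr rfl fun i _ => hGn i x
  have hDc : ∀ x, (G - 1) (constLinear R X (A 0) x) = constLinear R X (A 0) ((c.g - 1) x) :=
    fun x => by
      rw [LinearMap.sub_apply, LinearMap.sub_apply, map_sub]
      congr 1
  have hinj : Function.Injective (constLinear R X (A 0)) := fun x y h => congrFun h 1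
  have hker : LinearMap.ker S.mkQ = LinearMap.range (constLinear R X (A 0)) := by
    rw [Submodule.ker_mkQ]
  obtain ⟨hac1, hac2⟩ := twistedShift_acyclic (X := X) hw hγ c.pow_eq_one
  let π : ((∀ i, A i) → R) →ₗ[R] ((A 0 → X) ⧸ S) := S.mkQ ∘ₗ
    LinearMap.pi fun a₀ => c.π ∘ₗ LinearMap.funLeft R R fun b => Fin.cons a₀ b
  have hπ : ∀ f, π f = S.mkQ fun a₀ => c.π fun b => f (Fin.cons a₀ b) := fun f => rfl
  refine ⟨{ g := g', π := π, torsionFree := ?_, surjective := ?_, map_shift := ?_,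
            map_eq_zero := ?_, pow_eq_one := ?_, odd_equiv := ?_, even_equiv := ?_ }⟩
  · refine ⟨fun n hn z z' h => ?_⟩
    rw [← sub_eq_zero]
    replace h : n • (z - z') = 0 := by rw [nsmul_sub]; exact sub_eq_zero.2 h
    obtain ⟨y, hy⟩ := S.mkQ_surjective (z - z')
    rw [← hy] at h ⊢
    rw [← map_nsmul, Submodule.mkQ_apply, Submodule.Quotient.mk_eq_zero, hSmem] at h
    rw [Submodule.mkQ_apply, Submodule.Quotient.mk_eq_zero, hSmem]
    obtain ⟨x, hx⟩ := h
    refine ⟨y 1, fun a => nsmul_right_injective hn ?_⟩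
    exact (hx a).trans (hx 1).symm
  · intro z
    obtain ⟨y, rfl⟩ := S.mkQ_surjective z
    choose h hh using fun a₀ => c.surjective (y a₀)
    refine ⟨fun a => h (a 0) (Fin.tail a), ?_⟩
    rw [hπ]
    congr 1
    exact funext fun a₀ => hh a₀
  · intro f
    rw [hπ, hπ, hg']
    congr 1
    funext a₀
    rw [twistedShift_apply, ← c.map_shift]
    congr 1
    funext b
    congr 1
    funext i
    refine Fin.cases ?_ (fun i => ?_) i <;> simp
  · intro f
    rw [hπ, Submodule.mkQ_apply, Submodule.Quotient.mk_eq_zero, hSmem]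
    constructor
    · rintro ⟨x, hx⟩
      obtain ⟨h, rfl⟩ := c.surjective x
      have hcyl : ∀ a₀, IsCylinderSum fun b => f (Fin.cons a₀ b) - h b := fun a₀ => by
        rw [← c.map_eq_zero]
        exact (map_sub c.π (fun b => f (Fin.cons a₀ b)) h).trans (sub_eq_zero.2 (hx a₀))
      choose d hd hdf using hcyl
      refine ⟨Fin.cons (fun a => h (Fin.tail a)) fun i a => d (a 0) i (Fin.tail a), ?_, ?_⟩
      · intro i
        refine Fin.cases ?_ (fun i => ?_) i
        · intro a x
          simp only [Fin.cons_zero]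
          rw [Fin.tail_update_zero]
        · intro a x
          simp only [Fin.cons_succ]
          rw [Fin.tail_update_succ, hd, Function.update_of_ne (Fin.succ_ne_zero i).symm]
      · funext a
        have := congrFun (hdf (a 0)) (Fin.tail a)
        rw [Fin.cons_self_tail, Finset.sum_apply, sub_eq_iff_eq_add'] at this
        rw [this, Fin.sum_univ_succ, Pi.add_apply, Finset.sum_apply]
        rfl
    · rintro ⟨d, hd, rfl⟩
      refine ⟨c.π fun b => d 0 (Fin.cons 1 b), fun a₀ => ?_⟩
      have h1 : (fun b => (∑ i, d i) (Fin.cons a₀ b)) =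
          (fun b => d 0 (Fin.cons 1 b)) + ∑ i : Fin t, fun b => d i.succ (Fin.cons a₀ b) := by
        funext b
        rw [Finset.sum_apply, Fin.sum_univ_succ, Pi.add_apply, Finset.sum_apply]
        congr 1
        rw [← hd 0 _ (1 : A 0), Fin.update_cons_zero]
      rw [h1, map_add, (c.map_eq_zero (∑ i : Fin t, fun b => d i.succ (Fin.cons a₀ b))).2, add_zero]
      refine ⟨fun i b => d i.succ (Fin.cons a₀ b), fun i b x => ?_, rfl⟩
      change d i.succ (Fin.cons a₀ (Function.update b i x)) = _
      rw [Fin.cons_update, hd]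
  · refine LinearMap.ext fun z => ?_
    obtain ⟨y, rfl⟩ := S.mkQ_surjective z
    rw [hg'n, twistedShift_pow_eq_one hγ c.pow_eq_one]
    rfl
  · obtain ⟨e⟩ := nonempty_kerModRange_equiv_of_exact hinj S.mkQ_surjective hker hNc hDc hNq hDq
      hac1 hac2
    obtain ⟨e'⟩ := c.even_equiv
    exact ⟨e.toAddEquiv.trans e'⟩
  · obtain ⟨e⟩ := nonempty_kerModRange_equiv_of_exact hinj S.mkQ_surjective hker hDc hNc hDq hNq
      hac2 hac1
    obtain ⟨e'⟩ := c.odd_equiv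
    refine ⟨e.toAddEquiv.trans (e'.trans (Submodule.quotEquivOfEq _ _ ?_).toAddEquiv)⟩
    simp only [show Even (t + 1 + 1) ↔ Even t by grind]

theorem exists_cylinderQuotient (R : Type v) [CommRing R] [IsAddTorsionFree R] {t : ℕ}
    (A : Fin t → Type u) [∀ i, CommGroup (A i)] (γ : ∀ i, A i) {w : ℕ} (hw : w ≠ 0)
    (hγ : ∀ i, orderOf (γ i) = w) :
    ∃ (X : Type (max u v)) (_ : AddCommGroup X) (_ : Module R X),
      Nonempty (CylinderQuotient R A γ w X) := by
  induction t with
  | zero => exact ⟨_, _, _, exists_cylinderQuotient_zero R A γ hw⟩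
  | succ t ih =>
    obtain ⟨X, _, _, ⟨c⟩⟩ := ih (fun i => A i.succ) (fun i => γ i.succ) fun i => hγ i.succ
    exact ⟨_, _, _, c.exists_succ hw (hγ 0)⟩

/-! ### Torsion in a quotient of the group ring -/

section groupRing

theorem elementSum_range {G H : Type*} [Group G] [Fintype H] {f : H → G}
    (hf : Function.Injective f) :
    elementSum (Set.range f) = ∑ h, MonoidAlgebra.of ℤ G (f h) := by
  rw [elementSum, finsum_mem_range hf, finsum_eq_sum_of_fintype]

variable {t : ℕ} {A : Fin t → Type u} [∀ i, CommGroup (A i)] {Γ : Type v} [Group Γ]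

theorem IsCylinderSum.shift {R : Type*} [AddCommMonoid R] {f : (∀ i, A i) → R}
    (hf : IsCylinderSum f) (b : ∀ i, A i) : IsCylinderSum fun a => f (b⁻¹ * a) := by
  obtain ⟨d, hd, rfl⟩ := hf
  refine ⟨fun i a => d i (b⁻¹ * a), fun i a x => ?_, by ext a; simp⟩
  beta_reduce
  rw [show b⁻¹ * Function.update a i x = Function.update (b⁻¹ * a) i ((b i)⁻¹ * x) from ?_, hd]
  ext j
  rcases eq_or_ne j i with rfl | hj
  · simp
  · simp [hj]

/-- The image in `ℤ[Γ]` of a function on a finite group, regarded as an element of its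
group ring. -/
noncomputable def pushForward [∀ i, Fintype (A i)] (ψ : (∀ i, A i) →* Γ) :
    ((∀ i, A i) → ℤ) →+ MonoidAlgebra ℤ Γ where
  toFun f := ∑ a, MonoidAlgebra.single (ψ a) (f a)
  map_zero' := by simp
  map_add' f f' := by simp [Finset.sum_add_distrib, MonoidAlgebra.single_add]

variable [∀ i, Fintype (A i)] {ψ : (∀ i, A i) →* Γ}

theorem pushForward_apply (f : (∀ i, A i) → ℤ) :
    pushForward ψ f = ∑ a, MonoidAlgebra.single (ψ a) (f a) := rfl

theorem pushForward_single [∀ i, DecidableEq (A i)] (a : ∀ i, A i) (n : ℤ) :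
    pushForward ψ (Pi.single a n) = MonoidAlgebra.single (ψ a) n := by
  rw [pushForward_apply, Finset.sum_eq_single a]
  · simp
  · intro b _ hb
    simp [Pi.single_eq_of_ne hb]
  · simp

theorem pushForward_surjective (hψ : Function.Surjective ψ) :
    Function.Surjective (pushForward ψ) := by
  classical
  intro x
  induction x using MonoidAlgebra.induction_linear with
  | zero => exact ⟨0, map_zero _⟩
  | add x y hx hy =>
    obtain ⟨f, rfl⟩ := hx
    obtain ⟨f', rfl⟩ := hy
    exact ⟨f + f', map_add _ _ _⟩
  | single g n =>
    obtain ⟨a, rfl⟩ := hψ g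
    exact ⟨Pi.single a n, pushForward_single a n⟩

theorem pushForward_shift (f : (∀ i, A i) → ℤ) (b : ∀ i, A i) :
    pushForward ψ (fun a => f (b⁻¹ * a)) = MonoidAlgebra.single (ψ b) 1 * pushForward ψ f := by
  rw [pushForward_apply, pushForward_apply, Finset.mul_sum,
    ← Equiv.sum_comp (Equiv.mulLeft b)]
  refine Finset.sum_congr rfl fun a _ => ?_
  simp [MonoidAlgebra.single_mul_single]

theorem pushForward_cylinder_mem {i : Fin t} {d : (∀ i, A i) → ℤ}
    (hd : ∀ a x, d (Function.update a i x) = d a) {S : Ideal (MonoidAlgebra ℤ Γ)}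
    (hS : ∑ x : A i, MonoidAlgebra.of ℤ Γ (ψ (Pi.mulSingle i x)) ∈ S) :
    pushForward ψ d ∈ S := by
  classical
  -- Sum over the fibres `c * A i`, where `c` has trivial `i`-th coordinate.
  let e := Equiv.piSplitAt i A
  let c : (∀ j : {j // j ≠ i}, A j) → ∀ j, A j := fun b => e.symm (1, b)
  have he : ∀ x b, e.symm (x, b) = c b * Pi.mulSingle i x := by
    intro x b
    ext j
    rcases eq_or_ne j i with rfl | hj
    · simp [c, e, Equiv.piSplitAt]
    · simp [c, e, Equiv.piSplitAt, hj]
  have he' : ∀ x b, e.symm (x, b) = Function.update (c b) i x := by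
    intro x b
    ext j
    rcases eq_or_ne j i with rfl | hj
    · simp [e, Equiv.piSplitAt]
    · simp [c, e, Equiv.piSplitAt, hj]
  rw [pushForward_apply, ← Equiv.sum_comp e.symm, Fintype.sum_prod_type_right]
  refine sum_mem fun b _ => ?_
  have : ∑ x : A i, MonoidAlgebra.single (ψ (e.symm (x, b))) (d (e.symm (x, b))) =
      MonoidAlgebra.single (ψ (c b)) (d (c b)) *
        ∑ x : A i, MonoidAlgebra.of ℤ Γ (ψ (Pi.mulSingle i x)) := by
    rw [Finset.mul_sum]
    refine Finset.sum_congr rfl fun x _ => ?_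
    rw [MonoidAlgebra.of_apply, MonoidAlgebra.single_mul_single, ← map_mul, ← he, he', hd, mul_one]
  rw [this]
  exact S.mul_mem_left _ hS

theorem exists_cylinderSum_pushForward_eq (hψ : Function.Surjective ψ)
    {x : MonoidAlgebra ℤ Γ} (hx : x ∈ Ideal.span (Set.range fun i : Fin t =>
      ∑ x : A i, MonoidAlgebra.of ℤ Γ (ψ (Pi.mulSingle i x)))) :
    ∃ f, IsCylinderSum f ∧ pushForward ψ f = x := by
  classical
  have hzero : IsCylinderSum (0 : (∀ i, A i) → ℤ) := ⟨0, by simp, by simp⟩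
  have hadd : ∀ f f' : (∀ i, A i) → ℤ, IsCylinderSum f → IsCylinderSum f' →
      IsCylinderSum (f + f') := by
    rintro _ _ ⟨d, hd, rfl⟩ ⟨d', hd', rfl⟩
    exact ⟨d + d', fun i a x => by simp [hd, hd'], by simp [Finset.sum_add_distrib]⟩
  have hsmul : ∀ (n : ℤ) (f : (∀ i, A i) → ℤ), IsCylinderSum f → IsCylinderSum (n • f) := by
    rintro n _ ⟨d, hd, rfl⟩
    exact ⟨n • d, fun i a x => by simp [hd], by simp [Finset.smul_sum]⟩
  induction hx using Submodule.span_induction with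
  | mem x hx =>
    obtain ⟨i, rfl⟩ := hx
    let P : (∀ i, A i) → Prop := fun a => ∀ j ≠ i, a j = 1
    refine ⟨fun a => if P a then 1 else 0,
      ⟨Pi.single i fun a => if P a then 1 else 0, fun j a x => ?_, ?_⟩, ?_⟩
    · rcases eq_or_ne j i with rfl | hj
      · simp only [Pi.single_eq_same]
        have : P (Function.update a j x) ↔ P a :=
          forall₂_congr fun k hk => by rw [Function.update_of_ne hk]
        simp only [this]
      · rw [Pi.single_eq_of_ne hj]; rfl
    · rw [Finset.sum_pi_single']
      simp
    · rw [pushForward_apply]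
      symm
      refine Finset.sum_of_injOn (fun x => Pi.mulSingle i x) ?_ ?_ ?_ ?_
      · exact (Pi.mulSingle_injective i).injOn
      · intro x _; simp
      · intro a _ ha
        rw [if_neg, MonoidAlgebra.single_zero]
        intro hP
        refine ha ⟨a i, by simp, ?_⟩
        ext j
        rcases eq_or_ne j i with rfl | hj
        · simp
        · simp [hj, hP j hj]
      · intro x _
        rw [if_pos, MonoidAlgebra.of_apply]
        intro j hj
        exact Pi.mulSingle_eq_of_ne hj x
  | zero => exact ⟨0, hzero, map_zero _⟩
  | add x y _ _ hx hy =>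
    obtain ⟨f, hf, rfl⟩ := hx
    obtain ⟨f', hf', rfl⟩ := hy
    exact ⟨f + f', hadd _ _ hf hf', map_add _ _ _⟩
  | smul r x _ hx =>
    obtain ⟨f, hf, rfl⟩ := hx
    induction r using MonoidAlgebra.induction_linear with
    | zero => exact ⟨0, hzero, by simp⟩
    | add r r' hr hr' =>
      obtain ⟨f₁, hf₁, h₁⟩ := hr
      obtain ⟨f₂, hf₂, h₂⟩ := hr'
      exact ⟨f₁ + f₂, hadd _ _ hf₁ hf₂, by rw [map_add, h₁, h₂, add_smul]⟩
    | single g n =>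
      obtain ⟨b, rfl⟩ := hψ g
      refine ⟨n • fun a => f (b⁻¹ * a), hsmul _ _ (hf.shift b), ?_⟩
      rw [map_zsmul, pushForward_shift, smul_eq_mul, ← smul_mul_assoc]
      simp

/-- For `Γ = ∏ A i / ⟨γ⟩` with the components of `γ` all of order `w`, the torsion of the quotient
of `ℤ[Γ]` by the traces of the factors `A i` is periodic in the number `t ≠ 1` of factors. -/
theorem nonempty_torsion_quotient_equiv {w : ℕ} (hw : w ≠ 0) (ht : t ≠ 1) {γ : ∀ i, A i}
    (hγ : ∀ i, orderOf (γ i) = w) (hψ : Function.Surjective ψ)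
    (hker : ψ.ker = Subgroup.zpowers γ) {S : Ideal (MonoidAlgebra ℤ Γ)}
    (hS : S = Ideal.span (Set.range fun i : Fin t =>
      elementSum (Set.range fun x : A i => ψ (Pi.mulSingle i x)))) :
    Nonempty (AddCommGroup.torsion (MonoidAlgebra ℤ Γ ⧸ S) ≃+ ZMod (if Even t then 1 else w)) := by
  classical
  have hfin : IsOfFinOrder γ := isOfFinOrder_of_finite γ
  -- With at least two factors no nontrivial power of `γ` lies in a single factor.
  have hinj : ∀ i, Function.Injective fun x : A i => ψ (Pi.mulSingle i x) := by
    intro i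
    refine (injective_iff_map_eq_one (ψ.comp (MonoidHom.mulSingle A i))).2 fun x hx => ?_
    have hx' : Pi.mulSingle i x ∈ ψ.ker := hx
    rw [hker] at hx'
    obtain ⟨k, hk⟩ := hx'
    have : Nontrivial (Fin t) := Fin.nontrivial_iff_two_le.2 (by have := i.pos; omega)
    obtain ⟨j, hj⟩ := exists_ne i
    have h1 : γ j ^ k = 1 := by
      have := congrFun hk j
      simpa [hj] using this
    have h2 : γ i ^ k = x := by
      have := congrFun hk i
      simpa using this
    rw [← h2, ← orderOf_dvd_iff_zpow_eq_one, hγ i, ← hγ j, orderOf_dvd_iff_zpow_eq_one, h1]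
  have hS' : S = Ideal.span (Set.range fun i : Fin t =>
      ∑ x : A i, MonoidAlgebra.of ℤ Γ (ψ (Pi.mulSingle i x))) := by
    rw [hS]
    congr 2
    exact funext fun i => elementSum_range (hinj i)
  obtain ⟨X, _, instX, ⟨c⟩⟩ := exists_cylinderQuotient ℤ A γ hw hγ
  obtain rfl : instX = AddCommGroup.toIntModule X := Subsingleton.elim _ _
  have := c.torsionFree
  have hgpow : ∀ (k : ℕ) f, c.π (fun a => f ((γ ^ k)⁻¹ * a)) = (c.g ^ k) (c.π f) := by
    intro k
    induction k with
    | zero => intro f; simp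
    | succ k ih =>
      intro f
      rw [pow_succ c.g, Module.End.mul_apply, ← c.map_shift, ← ih]
      congr 1
      funext a
      rw [pow_succ, mul_inv_rev, mul_assoc]
  let s : Γ → ∀ i, A i := fun x => (hψ x).choose
  have hs : ∀ x, ψ (s x) = x := fun x => (hψ x).choose_spec
  let Λ : MonoidAlgebra ℤ Γ →+ X := (Finsupp.liftAddHom fun x =>
    zmultiplesHom X (c.π (Pi.single (s x) 1))).comp MonoidAlgebra.coeffAddEquiv.toAddMonoidHom
  have hΛ : ∀ x n, Λ (MonoidAlgebra.single x n) = n • c.π (Pi.single (s x) 1) := by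
    intro x n
    simp [Λ]
  -- Modulo `g - 1`, the map `π` factors through `pushForward ψ`.
  have hmod : ∀ f, c.π f - Λ (pushForward ψ f) ∈ LinearMap.range (c.g - 1) := by
    intro f
    have hf : f = ∑ a, f a • (Pi.single a 1 : (∀ i, A i) → ℤ) := by
      ext b
      simp [Finset.sum_apply, Pi.single_apply]
    have h1 : c.π f = ∑ a, f a • c.π (Pi.single a 1) := by
      conv_lhs => rw [hf]
      rw [map_sum]
      exact Finset.sum_congr rfl fun a _ => map_zsmul c.π _ _
    rw [h1, pushForward_apply, map_sum, ← Finset.sum_sub_distrib]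
    refine sum_mem fun a _ => ?_
    rw [hΛ, ← smul_sub]
    refine Submodule.smul_mem _ _ ?_
    have : a * (s (ψ a))⁻¹ ∈ ψ.ker := by
      rw [MonoidHom.mem_ker, map_mul, map_inv, hs, mul_inv_cancel]
    rw [hker, ← hfin.mem_powers_iff_mem_zpowers] at this
    obtain ⟨k, hk⟩ := this
    have hk' : a = γ ^ k * s (ψ a) := by
      rw [show γ ^ k = _ from hk]; simp
    have h2 : (Pi.single a 1 : (∀ i, A i) → ℤ) =
        fun b => (Pi.single (s (ψ a)) 1 : (∀ i, A i) → ℤ) ((γ ^ k)⁻¹ * b) := by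
      funext b
      rw [Pi.single_apply, Pi.single_apply]
      congr 1
      rw [inv_mul_eq_iff_eq_mul, ← hk']
    rw [h2, hgpow]
    exact pow_sub_self_mem_range _ _ _
  let mkS : MonoidAlgebra ℤ Γ →+ MonoidAlgebra ℤ Γ ⧸ S := S.mkQ.toAddMonoidHom
  have hmkS : ∀ x, mkS x = 0 ↔ x ∈ S := fun x => Submodule.Quotient.mk_eq_zero S
  have hcyl : ∀ f, IsCylinderSum f → pushForward ψ f ∈ S := by
    rintro _ ⟨d, hd, rfl⟩
    rw [map_sum]
    refine sum_mem fun i _ => pushForward_cylinder_mem (hd i) ?_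
    rw [hS']
    exact Ideal.subset_span ⟨i, rfl⟩
  have hshift : ∀ f, pushForward ψ (fun a => f (γ⁻¹ * a)) = pushForward ψ f := by
    intro f
    have : ψ γ = 1 := by
      rw [← MonoidHom.mem_ker, hker]; exact Subgroup.mem_zpowers γ
    rw [pushForward_shift, this, ← MonoidAlgebra.one_def, one_mul]
  let q₀ : ((∀ i, A i) → ℤ) →+ MonoidAlgebra ℤ Γ ⧸ S := mkS.comp (pushForward ψ)
  have hq₀ : ∀ f, q₀ f = 0 ↔ c.π f ∈ LinearMap.range (c.g - 1) := by
    intro f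
    change mkS (pushForward ψ f) = 0 ↔ _
    rw [hmkS]
    constructor
    · intro h
      rw [hS'] at h
      obtain ⟨f', hf', he⟩ := exists_cylinderSum_pushForward_eq hψ h
      have h1 := hmod (f - f')
      rw [map_sub (pushForward ψ), he, sub_self, map_zero, sub_zero, map_sub,
        (c.map_eq_zero f').2 hf', sub_zero] at h1
      exact h1
    · rintro ⟨x, hx⟩
      obtain ⟨h, rfl⟩ := c.surjective x
      have h1 : c.π (f - ((fun a => h (γ⁻¹ * a)) - h)) = 0 := by
        rw [map_sub, map_sub, c.map_shift, ← hx]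
        simp
      have h2 := hcyl _ ((c.map_eq_zero _).1 h1)
      rwa [map_sub, map_sub, hshift, sub_self, sub_zero] at h2
  have hle : c.π.toAddMonoidHom.ker ≤ q₀.ker := by
    intro f hf
    rw [AddMonoidHom.mem_ker, hq₀, show c.π f = 0 from hf]
    exact zero_mem _
  let q : X →+ MonoidAlgebra ℤ Γ ⧸ S := c.π.toAddMonoidHom.liftOfSurjective c.surjective ⟨q₀, hle⟩
  have hq : ∀ f, q (c.π f) = q₀ f := fun f =>
    AddMonoidHom.liftOfRightInverse_comp_apply c.π.toAddMonoidHom _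
      (Function.rightInverse_surjInv c.surjective) ⟨q₀, hle⟩ f
  have hqsurj : Function.Surjective q := by
    intro y
    obtain ⟨x, rfl⟩ := S.mkQ_surjective y
    obtain ⟨f, rfl⟩ := pushForward_surjective hψ x
    exact ⟨c.π f, hq f⟩
  obtain ⟨e⟩ := nonempty_torsion_coinvariants_equiv c.pow_eq_one hw hqsurj fun x => by
    obtain ⟨f, rfl⟩ := c.surjective x
    rw [hq, hq₀]
  obtain ⟨e'⟩ := c.odd_equiv
  refine ⟨e.trans (e'.trans ((Ideal.quotEquivOfEq ?_).toAddEquiv.trans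
    (Int.quotientSpanNatEquivZMod _).toAddEquiv))⟩
  split_ifs <;> simp

end groupRing

/-- The quotient of `ℤ[Γ]` by its trace is torsion-free, as the multiples of the trace are the
elements with constant coefficients. -/
theorem torsion_quotient_span_elementSum_univ {Γ : Type*} [Group Γ] [Finite Γ] :
    AddCommGroup.torsion (MonoidAlgebra ℤ Γ ⧸
      (Ideal.span {elementSum Set.univ} : Ideal (MonoidAlgebra ℤ Γ))) = ⊥ := by
  classical
  have := Fintype.ofFinite Γ
  have hN : elementSum (Set.univ : Set Γ) = ∑ g, MonoidAlgebra.of ℤ Γ g := by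
    rw [elementSum, finsum_mem_univ, finsum_eq_sum_of_fintype]
  have hNc : ∀ h, (elementSum (Set.univ : Set Γ)).coeff h = 1 := by
    intro h
    rw [hN]
    simp [MonoidAlgebra.coeff_sum, Finsupp.single_apply]
  have hconst : ∀ y ∈ (Ideal.span {elementSum Set.univ} : Ideal (MonoidAlgebra ℤ Γ)),
      ∀ g h, y.coeff g = y.coeff h := by
    intro y hy
    obtain ⟨r, rfl⟩ := Ideal.mem_span_singleton'.1 hy
    induction r using MonoidAlgebra.induction_linear with
    | zero => intro g h; simp
    | add r r' hr hr' =>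
      intro g h
      rw [add_mul, MonoidAlgebra.coeff_add, Finsupp.add_apply, Finsupp.add_apply,
        hr (Ideal.mul_mem_left _ _ (Ideal.mem_span_singleton_self _)) g h,
        hr' (Ideal.mul_mem_left _ _ (Ideal.mem_span_singleton_self _)) g h]
    | single k n =>
      intro g h
      simp [MonoidAlgebra.coeff_single_mul_apply, hNc]
  rw [eq_bot_iff]
  intro z hz
  obtain ⟨x, rfl⟩ := Submodule.Quotient.mk_surjective _ z
  obtain ⟨n, hn, hnx⟩ := isOfFinAddOrder_iff_nsmul_eq_zero.1 hz
  rw [← Submodule.Quotient.mk_smul, Submodule.Quotient.mk_eq_zero] at hnx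
  rw [AddSubgroup.mem_bot, Submodule.Quotient.mk_eq_zero]
  have hx : ∀ g, x.coeff g = x.coeff 1 := by
    intro g
    have := hconst _ hnx g 1
    simp only [MonoidAlgebra.coeff_smul, Finsupp.smul_apply] at this
    exact nsmul_right_injective hn.ne' this
  have : x = MonoidAlgebra.single 1 (x.coeff 1) * elementSum Set.univ := by
    ext g
    simp [MonoidAlgebra.coeff_single_mul_apply, hNc, hx g]
  rw [this]
  exact Ideal.mul_mem_left _ _ (Ideal.mem_span_singleton_self _)

/-! ### Primes that do not split -/

section zeta

open Filter Topology ENNReal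

variable (K : Type*) [Field K] [NumberField K]

/-- The Dirichlet series `∑ N(I) ^ (-s)` over the nonzero ideals `I` divisible by none of the primes
in `S`. -/
noncomputable def idealZeta (S : Finset (HeightOneSpectrum (𝓞 K))) (s : ℝ) : ℝ≥0∞ :=
  ∑' I : Ideal (𝓞 K), Set.indicator {I | I ≠ ⊥ ∧ ∀ v ∈ S, ¬ v.asIdeal ∣ I}
    (fun I => (Ideal.absNorm I : ℝ≥0∞) ^ (-s)) I

theorem idealZeta_empty_eq_tsum (s : ℝ) :
    idealZeta K ∅ s = ∑' n : ℕ, if n = 0 then 0 else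
      (Nat.card {I : Ideal (𝓞 K) // Ideal.absNorm I = n} : ℝ≥0∞) * (n : ℝ≥0∞) ^ (-s) := by
  rw [idealZeta, ← (Equiv.sigmaFiberEquiv (Ideal.absNorm : Ideal (𝓞 K) → ℕ)).tsum_eq,
    ENNReal.tsum_sigma']
  congr 1
  funext n
  have h1 : ∀ I : {I : Ideal (𝓞 K) // Ideal.absNorm I = n},
      Set.indicator {I : Ideal (𝓞 K) | I ≠ ⊥ ∧ ∀ v ∈ (∅ : Finset (HeightOneSpectrum (𝓞 K))),
        ¬ v.asIdeal ∣ I} (fun I => (Ideal.absNorm I : ℝ≥0∞) ^ (-s)) I =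
        if n = 0 then 0 else (n : ℝ≥0∞) ^ (-s) := by
    rintro ⟨I, rfl⟩
    by_cases hI : I = ⊥
    · simp [hI]
    · simp [hI, Ideal.absNorm_eq_zero_iff]
  refine (tsum_congr h1).trans ?_
  split_ifs with hn
  · simp
  · have : Finite {I : Ideal (𝓞 K) // Ideal.absNorm I = n} :=
      (Ideal.finite_setOfPred_absNorm_eq n).to_subtype
    rw [ENNReal.tsum_const, ENat.card_eq_coe_natCard]
    simp

theorem tendsto_sub_one_mul_idealZeta :
    Tendsto (fun s : ℝ => ENNReal.ofReal (s - 1) * idealZeta K ∅ s) (𝓝[>] 1)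
      (𝓝 (ENNReal.ofReal (dedekindZeta_residue K))) := by
  have hlim := tendsto_sub_one_mul_dedekindZeta_nhdsGT K
  have hne : ∀ᶠ s : ℝ in 𝓝[>] 1, ((s : ℂ) - 1) * dedekindZeta K s ≠ 0 :=
    hlim.eventually_ne (by exact_mod_cast dedekindZeta_residue_ne_zero K)
  have hre := ENNReal.tendsto_ofReal ((Complex.continuous_re.tendsto _).comp hlim)
  rw [Complex.ofReal_re] at hre
  refine hre.congr' ?_
  filter_upwards [hne, self_mem_nhdsWithin] with s hs hs1
  have hs1' : 0 < s - 1 := sub_pos.2 hs1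
  let r : ℕ → ℝ := fun n => if n = 0 then 0 else
    (Nat.card {I : Ideal (𝓞 K) // Ideal.absNorm I = n} : ℝ) * (n : ℝ) ^ (-s)
  have hr0 : ∀ n, 0 ≤ r n := fun n => by
    simp only [r]
    split_ifs
    · exact le_rfl
    · positivity
  have hterm : ∀ n, LSeries.term
      (fun n => (Nat.card {I : Ideal (𝓞 K) // Ideal.absNorm I = n} : ℂ)) s n = (r n : ℂ) := by
    intro n
    simp only [LSeries.term, r]
    split_ifs with hn
    · simp
    · rw [Complex.ofReal_mul, Complex.ofReal_natCast, Complex.ofReal_cpow (Nat.cast_nonneg n),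
        Complex.ofReal_neg, Complex.cpow_neg, Complex.ofReal_natCast, div_eq_mul_inv]
  -- The series converges, as otherwise its value would be `0`.
  have hsum : Summable r := by
    by_contra hns
    refine hs ?_
    have : ¬ Summable fun n => (r n : ℂ) := by rwa [Complex.summable_ofReal]
    rw [dedekindZeta, LSeries, tsum_congr hterm, tsum_eq_zero_of_not_summable this, mul_zero]
  have hval : dedekindZeta K s = ((∑' n, r n : ℝ) : ℂ) := by
    rw [dedekindZeta, LSeries, tsum_congr hterm, Complex.ofReal_tsum]
  have hre : (((s : ℂ) - 1) * dedekindZeta K s).re = (s - 1) * ∑' n, r n := by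
    rw [hval, ← Complex.ofReal_one, ← Complex.ofReal_sub, ← Complex.ofReal_mul, Complex.ofReal_re]
  change ENNReal.ofReal (((s : ℂ) - 1) * dedekindZeta K s).re = _
  rw [hre, ENNReal.ofReal_mul hs1'.le, ENNReal.ofReal_tsum_of_nonneg hr0 hsum,
    idealZeta_empty_eq_tsum]
  congr 1
  refine tsum_congr fun n => ?_
  simp only [r]
  split_ifs with hn
  · simp
  · rw [ENNReal.ofReal_mul (Nat.cast_nonneg _), ENNReal.ofReal_natCast,
      ← ENNReal.ofReal_rpow_of_pos (by positivity), ENNReal.ofReal_natCast]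

variable {K}

theorem idealZeta_le_two_mul_idealZeta_insert [DecidableEq (HeightOneSpectrum (𝓞 K))]
    (S : Finset (HeightOneSpectrum (𝓞 K)))
    (v : HeightOneSpectrum (𝓞 K)) {s : ℝ} (hs : 1 ≤ s) (hfin : idealZeta K S s ≠ ∞) :
    idealZeta K S s ≤ 2 * idealZeta K (insert v S) s := by
  classical
  let f : Ideal (𝓞 K) → ℝ≥0∞ := fun I => (Ideal.absNorm I : ℝ≥0∞) ^ (-s)
  have hv : (Ideal.absNorm v.asIdeal : ℝ≥0∞) ^ (-s) ≤ 2⁻¹ := by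
    have h2 : 2 ≤ Ideal.absNorm v.asIdeal := by
      have h0 : Ideal.absNorm v.asIdeal ≠ 0 := by
        rw [Ne, Ideal.absNorm_eq_zero_iff]; exact v.ne_bot
      have h1 : Ideal.absNorm v.asIdeal ≠ 1 := by
        rw [Ne, Ideal.absNorm_eq_one_iff]; exact v.isPrime.ne_top
      omega
    have h2' : (2 : ℝ≥0∞) ≤ Ideal.absNorm v.asIdeal := by exact_mod_cast h2
    rw [ENNReal.rpow_neg]
    refine ENNReal.inv_le_inv.2 (h2'.trans ?_)
    conv_lhs => rw [← ENNReal.rpow_one (Ideal.absNorm v.asIdeal : ℝ≥0∞)]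
    exact ENNReal.rpow_le_rpow_of_exponent_le (le_trans (by norm_num) h2') hs
  -- Ideals divisible by `v` contribute at most `N(v) ^ (-s) ≤ 1 / 2` of the whole.
  have hdvd : ∑' I : Ideal (𝓞 K), Set.indicator
      {I | (I ≠ ⊥ ∧ ∀ u ∈ S, ¬ u.asIdeal ∣ I) ∧ v.asIdeal ∣ I} f I ≤ idealZeta K S s / 2 := by
    have hinj : Function.Injective fun J : Ideal (𝓞 K) => v.asIdeal * J :=
      fun J J' h => mul_left_cancel₀ v.ne_bot h
    rw [← hinj.tsum_eq, idealZeta, div_eq_mul_inv, ← ENNReal.tsum_mul_right]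
    · refine ENNReal.tsum_le_tsum fun J => ?_
      by_cases hJ : v.asIdeal * J ∈
          {I | (I ≠ ⊥ ∧ ∀ u ∈ S, ¬ u.asIdeal ∣ I) ∧ v.asIdeal ∣ I}
      · rw [Set.indicator_of_mem hJ, Set.indicator_of_mem]
        · simp only [f]
          rw [map_mul, Nat.cast_mul, ENNReal.mul_rpow_of_ne_top (by simp) (by simp), mul_comm]
          gcongr
        · exact ⟨fun h => hJ.1.1 (by rw [h, Ideal.mul_bot]),
            fun u hu hd => hJ.1.2 u hu (hd.mul_left _)⟩
      · rw [Set.indicator_of_notMem hJ]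
        exact zero_le
    · intro I hI
      obtain ⟨J, hJ⟩ := (Set.mem_of_indicator_ne_zero hI).2
      exact ⟨J, hJ.symm⟩
  have hle : idealZeta K S s ≤ idealZeta K (insert v S) s + idealZeta K S s / 2 := by
    refine le_trans ?_ (add_le_add_right hdvd _)
    rw [idealZeta, idealZeta, ← ENNReal.tsum_add]
    refine ENNReal.tsum_le_tsum fun I => ?_
    by_cases h1 : I ∈ {I : Ideal (𝓞 K) | I ≠ ⊥ ∧ ∀ u ∈ S, ¬ u.asIdeal ∣ I}
    · rw [Set.indicator_of_mem h1]
      by_cases h2 : v.asIdeal ∣ I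
      · refine le_add_left ?_
        rw [Set.indicator_of_mem (show I ∈ {I | (I ≠ ⊥ ∧ ∀ u ∈ S, ¬ u.asIdeal ∣ I) ∧
          v.asIdeal ∣ I} from ⟨h1, h2⟩)]
      · refine le_add_right ?_
        rw [Set.indicator_of_mem]
        exact ⟨h1.1, fun u hu => by
          rcases Finset.mem_insert.1 hu with rfl | hu
          · exact h2
          · exact h1.2 u hu⟩
    · rw [Set.indicator_of_notMem h1]
      exact zero_le
  have hhalf : idealZeta K S s / 2 ≤ idealZeta K (insert v S) s := by
    have hne : idealZeta K S s / 2 ≠ ∞ := (ENNReal.div_lt_top hfin (by norm_num)).ne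
    rw [← ENNReal.add_le_add_iff_right hne, ENNReal.add_halves]
    exact hle
  rw [mul_comm]
  exact (ENNReal.div_le_iff (by norm_num) (by norm_num)).1 hhalf

theorem idealZeta_mono {S T : Finset (HeightOneSpectrum (𝓞 K))} (h : S ⊆ T) (s : ℝ) :
    idealZeta K T s ≤ idealZeta K S s := by
  refine ENNReal.tsum_le_tsum fun _ => Set.indicator_le_indicator_of_subset ?_ (fun _ => zero_le) _
  exact fun I hI => ⟨hI.1, fun v hv => hI.2 v (h hv)⟩

theorem idealZeta_empty_le (S : Finset (HeightOneSpectrum (𝓞 K))) {s : ℝ} (hs : 1 ≤ s)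
    (hfin : idealZeta K ∅ s ≠ ∞) : idealZeta K ∅ s ≤ 2 ^ S.card * idealZeta K S s := by
  classical
  induction S using Finset.induction_on with
  | empty => simp
  | insert v S hv ih =>
    refine ih.trans ?_
    rw [Finset.card_insert_of_notMem hv, pow_succ, mul_assoc]
    gcongr
    exact idealZeta_le_two_mul_idealZeta_insert S v hs
      (ne_top_of_le_ne_top hfin (idealZeta_mono (Finset.empty_subset S) s))

/-- If every prime outside `S` has two distinct primes of the same norm above it, then pairs of
ideals of `K` inject into the ideals of `F`. -/
theorem idealZeta_sq_le {F : Type*} [Field F] [NumberField F] [Algebra K F]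
    (S : Finset (HeightOneSpectrum (𝓞 K)))
    (hsplit : ∀ v : HeightOneSpectrum (𝓞 K), v ∉ S → ∃ P Q : HeightOneSpectrum (𝓞 F), P ≠ Q ∧
      P.asIdeal.under (𝓞 K) = v.asIdeal ∧ Q.asIdeal.under (𝓞 K) = v.asIdeal ∧
      Ideal.absNorm P.asIdeal = Ideal.absNorm v.asIdeal ∧
      Ideal.absNorm Q.asIdeal = Ideal.absNorm v.asIdeal) (s : ℝ) :
    idealZeta K S s * idealZeta K S s ≤ idealZeta F ∅ s := by
  classical
  have hsplit' : ∀ p : Ideal (𝓞 K), ∃ P Q : Ideal (𝓞 F),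
      (Prime p ∧ ∀ v ∈ S, v.asIdeal ≠ p) → Prime P ∧ Prime Q ∧ P ≠ Q ∧
      P.under (𝓞 K) = p ∧ Q.under (𝓞 K) = p ∧
      Ideal.absNorm P = Ideal.absNorm p ∧ Ideal.absNorm Q = Ideal.absNorm p := by
    intro p
    by_cases hp : Prime p ∧ ∀ v ∈ S, v.asIdeal ≠ p
    · let v : HeightOneSpectrum (𝓞 K) := ⟨p, Ideal.isPrime_of_prime hp.1, hp.1.ne_zero⟩
      obtain ⟨P, Q, hne, h1, h2, h3, h4⟩ := hsplit v fun h => hp.2 v h rfl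
      exact ⟨P.asIdeal, Q.asIdeal, fun _ => ⟨P.prime, Q.prime,
        fun h => hne (HeightOneSpectrum.ext h), h1, h2, h3, h4⟩⟩
    · exact ⟨⊥, ⊥, fun h => absurd h hp⟩
  choose c₁ c₂ hc using hsplit'
  let D : Set (Ideal (𝓞 K)) := {I | I ≠ ⊥ ∧ ∀ v ∈ S, ¬ v.asIdeal ∣ I}
  let nf : Ideal (𝓞 K) → Multiset (Ideal (𝓞 K)) := UniqueFactorizationMonoid.normalizedFactors
  have hnf : ∀ I ∈ D, ∀ p ∈ nf I, Prime p ∧ ∀ v ∈ S, v.asIdeal ≠ p := by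
    intro I hI p hp
    refine ⟨UniqueFactorizationMonoid.prime_of_normalized_factor p hp, fun v hv h => ?_⟩
    exact hI.2 v hv (h ▸ UniqueFactorizationMonoid.dvd_of_mem_normalizedFactors hp)
  have hprod : ∀ I ∈ D, (nf I).prod = I := fun I hI =>
    Ideal.prod_normalizedFactors_eq_self hI.1
  let m : Ideal (𝓞 K) → Ideal (𝓞 K) → Multiset (Ideal (𝓞 F)) := fun I J =>
    (nf I).map c₁ + (nf J).map c₂
  have hmprime : ∀ I ∈ D, ∀ J ∈ D, ∀ P ∈ m I J, Prime P := by
    intro I hI J hJ P hP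
    rcases Multiset.mem_add.1 hP with hP | hP
    · obtain ⟨p, hp, rfl⟩ := Multiset.mem_map.1 hP
      exact (hc p (hnf I hI p hp)).1
    · obtain ⟨p, hp, rfl⟩ := Multiset.mem_map.1 hP
      exact (hc p (hnf J hJ p hp)).2.1
  -- The two factors can be recovered from the factorization of the image.
  have hm1 : ∀ I ∈ D, ∀ J ∈ D,
      ((m I J).filter fun P => c₁ (P.under (𝓞 K)) = P).map (Ideal.under (𝓞 K)) = nf I := by
    intro I hI J hJ
    rw [Multiset.filter_add, Multiset.filter_eq_self.2, Multiset.filter_eq_nil.2, add_zero,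
      Multiset.map_map]
    · refine (Multiset.map_congr rfl fun p hp => ?_).trans (Multiset.map_id _)
      exact (hc p (hnf I hI p hp)).2.2.2.1
    · intro P hP h
      obtain ⟨p, hp, rfl⟩ := Multiset.mem_map.1 hP
      obtain ⟨-, -, hne, -, h2, -⟩ := hc p (hnf J hJ p hp)
      exact hne (by rwa [h2] at h)
    · intro P hP
      obtain ⟨p, hp, rfl⟩ := Multiset.mem_map.1 hP
      rw [(hc p (hnf I hI p hp)).2.2.2.1]
  have hm2 : ∀ I ∈ D, ∀ J ∈ D,
      ((m I J).filter fun P => ¬ c₁ (P.under (𝓞 K)) = P).map (Ideal.under (𝓞 K)) = nf J := by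
    intro I hI J hJ
    rw [Multiset.filter_add, Multiset.filter_eq_nil.2, zero_add, Multiset.filter_eq_self.2,
      Multiset.map_map]
    · refine (Multiset.map_congr rfl fun p hp => ?_).trans (Multiset.map_id _)
      exact (hc p (hnf J hJ p hp)).2.2.2.2.1
    · intro P hP h
      obtain ⟨p, hp, rfl⟩ := Multiset.mem_map.1 hP
      obtain ⟨-, -, hne, -, h2, -⟩ := hc p (hnf J hJ p hp)
      exact hne (by rwa [h2] at h)
    · intro P hP h
      obtain ⟨p, hp, rfl⟩ := Multiset.mem_map.1 hP
      refine h ?_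
      rw [(hc p (hnf I hI p hp)).2.2.2.1]
  let Φ : D × D → Ideal (𝓞 F) := fun x => (m x.1 x.2).prod
  have hΦnf : ∀ x, UniqueFactorizationMonoid.normalizedFactors (Φ x) = m x.1 x.2 := fun x =>
    UniqueFactorizationMonoid.normalizedFactors_prod_of_prime
      (hmprime _ x.1.2 _ x.2.2)
  have hΦinj : Function.Injective Φ := by
    intro x y hxy
    have hm : m x.1 x.2 = m y.1 y.2 := by rw [← hΦnf, ← hΦnf, hxy]
    refine Prod.ext (Subtype.ext ?_) (Subtype.ext ?_)
    · rw [← hprod _ x.1.2, ← hprod _ y.1.2, ← hm1 _ x.1.2 _ x.2.2, ← hm1 _ y.1.2 _ y.2.2, hm]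
    · rw [← hprod _ x.2.2, ← hprod _ y.2.2, ← hm2 _ x.1.2 _ x.2.2, ← hm2 _ y.1.2 _ y.2.2, hm]
  have hΦnorm : ∀ x, Ideal.absNorm (Φ x) =
      Ideal.absNorm (x.1 : Ideal (𝓞 K)) * Ideal.absNorm (x.2 : Ideal (𝓞 K)) := by
    intro x
    simp only [Φ, m]
    rw [Multiset.prod_add, map_mul, map_multiset_prod, map_multiset_prod, Multiset.map_map,
      Multiset.map_map]
    conv_rhs => rw [← hprod _ x.1.2, ← hprod _ x.2.2, map_multiset_prod, map_multiset_prod]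
    congr 2
    · exact Multiset.map_congr rfl fun p hp => (hc p (hnf _ x.1.2 p hp)).2.2.2.2.2.1
    · exact Multiset.map_congr rfl fun p hp => (hc p (hnf _ x.2.2 p hp)).2.2.2.2.2.2
  have hΦ0 : ∀ x, Φ x ≠ ⊥ := fun x =>
    Multiset.prod_ne_zero fun h => (hmprime _ x.1.2 _ x.2.2 _ h).ne_zero rfl
  have hS : idealZeta K S s = ∑' I : D, (Ideal.absNorm (I : Ideal (𝓞 K)) : ℝ≥0∞) ^ (-s) := by
    rw [tsum_subtype D fun I => (Ideal.absNorm I : ℝ≥0∞) ^ (-s)]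
    rfl
  rw [hS, ← ENNReal.tsum_mul_right]
  simp_rw [← ENNReal.tsum_mul_left]
  rw [← ENNReal.tsum_prod (f := fun I J : D => (Ideal.absNorm (I : Ideal (𝓞 K)) : ℝ≥0∞) ^ (-s) *
    (Ideal.absNorm (J : Ideal (𝓞 K)) : ℝ≥0∞) ^ (-s))]
  refine le_trans (ENNReal.tsum_le_tsum fun x => ?_)
    (ENNReal.tsum_comp_le_tsum_of_injective hΦinj _)
  rw [Set.indicator_of_mem, hΦnorm, Nat.cast_mul,
    ENNReal.mul_rpow_of_ne_top (by simp) (by simp)]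
  exact ⟨hΦ0 x, by simp⟩

/-- In an extension of number fields it is impossible that all but finitely many primes have two
distinct primes of the same norm above them: the zeta function would have a double pole. -/
theorem not_forall_exists_two_primes_absNorm_eq {F : Type*} [Field F] [NumberField F] [Algebra K F]
    (S : Finset (HeightOneSpectrum (𝓞 K)))
    (hsplit : ∀ v : HeightOneSpectrum (𝓞 K), v ∉ S → ∃ P Q : HeightOneSpectrum (𝓞 F), P ≠ Q ∧
      P.asIdeal.under (𝓞 K) = v.asIdeal ∧ Q.asIdeal.under (𝓞 K) = v.asIdeal ∧
      Ideal.absNorm P.asIdeal = Ideal.absNorm v.asIdeal ∧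
      Ideal.absNorm Q.asIdeal = Ideal.absNorm v.asIdeal) : False := by
  have hK := tendsto_sub_one_mul_idealZeta K
  have hF := tendsto_sub_one_mul_idealZeta F
  have hs0 : Tendsto (fun s : ℝ => ENNReal.ofReal (s - 1)) (𝓝[>] 1) (𝓝 0) := by
    have : Tendsto (fun s : ℝ => s - 1) (𝓝[>] 1) (𝓝 0) := by
      have h : Tendsto (fun s : ℝ => s - 1) (𝓝 1) (𝓝 (1 - 1)) :=
        (continuous_id.sub continuous_const).tendsto 1
      rw [sub_self] at h
      exact h.mono_left nhdsWithin_le_nhds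
    simpa using ENNReal.tendsto_ofReal this
  have hlhs := ENNReal.Tendsto.mul hK (Or.inr ENNReal.ofReal_ne_top) hK
    (Or.inr ENNReal.ofReal_ne_top)
  have hrhs : Tendsto (fun s : ℝ => (2 ^ S.card * 2 ^ S.card) *
      (ENNReal.ofReal (s - 1) * (ENNReal.ofReal (s - 1) * idealZeta F ∅ s))) (𝓝[>] 1) (𝓝 0) := by
    have h := ENNReal.Tendsto.const_mul (a := (2 ^ S.card * 2 ^ S.card : ℝ≥0∞))
      (ENNReal.Tendsto.mul hs0 (Or.inr ENNReal.ofReal_ne_top) hF (Or.inr ENNReal.zero_ne_top))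
      (Or.inr (ENNReal.mul_ne_top (by simp) (by simp)))
    simpa using h
  have hfin : ∀ᶠ s : ℝ in 𝓝[>] 1, idealZeta K ∅ s ≠ ∞ := by
    filter_upwards [hK.eventually_lt_const (ENNReal.ofReal_lt_top : _ < ∞), self_mem_nhdsWithin]
      with s hs hs1 h
    rw [h, ENNReal.mul_top (by simpa using hs1)] at hs
    exact lt_irrefl _ hs
  have hle := le_of_tendsto_of_tendsto hlhs hrhs (by
    filter_upwards [hfin, self_mem_nhdsWithin] with s hs hs1
    have h1 := idealZeta_empty_le S (le_of_lt hs1) hs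
    calc _ ≤ (ENNReal.ofReal (s - 1) * (2 ^ S.card * idealZeta K S s)) *
          (ENNReal.ofReal (s - 1) * (2 ^ S.card * idealZeta K S s)) := by gcongr
      _ = (2 ^ S.card * 2 ^ S.card) * (ENNReal.ofReal (s - 1) * (ENNReal.ofReal (s - 1) *
          (idealZeta K S s * idealZeta K S s))) := by ring
      _ ≤ _ := by
        gcongr
        exact idealZeta_sq_le S hsplit s)
  have hpos : 0 < ENNReal.ofReal (dedekindZeta_residue K) :=
    ENNReal.ofReal_pos.2 (dedekindZeta_residue_pos K)
  exact absurd hle (not_le.2 (ENNReal.mul_pos hpos.ne' hpos.ne'))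

end zeta

/-! ### Inertia groups and Frobenius elements in towers -/

section tower

open scoped Pointwise

variable {K M L : Type*} [Field K] [Field M] [Field L]
  [Algebra K M] [Algebra M L] [Algebra K L] [IsScalarTower K M L]

theorem algebraMap_restrictNormalHom_smul [Normal K M] (σ : Gal(L/K)) (x : 𝓞 M) :
    algebraMap (𝓞 M) (𝓞 L) (AlgEquiv.restrictNormalHom M σ • x) =
      σ • algebraMap (𝓞 M) (𝓞 L) x :=
  RingOfIntegers.ext (AlgEquiv.restrictNormal_commutes σ M x)

theorem IsArithFrobAt.restrictNormalHom [Normal K M] {σ : Gal(L/K)} {Q : Ideal (𝓞 L)}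
    (h : IsArithFrobAt (𝓞 K) σ Q) :
    IsArithFrobAt (𝓞 K) (AlgEquiv.restrictNormalHom M σ) (Q.under (𝓞 M)) := by
  intro x
  rw [Ideal.under_under, Ideal.mem_comap, map_sub, map_pow]
  change algebraMap (𝓞 M) (𝓞 L) (AlgEquiv.restrictNormalHom M σ • x) - _ ∈ Q
  rw [algebraMap_restrictNormalHom_smul]
  exact h _

theorem restrictNormalHom_mem_inertia [Normal K M] {σ : Gal(L/K)} {Q : Ideal (𝓞 L)}
    (h : σ ∈ Q.inertia Gal(L/K)) :
    AlgEquiv.restrictNormalHom M σ ∈ (Q.under (𝓞 M)).inertia Gal(M/K) := by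
  intro x
  change _ ∈ Q.under (𝓞 M)
  rw [Ideal.mem_comap, map_sub, algebraMap_restrictNormalHom_smul]
  exact h _

theorem restrictNormalHom_restrictScalars [Normal K M] (τ : Gal(L/M)) :
    AlgEquiv.restrictNormalHom M (τ.restrictScalars K) = 1 := by
  ext x
  apply (algebraMap M L).injective
  refine (AlgEquiv.restrictNormal_commutes (τ.restrictScalars K) M x).trans ?_
  simp

theorem smul_under_restrictNormalHom [Normal K M] (σ : Gal(L/K)) (Q : Ideal (𝓞 L)) :
    (σ • Q).under (𝓞 M) = AlgEquiv.restrictNormalHom M σ • Q.under (𝓞 M) := by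
  ext x
  rw [Ideal.mem_comap, Ideal.mem_pointwise_smul_iff_inv_smul_mem,
    Ideal.mem_pointwise_smul_iff_inv_smul_mem, Ideal.mem_comap, ← map_inv,
    algebraMap_restrictNormalHom_smul]

/-- Restriction maps the inertia group in `L / K` onto the inertia group in `M / K`. -/
theorem exists_mem_inertia_restrictNormalHom_eq [NumberField K] [NumberField M] [NumberField L]
    [IsGalois K L] [IsGalois K M]
    {σ : Gal(L/K)} {Q : Ideal (𝓞 L)} [Q.IsMaximal]
    (h : AlgEquiv.restrictNormalHom M σ ∈ (Q.under (𝓞 M)).inertia Gal(M/K)) :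
    ∃ τ ∈ Q.inertia Gal(L/K), AlgEquiv.restrictNormalHom M τ = AlgEquiv.restrictNormalHom M σ := by
  have : IsGalois M L := IsGalois.tower_top_of_isGalois K M L
  -- First correct `σ` so that it stabilises `Q`.
  have hstab : (σ • Q).under (𝓞 M) = Q.under (𝓞 M) := by
    rw [smul_under_restrictNormalHom]
    exact Ideal.inertia_le_stabilizer _ h
  obtain ⟨τ, hτ⟩ := Algebra.IsInvariant.exists_smul_of_under_eq (𝓞 M) (𝓞 L) Gal(L/M) Q (σ • Q)
    hstab.symm
  let τ₁ : Gal(L/K) := τ.restrictScalars K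
  have hτ₁ : ∀ x : 𝓞 L, τ₁ • x = τ • x := fun x => rfl
  have hτ₁Q : τ₁ • Q = τ • Q := by
    ext x
    rw [Ideal.mem_pointwise_smul_iff_inv_smul_mem, Ideal.mem_pointwise_smul_iff_inv_smul_mem]
    rfl
  let σ₁ : Gal(L/K) := τ₁⁻¹ * σ
  have hσ₁ : AlgEquiv.restrictNormalHom M σ₁ = AlgEquiv.restrictNormalHom M σ := by
    rw [map_mul, map_inv, restrictNormalHom_restrictScalars, inv_one, one_mul]
  have hσ₁Q : σ₁ ∈ MulAction.stabilizer Gal(L/K) Q := by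
    rw [MulAction.mem_stabilizer_iff, mul_smul, hτ, ← hτ₁Q, inv_smul_smul]
  -- Its action on the residue field is that of an element of the decomposition group over `M`.
  let l₀ := Ideal.Quotient.stabilizerHom Q (Q.under (𝓞 K)) Gal(L/K) ⟨σ₁, hσ₁Q⟩
  let l : (𝓞 L ⧸ Q) ≃ₐ[𝓞 M ⧸ Q.under (𝓞 M)] (𝓞 L ⧸ Q) :=
    AlgEquiv.ofRingEquiv (f := l₀.toRingEquiv) (by
      intro x
      obtain ⟨x, rfl⟩ := Ideal.Quotient.mk_surjective x
      change Ideal.Quotient.mk Q (σ₁ • algebraMap (𝓞 M) (𝓞 L) x) =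
        Ideal.Quotient.mk Q (algebraMap (𝓞 M) (𝓞 L) x)
      rw [Ideal.Quotient.eq, ← algebraMap_restrictNormalHom_smul, ← map_sub, ← Ideal.mem_comap,
        hσ₁]
      exact h x)
  obtain ⟨τ₂, hτ₂⟩ := Ideal.Quotient.stabilizerHom_surjective Gal(L/M) (Q.under (𝓞 M)) Q l
  let τ₃ : Gal(L/K) := (τ₂ : Gal(L/M)).restrictScalars K
  refine ⟨τ₃⁻¹ * σ₁, fun x => ?_, ?_⟩
  · have h1 : Ideal.Quotient.mk Q ((τ₂ : Gal(L/M)) • x) = Ideal.Quotient.mk Q (σ₁ • x) :=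
      DFunLike.congr_fun hτ₂ (Ideal.Quotient.mk Q x)
    rw [Ideal.Quotient.eq] at h1
    have h2 : (τ₂ : Gal(L/M)) • ((τ₃⁻¹ * σ₁) • x - x) = σ₁ • x - (τ₂ : Gal(L/M)) • x := by
      rw [smul_sub]
      congr 1
      change τ₃ • ((τ₃⁻¹ * σ₁) • x) = _
      rw [mul_smul, smul_inv_smul]
    have h3 : (τ₂ : Gal(L/M)) • ((τ₃⁻¹ * σ₁) • x - x) ∈ (τ₂ : Gal(L/M)) • Q := by
      rw [h2, MulAction.mem_stabilizer_iff.1 τ₂.2, ← neg_sub]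
      exact neg_mem h1
    exact Ideal.smul_mem_pointwise_smul_iff.1 h3
  · rw [map_mul, map_inv, restrictNormalHom_restrictScalars, inv_one, one_mul, hσ₁]

end tower

section frobenius

open scoped Pointwise

variable {K L : Type*} [Field K] [Field L] [Algebra K L]

theorem IsArithFrobAt.eq_of_inertia_eq_bot {σ τ : Gal(L/K)} {Q : Ideal (𝓞 L)}
    (hQ : Q.inertia Gal(L/K) = ⊥) (hσ : IsArithFrobAt (𝓞 K) σ Q)
    (hτ : IsArithFrobAt (𝓞 K) τ Q) : σ = τ := by
  have := hσ.mul_inv_mem_inertia hτ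
  rwa [hQ, Subgroup.mem_bot, mul_inv_eq_one] at this

variable [NumberField L]

/-- A prime with trivial Frobenius has residue degree one. -/
theorem bijective_algebraMap_of_isArithFrobAt_one {Q : Ideal (𝓞 L)} [Q.IsMaximal]
    (h : IsArithFrobAt (𝓞 K) (1 : Gal(L/K)) Q) :
    Function.Bijective (algebraMap (𝓞 K ⧸ Q.under (𝓞 K)) (𝓞 L ⧸ Q)) := by
  classical
  have : Q.IsPrime := inferInstance
  have hQ0 : Q ≠ ⊥ := NeZero.ne Q
  have hfin : Finite (𝓞 L ⧸ Q) := Ideal.finiteQuotientOfFreeOfNeBot Q hQ0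
  let _ : Field (𝓞 L ⧸ Q) := Ideal.Quotient.field Q
  have hinj : Function.Injective (algebraMap (𝓞 K ⧸ Q.under (𝓞 K)) (𝓞 L ⧸ Q)) :=
    Ideal.algebraMap_quotient_injective
  have hfin' : Finite (𝓞 K ⧸ Q.under (𝓞 K)) := Finite.of_injective _ hinj
  have := Fintype.ofFinite (𝓞 L ⧸ Q)
  set q := Nat.card (𝓞 K ⧸ Q.under (𝓞 K)) with hq
  have hq1 : 1 < q := by
    have : Nontrivial (𝓞 K ⧸ Q.under (𝓞 K)) :=
      Ideal.Quotient.nontrivial_iff.2 (Ideal.IsPrime.under (𝓞 K) Q).ne_top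
    exact Finite.one_lt_card
  have hroot : ∀ x : 𝓞 L ⧸ Q, x ^ q = x := by
    intro x
    obtain ⟨x, rfl⟩ := Ideal.Quotient.mk_surjective x
    have h1 : (MulSemiringAction.toAlgHom (𝓞 K) (𝓞 L) (1 : Gal(L/K))) x = x := one_smul _ x
    rw [← h.mk_apply, h1]
  have hcard : Nat.card (𝓞 L ⧸ Q) ≤ q := by
    have hne : (Polynomial.X ^ q - Polynomial.X : Polynomial (𝓞 L ⧸ Q)) ≠ 0 :=
      FiniteField.X_pow_card_sub_X_ne_zero _ hq1
    have hsub : (Finset.univ : Finset (𝓞 L ⧸ Q)) ⊆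
        (Polynomial.X ^ q - Polynomial.X : Polynomial (𝓞 L ⧸ Q)).roots.toFinset := by
      intro x _
      rw [Multiset.mem_toFinset, Polynomial.mem_roots hne]
      simp [Polynomial.IsRoot, hroot x]
    rw [Nat.card_eq_fintype_card, ← Finset.card_univ]
    refine (Finset.card_le_card hsub).trans ((Multiset.toFinset_card_le _).trans
      ((Polynomial.card_roots' _).trans ?_))
    rw [FiniteField.X_pow_card_sub_X_natDegree_eq _ hq1]
  exact (Nat.bijective_iff_injective_and_card _).2
    ⟨hinj, le_antisymm (Nat.card_le_card_of_injective _ hinj) hcard⟩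

theorem absNorm_eq_of_isArithFrobAt_one [NumberField K] {Q : Ideal (𝓞 L)} [Q.IsMaximal]
    (h : IsArithFrobAt (𝓞 K) (1 : Gal(L/K)) Q) :
    Ideal.absNorm Q = Ideal.absNorm (Q.under (𝓞 K)) :=
  (Nat.card_congr (Equiv.ofBijective _ (bijective_algebraMap_of_isArithFrobAt_one h))).symm

theorem mem_inertia_of_smul_eq_of_isArithFrobAt_one {Q : Ideal (𝓞 L)} [Q.IsMaximal]
    (h : IsArithFrobAt (𝓞 K) (1 : Gal(L/K)) Q) {σ : Gal(L/K)} (hσ : σ • Q = Q) :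
    σ ∈ Q.inertia Gal(L/K) := by
  intro x
  obtain ⟨y, hy⟩ := (bijective_algebraMap_of_isArithFrobAt_one h).2 (Ideal.Quotient.mk Q x)
  obtain ⟨r, rfl⟩ := Ideal.Quotient.mk_surjective y
  replace hy : Ideal.Quotient.mk Q (algebraMap (𝓞 K) (𝓞 L) r) = Ideal.Quotient.mk Q x := hy
  rw [Ideal.Quotient.eq] at hy
  have h1 : σ • (algebraMap (𝓞 K) (𝓞 L) r - x) ∈ σ • Q :=
    Ideal.smul_mem_pointwise_smul_iff.2 hy
  rw [hσ, smul_sub, smul_algebraMap] at h1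
  have := sub_mem hy h1
  rw [sub_sub_sub_cancel_left] at this
  exact this

end frobenius

/-! ### The Artin map and change of the modulus -/

section artin

open scoped Pointwise

variable {K : Type*} [Field K] [NumberField K] {n m : Ideal (𝓞 K)}

/-- A nonzero integral ideal prime to `n`, as an element of `I_n`. -/
noncomputable def primeToIdeal (I : Ideal (𝓞 K)) (hI : I ≠ ⊥) (hIn : IsCoprime I n) :
    idealsPrimeTo K n :=
  ⟨Units.mk0 (I : FractionalIdeal (𝓞 K)⁰ K) (FractionalIdeal.coeIdeal_ne_zero.2 hI), by
    classical
    intro v hv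
    rw [Units.val_mk0, FractionalIdeal.count_coe K v hI]
    by_contra h
    have hvI : v.asIdeal ∣ I :=
      (Associates.count_ne_zero_iff_dvd hI v.irreducible).1 fun h0 => h (by rw [h0]; rfl)
    rw [Ideal.isCoprime_iff_sup_eq] at hIn
    refine v.isPrime.ne_top (top_le_iff.1 ?_)
    rw [← hIn]
    exact sup_le (Ideal.le_of_dvd hvI) (Ideal.le_of_dvd hv)⟩

theorem coe_primeToIdeal {I : Ideal (𝓞 K)} {hI : I ≠ ⊥} {hIn : IsCoprime I n} :
    (((primeToIdeal I hI hIn : idealsPrimeTo K n) : (FractionalIdeal (𝓞 K)⁰ K)ˣ) :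
      FractionalIdeal (𝓞 K)⁰ K) = I := rfl

theorem HeightOneSpectrum.isCoprime_of_not_dvd {v : HeightOneSpectrum (𝓞 K)}
    (hv : ¬ v.asIdeal ∣ n) : IsCoprime v.asIdeal n := by
  rw [Ideal.isCoprime_iff_sup_eq]
  by_contra h
  have h1 : v.asIdeal = v.asIdeal ⊔ n := v.isMaximal.eq_of_le h le_sup_left
  exact hv (Ideal.dvd_iff_le.2 (h1.symm ▸ le_sup_right))

/-- The map `φ` sends the primes not dividing `n` to their Frobenius elements. -/
def IsArtinMap {L : Type*} [Field L] [Algebra K L] (φ : idealsPrimeTo K n →* Gal(L/K)) : Prop :=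
  ∀ (J : idealsPrimeTo K n) (v : HeightOneSpectrum (𝓞 K)),
    (((J : (FractionalIdeal (𝓞 K)⁰ K)ˣ) : FractionalIdeal (𝓞 K)⁰ K) =
      (v.asIdeal : FractionalIdeal (𝓞 K)⁰ K)) →
    ∀ Q : Ideal (𝓞 L), Q.IsMaximal → Q.under (𝓞 K) = v.asIdeal → IsArithFrobAt (𝓞 K) (φ J) Q

/-- Every prime not dividing `n` is unramified in `L`. -/
def UnramifiedOutside (n : Ideal (𝓞 K)) (L : Type*) [Field L] [Algebra K L] : Prop :=
  ∀ Q : Ideal (𝓞 L), Q.IsMaximal → ¬ Q.under (𝓞 K) ∣ n → Q.inertia Gal(L/K) = ⊥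

/-- An extension in which almost all primes split completely is trivial. -/
theorem eq_one_of_forall_isArithFrobAt_one {F : Type*} [Field F] [NumberField F] [Algebra K F]
    (S : Set (HeightOneSpectrum (𝓞 K))) (hS : S.Finite)
    (h : ∀ v ∉ S, ∀ Q : Ideal (𝓞 F), Q.IsMaximal → Q.under (𝓞 K) = v.asIdeal →
      IsArithFrobAt (𝓞 K) (1 : Gal(F/K)) Q ∧ Q.inertia Gal(F/K) = ⊥) (σ : Gal(F/K)) : σ = 1 := by
  by_contra hσ
  refine not_forall_exists_two_primes_absNorm_eq (F := F) hS.toFinset fun v hv => ?_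
  rw [Set.Finite.mem_toFinset] at hv
  have := v.isMaximal
  obtain ⟨Q, hQ, hQv⟩ := Ideal.exists_maximal_ideal_liesOver_of_isIntegral (S := 𝓞 F) v.asIdeal
  have hQv' : Q.under (𝓞 K) = v.asIdeal := hQv.over.symm
  obtain ⟨hfrob, hin⟩ := h v hv Q hQ hQv'
  have hfrob' : IsArithFrobAt (𝓞 K) (1 : Gal(F/K)) (σ • Q) := by
    have := hfrob.conj σ
    rwa [mul_one, mul_inv_cancel] at this
  have hprime : (σ • Q).IsPrime := inferInstance
  have hne0 : σ • Q ≠ ⊥ := fun h0 => (NeZero.ne Q) (by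
    rw [← inv_smul_smul σ Q, h0]
    exact Ideal.map_bot)
  have hmax : (σ • Q).IsMaximal := hprime.isMaximal hne0
  have hunder : (σ • Q).under (𝓞 K) = v.asIdeal := by
    rw [← hQv']
    ext x
    rw [Ideal.mem_comap, Ideal.mem_comap, Ideal.mem_pointwise_smul_iff_inv_smul_mem,
      smul_algebraMap]
  refine ⟨⟨Q, inferInstance, NeZero.ne Q⟩, ⟨σ • Q, hprime, hne0⟩, fun heq => hσ ?_, hQv', hunder,
    ?_, ?_⟩
  · have := mem_inertia_of_smul_eq_of_isArithFrobAt_one hfrob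
      (congrArg HeightOneSpectrum.asIdeal heq).symm
    rwa [hin, Subgroup.mem_bot] at this
  · rw [← hQv']
    exact absNorm_eq_of_isArithFrobAt_one hfrob
  · rw [← hunder]
    exact absNorm_eq_of_isArithFrobAt_one hfrob'

/-- In a compositum of two abelian extensions every automorphism is given, on both of them, by the
Artin symbol of one and the same ideal. -/
theorem exists_restrictNormalHom_eq_artin {E L₁ L₂ : Type*} [Field E] [Field L₁] [Field L₂]
    [Algebra K E] [Algebra K L₁] [Algebra K L₂] [Algebra L₁ E] [Algebra L₂ E]
    [IsScalarTower K L₁ E] [IsScalarTower K L₂ E] [FiniteDimensional K E]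
    [IsAbelianGalois K E] [IsGalois K L₁] [IsGalois K L₂] (hn : n ≠ ⊥)
    (hinj : ∀ g : Gal(E/K), AlgEquiv.restrictNormalHom L₁ g = 1 →
      AlgEquiv.restrictNormalHom L₂ g = 1 → g = 1)
    {φ₁ : idealsPrimeTo K n →* Gal(L₁/K)} {φ₂ : idealsPrimeTo K n →* Gal(L₂/K)}
    (h₁ : IsArtinMap φ₁) (h₂ : IsArtinMap φ₂) (hu₁ : UnramifiedOutside n L₁)
    (hu₂ : UnramifiedOutside n L₂) (g : Gal(E/K)) :
    ∃ J, AlgEquiv.restrictNormalHom L₁ g = φ₁ J ∧ AlgEquiv.restrictNormalHom L₂ g = φ₂ J := by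
  have : NumberField E := NumberField.of_module_finite K E
  let D : Subgroup Gal(E/K) := (φ₁.prod φ₂).range.comap
    ((AlgEquiv.restrictNormalHom L₁).prod (AlgEquiv.restrictNormalHom L₂))
  have hD : ∀ g, g ∈ D ↔ ∃ J, AlgEquiv.restrictNormalHom L₁ g = φ₁ J ∧
      AlgEquiv.restrictNormalHom L₂ g = φ₂ J := fun g => by
    rw [Subgroup.mem_comap, MonoidHom.mem_range]
    simp only [MonoidHom.prod_apply, Prod.mk.injEq, eq_comm]
  rw [← hD]
  let F := IntermediateField.fixedField D
  have : NumberField F := NumberField.of_module_finite K F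
  have hfix : ∀ τ : Gal(E/K), AlgEquiv.restrictNormalHom F τ = 1 ↔ τ ∈ D := by
    intro τ
    rw [← MonoidHom.mem_ker, IntermediateField.restrictNormalHom_ker,
      IntermediateField.fixingSubgroup_fixedField]
  rw [← hfix]
  refine eq_one_of_forall_isArithFrobAt_one {v | v.asIdeal ∣ n} (Ideal.finite_factors hn) ?_ _
  intro v hv Q hQ hQv
  obtain ⟨Q', hQ', hQQ'⟩ := Ideal.exists_maximal_ideal_liesOver_of_isIntegral (S := 𝓞 E) Q
  have hover : Q'.under (𝓞 F) = Q := hQQ'.over.symm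
  have hQ'v : Q'.under (𝓞 K) = v.asIdeal := by
    rw [← Ideal.under_under (B := 𝓞 F), hover, hQv]
  have hm₁ : (Q'.under (𝓞 L₁)).IsMaximal := Ideal.IsMaximal.under (𝓞 L₁) Q'
  have hm₂ : (Q'.under (𝓞 L₂)).IsMaximal := Ideal.IsMaximal.under (𝓞 L₂) Q'
  have hv₁ : (Q'.under (𝓞 L₁)).under (𝓞 K) = v.asIdeal := by rw [Ideal.under_under, hQ'v]
  have hv₂ : (Q'.under (𝓞 L₂)).under (𝓞 K) = v.asIdeal := by rw [Ideal.under_under, hQ'v]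
  have hin₁ := hu₁ _ hm₁ (by rwa [hv₁])
  have hin₂ := hu₂ _ hm₂ (by rwa [hv₂])
  constructor
  · have : Finite (𝓞 E ⧸ Q') := Ideal.finiteQuotientOfFreeOfNeBot Q' (NeZero.ne Q')
    obtain ⟨τ, hτ⟩ := IsArithFrobAt.exists_of_isInvariant (𝓞 K) Gal(E/K) Q'
    have hτD : AlgEquiv.restrictNormalHom F τ = 1 := by
      rw [hfix, hD]
      let J : idealsPrimeTo K n :=
        primeToIdeal v.asIdeal v.ne_bot (HeightOneSpectrum.isCoprime_of_not_dvd hv)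
      exact ⟨J, hτ.restrictNormalHom.eq_of_inertia_eq_bot hin₁ (h₁ J v rfl _ hm₁ hv₁),
        hτ.restrictNormalHom.eq_of_inertia_eq_bot hin₂ (h₂ J v rfl _ hm₂ hv₂)⟩
    rw [← hτD, ← hover]
    exact hτ.restrictNormalHom
  · rw [eq_bot_iff]
    intro σ hσ
    obtain ⟨τ, rfl⟩ := AlgEquiv.restrictNormalHom_surjective E (K₁ := F) σ
    rw [← hover] at hσ
    obtain ⟨τ', hτ', heq⟩ := exists_mem_inertia_restrictNormalHom_eq hσ
    have hτ'₁ := restrictNormalHom_mem_inertia (M := L₁) hτ'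
    have hτ'₂ := restrictNormalHom_mem_inertia (M := L₂) hτ'
    rw [hin₁, Subgroup.mem_bot] at hτ'₁
    rw [hin₂, Subgroup.mem_bot] at hτ'₂
    rw [Subgroup.mem_bot, ← heq, hinj τ' hτ'₁ hτ'₂, map_one]

theorem idealsPrimeTo_le (h : m ∣ n) : idealsPrimeTo K n ≤ idealsPrimeTo K m :=
  fun _ hJ v hv => hJ v (hv.trans h)

theorem ModEqOne.of_dvd (h : m ∣ n) {x : K} (hx : ModEqOne n x) : ModEqOne m x := by
  obtain ⟨a, b, hb, han, hbn, hab, rfl⟩ := hx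
  exact ⟨a, b, hb, han.of_isCoprime_of_dvd_right h, hbn.of_isCoprime_of_dvd_right h,
    Ideal.le_of_dvd h hab, rfl⟩

theorem rayIdeals_subset (h : m ∣ n) : rayIdeals K n ⊆ rayIdeals K m := by
  rintro _ ⟨x, rfl, hx, hpos⟩
  exact ⟨x, rfl, hx.of_dvd h, hpos⟩

end artin

section

variable {K : Type*} [Field K]

theorem UnramifiedOutside.of_dvd {n m : Ideal (𝓞 K)} {L : Type*} [Field L] [Algebra K L] (h : m ∣ n)
    (hu : UnramifiedOutside m L) : UnramifiedOutside n L :=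
  fun Q hQ hd => hu Q hQ fun h' => hd (h'.trans h)

theorem mem_galOver_iff {Ω : Type*} [Field Ω] [Algebra K Ω] {H F : IntermediateField K Ω}
    (σ : Gal(F/K)) : σ ∈ galOver H F ↔ ∀ x : F, (x : Ω) ∈ H → σ x = x :=
  IntermediateField.mem_fixingSubgroup_iff _ _

end

section artin

variable {K : Type*} [Field K] [NumberField K] {n m : Ideal (𝓞 K)}

theorem IsArtinMap.comp_inclusion {L : Type*} [Field L] [Algebra K L] (h : m ∣ n)
    {φ : idealsPrimeTo K m →* Gal(L/K)} (hφ : IsArtinMap φ) :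
    IsArtinMap (φ.comp (Subgroup.inclusion (idealsPrimeTo_le h))) :=
  fun _ v hJ Q hQ hQv => hφ _ v hJ Q hQ hQv

/-- For `m ∣ n` the ray class field modulo `m` is contained in that modulo `n`, and the Artin symbol
of an ideal prime to `n` is trivial on it exactly for the ideals in `R_m`. -/
theorem IsRayClassField.le_and_mem_galOver_iff {Ω : Type*} [Field Ω] [Algebra K Ω]
    {Lm Ln : IntermediateField K Ω} (hn : n ≠ ⊥) (h : m ∣ n) (hLm : IsRayClassField K m Lm)
    (hLn : IsRayClassField K n Ln) {φ : idealsPrimeTo K n →* Gal(Ln/K)} (hφ : IsArtinMap φ)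
    (hker : ∀ J : idealsPrimeTo K n, φ J = 1 ↔
      (J : (FractionalIdeal (𝓞 K)⁰ K)ˣ) ∈ rayIdeals K n) :
    Lm ≤ Ln ∧ ∀ J : idealsPrimeTo K n, φ J ∈ galOver Lm Ln ↔
      (J : (FractionalIdeal (𝓞 K)⁰ K)ˣ) ∈ rayIdeals K m := by
  have := hLm.finite
  have := hLn.finite
  have := hLm.abelian
  have := hLn.abelian
  obtain ⟨φm', hφm', -, hkerm⟩ := hLm.artin
  let φm := φm'.comp (Subgroup.inclusion (idealsPrimeTo_le h))
  have hφm : IsArtinMap φm := IsArtinMap.comp_inclusion h hφm'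
  let E : IntermediateField K Ω := Lm ⊔ Ln
  let _ : Algebra Lm E := (IntermediateField.inclusion (le_sup_left : Lm ≤ E)).toAlgebra
  let _ : Algebra Ln E := (IntermediateField.inclusion (le_sup_right : Ln ≤ E)).toAlgebra
  have : IsScalarTower K Lm E := IsScalarTower.of_algebraMap_eq' rfl
  have : IsScalarTower K Ln E := IsScalarTower.of_algebraMap_eq' rfl
  have : FiniteDimensional K E := IntermediateField.finiteDimensional_sup Lm Ln
  have : Normal K E := IntermediateField.normal_sup K Ω Lm Ln
  have : IsGalois K E := {}
  have hrm : ∀ (g : Gal(E/K)) (y : Lm), ((AlgEquiv.restrictNormalHom Lm g y : Lm) : Ω) =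
      (g (algebraMap Lm E y) : E) := fun g y =>
    congrArg (Subtype.val : E → Ω) (AlgEquiv.restrictNormal_commutes g Lm y)
  have hrn : ∀ (g : Gal(E/K)) (y : Ln), ((AlgEquiv.restrictNormalHom Ln g y : Ln) : Ω) =
      (g (algebraMap Ln E y) : E) := fun g y =>
    congrArg (Subtype.val : E → Ω) (AlgEquiv.restrictNormal_commutes g Ln y)
  have hinj : ∀ g : Gal(E/K), AlgEquiv.restrictNormalHom Lm g = 1 →
      AlgEquiv.restrictNormalHom Ln g = 1 → g = 1 := by
    intro g h1 h2
    let F : IntermediateField K Ω :=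
      (IntermediateField.fixedField (Subgroup.zpowers g)).map E.val
    have hF : ∀ x : E, g x = x → (x : Ω) ∈ F := by
      intro x hx
      refine ⟨x, ?_, rfl⟩
      rintro ⟨_, k, rfl⟩
      change (g ^ k) • x = x
      exact MulAction.mem_stabilizer_iff.1 (zpow_mem (MulAction.mem_stabilizer_iff.2 hx) k)
    have hEF : E ≤ F := by
      refine sup_le (fun x hx => ?_) (fun x hx => ?_)
      · refine hF (algebraMap Lm E ⟨x, hx⟩) (Subtype.ext ?_)
        rw [← hrm, h1]
        rfl
      · refine hF (algebraMap Ln E ⟨x, hx⟩) (Subtype.ext ?_)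
        rw [← hrn, h2]
        rfl
    ext x
    obtain ⟨y, hy, hyx⟩ := hEF x.2
    obtain rfl : y = x := Subtype.ext hyx
    exact congrArg (Subtype.val : E → Ω) (hy ⟨g, Subgroup.mem_zpowers g⟩)
  have hab : IsAbelianGalois K E := { is_comm := ⟨fun a b => by
    have hc : ∀ a b : Gal(E/K), a * b * (b * a)⁻¹ = 1 := fun a b => by
      refine hinj _ ?_ ?_ <;>
      · rw [map_mul, map_inv, map_mul, map_mul, mul_inv_eq_one]
        exact mul_comm' _ _
    exact mul_inv_eq_one.1 (hc a b)⟩ }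
  have hkey := exists_restrictNormalHom_eq_artin hn hinj hφm hφ
    (UnramifiedOutside.of_dvd h hLm.unramified) hLn.unramified
  have hkerm' : ∀ J : idealsPrimeTo K n, φm J = 1 ↔
      (J : (FractionalIdeal (𝓞 K)⁰ K)ˣ) ∈ rayIdeals K m := fun J => hkerm _
  have hle : ∀ J, φ J = 1 → φm J = 1 := fun J hJ =>
    (hkerm' J).2 (rayIdeals_subset h ((hker J).1 hJ))
  have hmn : Lm ≤ Ln := by
    intro x hx
    have : FiniteDimensional Ln E := FiniteDimensional.right K Ln E
    have : IsGalois Ln E := IsGalois.tower_top_of_isGalois K Ln E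
    have hfix : algebraMap Lm E ⟨x, hx⟩ ∈ Set.range (algebraMap Ln E) := by
      rw [IsGalois.mem_range_algebraMap_iff_fixed]
      intro f
      have hf1 : AlgEquiv.restrictNormalHom Ln (f.restrictScalars K) = 1 :=
        restrictNormalHom_restrictScalars f
      obtain ⟨J, hJm, hJn⟩ := hkey (f.restrictScalars K)
      have hf2 := hinj _ (hJm.trans (hle J (hJn.symm.trans hf1))) hf1
      exact DFunLike.congr_fun hf2 _
    obtain ⟨y, hy⟩ := hfix
    have : (y : Ω) = x := congrArg (Subtype.val : E → Ω) hy
    rw [← this]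
    exact y.2
  · refine ⟨hmn, fun J => ?_⟩
    obtain ⟨g, hg⟩ := AlgEquiv.restrictNormalHom_surjective E (K₁ := Ln) (φ J)
    obtain ⟨J', hJm, hJn⟩ := hkey g
    have hJJ' : φm J = φm J' := by
      rw [← mul_inv_eq_one, ← map_inv, ← map_mul]
      refine hle _ ?_
      rw [map_mul, map_inv, ← hJn, hg, mul_inv_cancel]
    rw [← hkerm', hJJ', ← hJm, mem_galOver_iff, ← hg]
    constructor
    · intro hfix
      ext x
      refine (hrm g x).trans ?_
      have h2 := hrn g ⟨x, hmn x.2⟩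
      rw [hfix ⟨x, hmn x.2⟩ x.2] at h2
      exact h2.symm
    · intro h1 x hx
      refine Subtype.ext ?_
      rw [hrn]
      have h2 := hrm g ⟨x, hx⟩
      rw [h1] at h2
      exact h2.symm

end artin

/-! ### Norms at unramified primes -/

section norm

open scoped Pointwise

variable {A B G : Type*} [CommRing A] [CommRing B] [Algebra A B] [Group G]
  [MulSemiringAction G B] [SMulCommClass G A B]

theorem Ideal.smul_mem_map {I : Ideal A} (σ : G) {x : B} (hx : x ∈ I.map (algebraMap A B)) :
    σ • x ∈ I.map (algebraMap A B) := by
  have h : I.map (algebraMap A B) ≤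
      (I.map (algebraMap A B)).comap (MulSemiringAction.toRingHom G B σ) := by
    rw [Ideal.map_le_iff_le_comap]
    intro a ha
    rw [Ideal.mem_comap, Ideal.mem_comap]
    change σ • algebraMap A B a ∈ _
    rw [smul_algebraMap]
    exact Ideal.mem_map_of_mem _ ha
  exact h hx

variable [Fintype G]

theorem Ideal.prod_smul_sub_prod_smul_mem_map {I : Ideal A} {x y : B}
    (h : x - y ∈ I.map (algebraMap A B)) :
    ∏ σ : G, σ • x - ∏ σ : G, σ • y ∈ I.map (algebraMap A B) := by
  rw [← Ideal.Quotient.eq, map_prod, map_prod]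
  refine Finset.prod_congr rfl fun σ _ => ?_
  rw [Ideal.Quotient.eq, ← smul_sub]
  exact Ideal.smul_mem_map σ h

theorem Finset.exists_prod_one_add_mul_eq {ι R : Type*} [CommRing R] (s : Finset ι) (a : R)
    (f : ι → R) :
    ∃ r, ∏ i ∈ s, (1 + a * f i) = 1 + a * ∑ i ∈ s, f i + a ^ 2 * r := by
  classical
  induction s using Finset.induction_on with
  | empty => exact ⟨0, by simp⟩
  | insert i s hi ih =>
    obtain ⟨r, hr⟩ := ih
    refine ⟨r + f i * ∑ j ∈ s, f j + a * f i * r, ?_⟩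
    rw [Finset.prod_insert hi, Finset.sum_insert hi, hr]
    ring

/-- An element that is `1` modulo `P` and `0` modulo all the other conjugates of `P`. -/
theorem Ideal.exists_sub_one_mem_and_smul_mem (P : Ideal B) [P.IsMaximal] :
    ∃ e : B, (∀ σ ∈ MulAction.stabilizer G P, σ • e - 1 ∈ P) ∧
      ∀ σ ∉ MulAction.stabilizer G P, σ • e ∈ P := by
  classical
  have h : ∀ σ : G, ∃ e : B, e - 1 ∈ P ∧ (σ ∉ MulAction.stabilizer G P → e ∈ σ⁻¹ • P) := by
    intro σ
    by_cases hσ : σ ∈ MulAction.stabilizer G P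
    · exact ⟨1, by simp, fun h => absurd hσ h⟩
    · have hne : P ⊔ σ⁻¹ • P = ⊤ := by
        by_contra hne
        have h1 : P = P ⊔ σ⁻¹ • P := (inferInstance : P.IsMaximal).eq_of_le hne le_sup_left
        have h2 : σ⁻¹ • P ≤ P := le_sup_right.trans h1.ge
        have hmax : (σ⁻¹ • P).IsMaximal :=
          Ideal.map_isMaximal_of_equiv (MulSemiringAction.toRingEquiv G B σ⁻¹)
        have h3 : σ⁻¹ • P = P := hmax.eq_of_le (inferInstance : P.IsMaximal).ne_top h2
        exact hσ (inv_mem_iff.1 (MulAction.mem_stabilizer_iff.2 h3))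
      obtain ⟨x, hx, y, hy, hxy⟩ := Submodule.mem_sup.1 ((Ideal.eq_top_iff_one _).1 hne)
      refine ⟨y, ?_, fun _ => hy⟩
      rw [← hxy, sub_add_cancel_right]
      exact neg_mem hx
  choose e he1 he2 using h
  have hprod : ∏ σ : G, e σ - 1 ∈ P := by
    rw [← Ideal.Quotient.eq, map_prod, map_one]
    exact Finset.prod_eq_one fun σ _ => by
      rw [← map_one (Ideal.Quotient.mk P), Ideal.Quotient.eq]
      exact he1 σ
  refine ⟨∏ σ : G, e σ, fun σ hσ => ?_, fun σ hσ => ?_⟩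
  · have h1 := Ideal.smul_mem_pointwise_smul_iff (a := σ).2 hprod
    rwa [MulAction.mem_stabilizer_iff.1 hσ, smul_sub, smul_one] at h1
  · have h1 := Ideal.mul_mem_left (σ⁻¹ • P) (∏ τ ∈ Finset.univ.erase σ, e τ) (he2 σ hσ)
    rw [Finset.prod_erase_mul _ _ (Finset.mem_univ σ)] at h1
    have h2 := Ideal.smul_mem_pointwise_smul_iff (a := σ).2 h1
    rwa [smul_inv_smul] at h2

section residue

variable [Algebra.IsInvariant A B G] (P : Ideal B) [P.IsMaximal]

/-- At an unramified prime the decomposition group is the Galois group of the residue fields. -/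
theorem Ideal.bijective_stabilizerHom (hP : P.inertia G = ⊥) :
    Function.Bijective (Ideal.Quotient.stabilizerHom P (P.under A) G) := by
  refine ⟨(MonoidHom.ker_eq_bot_iff _).1 ?_, Ideal.Quotient.stabilizerHom_surjective G _ P⟩
  rw [← (Subgroup.map_injective (Subgroup.subtype_injective _)).eq_iff, Subgroup.map_bot, ← hP]
  exact Ideal.Quotient.map_ker_stabilizer_subtype P (P.under A) G

variable [Finite (B ⧸ P)]

/-- At an unramified prime the norm is surjective modulo the prime: an element that lifts a given
residue at `P` and is `1` at the other conjugates of `P` has as its norm the norm of that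
residue. -/
theorem Ideal.exists_prod_smul_eq_of_inertia_eq_bot (hP : P.inertia G = ⊥) (c : A) :
    ∃ (y : B) (c' : A), algebraMap A B c' = ∏ σ : G, σ • y ∧ c' - c ∈ P.under A := by
  classical
  have hmax : (P.under A).IsMaximal := by
    have : Algebra.IsIntegral A B := Algebra.IsInvariant.isIntegral A B G
    exact Ideal.IsMaximal.under A P
  let _ : Field (A ⧸ P.under A) := Ideal.Quotient.field _
  let _ : Field (B ⧸ P) := Ideal.Quotient.field _
  have hinj : Function.Injective (algebraMap (A ⧸ P.under A) (B ⧸ P)) :=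
    Ideal.algebraMap_quotient_injective
  have : Finite (A ⧸ P.under A) := Finite.of_injective _ hinj
  have : Module.Finite (A ⧸ P.under A) (B ⧸ P) := Module.Finite.of_finite
  obtain ⟨b, hb⟩ := FiniteField.norm_surjective (A ⧸ P.under A) (B ⧸ P)
    (Ideal.Quotient.mk _ c)
  obtain ⟨b, rfl⟩ := Ideal.Quotient.mk_surjective b
  obtain ⟨e, he1, he2⟩ := P.exists_sub_one_mem_and_smul_mem (G := G)
  let y := e * (b - 1) + 1
  obtain ⟨c', hc'⟩ := Algebra.IsInvariant.isInvariant (A := A) (G := G) (∏ σ : G, σ • y)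
    fun g => by
      rw [Finset.smul_prod']
      exact Fintype.prod_equiv (Equiv.mulLeft g) _ _ fun σ => by simp [mul_smul]
  refine ⟨y, c', hc', ?_⟩
  rw [Ideal.mem_comap, map_sub, ← Ideal.Quotient.eq, hc', map_prod]
  have h1 : ∀ σ : G, Ideal.Quotient.mk P (σ • y) =
      if σ ∈ MulAction.stabilizer G P then Ideal.Quotient.mk P (σ • b) else 1 := by
    intro σ
    rw [← map_one (Ideal.Quotient.mk P), ← apply_ite (Ideal.Quotient.mk P), Ideal.Quotient.eq]
    simp only [y, smul_add, smul_mul', smul_sub, smul_one]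
    split_ifs with hσ
    · have : σ • e * (σ • b - 1) + 1 - σ • b = (σ • e - 1) * (σ • b - 1) := by ring
      rw [this]
      exact Ideal.mul_mem_right _ _ (he1 σ hσ)
    · rw [add_sub_cancel_right]
      exact Ideal.mul_mem_right _ _ (he2 σ hσ)
  rw [Finset.prod_congr rfl fun σ _ => h1 σ, Finset.prod_ite, Finset.prod_const_one, mul_one]
  have h2 := Algebra.norm_eq_prod_automorphisms (A ⧸ P.under A) (Ideal.Quotient.mk P b)
  rw [hb] at h2
  refine Eq.trans ?_ h2.symm
  rw [Finset.prod_subtype (p := fun σ => σ ∈ MulAction.stabilizer G P) _ (by simp)]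
  exact Fintype.prod_bijective _ (Ideal.bijective_stabilizerHom (A := A) P hP) _ _ fun σ => rfl

/-- At an unramified prime `1` is a trace modulo the prime. -/
theorem Ideal.exists_sum_smul_eq_of_inertia_eq_bot (hP : P.inertia G = ⊥) :
    ∃ (z : B) (t : A), algebraMap A B t = ∑ σ : G, σ • z ∧ t - 1 ∈ P.under A := by
  classical
  have hmax : (P.under A).IsMaximal := by
    have : Algebra.IsIntegral A B := Algebra.IsInvariant.isIntegral A B G
    exact Ideal.IsMaximal.under A P
  let _ : Field (A ⧸ P.under A) := Ideal.Quotient.field _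
  let _ : Field (B ⧸ P) := Ideal.Quotient.field _
  have hinj : Function.Injective (algebraMap (A ⧸ P.under A) (B ⧸ P)) :=
    Ideal.algebraMap_quotient_injective
  have : Finite (A ⧸ P.under A) := Finite.of_injective _ hinj
  have : Module.Finite (A ⧸ P.under A) (B ⧸ P) := Module.Finite.of_finite
  obtain ⟨b, hb⟩ := Algebra.trace_surjective (A ⧸ P.under A) (B ⧸ P) 1
  obtain ⟨b, rfl⟩ := Ideal.Quotient.mk_surjective b
  obtain ⟨e, he1, he2⟩ := P.exists_sub_one_mem_and_smul_mem (G := G)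
  obtain ⟨t, ht⟩ := Algebra.IsInvariant.isInvariant (A := A) (G := G) (∑ σ : G, σ • (e * b))
    fun g => by
      rw [Finset.smul_sum]
      exact Fintype.sum_equiv (Equiv.mulLeft g) _ _ fun σ => by simp [mul_smul]
  refine ⟨e * b, t, ht, ?_⟩
  rw [Ideal.mem_comap, map_sub, ← Ideal.Quotient.eq, ht, map_sum]
  have h1 : ∀ σ : G, Ideal.Quotient.mk P (σ • (e * b)) =
      if σ ∈ MulAction.stabilizer G P then Ideal.Quotient.mk P (σ • b) else 0 := by
    intro σ
    rw [← map_zero (Ideal.Quotient.mk P), ← apply_ite (Ideal.Quotient.mk P), Ideal.Quotient.eq,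
      smul_mul']
    split_ifs with hσ
    · rw [← sub_one_mul]
      exact Ideal.mul_mem_right _ _ (he1 σ hσ)
    · rw [sub_zero]
      exact Ideal.mul_mem_right _ _ (he2 σ hσ)
  rw [Finset.sum_congr rfl fun σ _ => h1 σ, Finset.sum_ite, Finset.sum_const_zero, add_zero]
  have h2 := trace_eq_sum_automorphisms (K := A ⧸ P.under A) (Ideal.Quotient.mk P b)
  rw [hb, map_one] at h2
  rw [map_one, map_one]
  refine Eq.trans ?_ h2.symm
  rw [Finset.sum_subtype (p := fun σ => σ ∈ MulAction.stabilizer G P) _ (by simp)]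
  exact Fintype.sum_bijective _ (Ideal.bijective_stabilizerHom (A := A) P hP) _ _ fun σ => rfl

/-- At an unramified prime, every unit is a norm modulo every power of the prime: the residue norm
is surjective, and the approximation is refined using the surjectivity of the residue trace. -/
theorem Ideal.exists_prod_smul_eq_of_inertia_eq_bot_of_notMem [Module.FaithfullyFlat A B]
    (hP : P.inertia G = ⊥) {c : A} (hc : c ∉ P.under A) (k : ℕ) :
    ∃ (y : B) (c' : A), algebraMap A B c' = ∏ σ : G, σ • y ∧ c' - c ∈ P.under A ^ (k + 1) := by
  have hmax : (P.under A).IsMaximal := by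
    have : Algebra.IsIntegral A B := Algebra.IsInvariant.isIntegral A B G
    exact Ideal.IsMaximal.under A P
  set p := P.under A with hp
  induction k with
  | zero =>
    simpa only [zero_add, pow_one] using Ideal.exists_prod_smul_eq_of_inertia_eq_bot P hP c
  | succ k ih =>
    obtain ⟨y, c', hy, hc'⟩ := ih
    obtain ⟨z, t, hz, ht⟩ := Ideal.exists_sum_smul_eq_of_inertia_eq_bot (A := A) P hP
    have hc'p : c' ∉ p := fun h => hc (by
      have := sub_mem h (Ideal.pow_le_self k.succ_ne_zero hc')
      rwa [sub_sub_cancel] at this)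
    obtain ⟨u, hu⟩ : ∃ u, c' * u - 1 ∈ p := by
      obtain ⟨u, i, hi, h⟩ := hmax.exists_inv hc'p
      exact ⟨u, by rw [← h, mul_comm, sub_add_cancel_left]; exact neg_mem hi⟩
    set a := (c - c') * u with ha
    have hap : a ∈ p ^ (k + 1) := Ideal.mul_mem_right _ _ (by rw [← neg_sub]; exact neg_mem hc')
    -- `N (1 + a * z) = 1 + a * Tr z` modulo `a ^ 2`, and `Tr z` is `1` modulo `p`.
    obtain ⟨r, hr⟩ := Finset.exists_prod_one_add_mul_eq Finset.univ (algebraMap A B a)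
      fun σ : G => σ • z
    let y' := y * (1 + algebraMap A B a * z)
    have hy' : ∏ σ : G, σ • y' = algebraMap A B (c' * (1 + a * t)) +
        algebraMap A B (a ^ 2) * (algebraMap A B c' * r) := by
      simp only [y', smul_mul', smul_add, smul_one, smul_algebraMap, Finset.prod_mul_distrib]
      rw [hr, ← hy, ← hz]
      simp only [map_mul, map_add, map_one, map_pow]
      ring
    obtain ⟨c'', hc''⟩ := Algebra.IsInvariant.isInvariant (A := A) (G := G) (∏ σ : G, σ • y')
      fun g => by
        rw [Finset.smul_prod']
        exact Fintype.prod_equiv (Equiv.mulLeft g) _ _ fun σ => by simp [mul_smul]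
    refine ⟨y', c'', hc'', ?_⟩
    have h1 : c'' - c' * (1 + a * t) ∈ p ^ (k + 1 + 1) := by
      rw [← Ideal.comap_map_eq_self_of_faithfullyFlat (B := B) (p ^ (k + 1 + 1)), Ideal.mem_comap,
        map_sub, hc'', hy', add_sub_cancel_left]
      refine Ideal.mul_mem_right _ _ (Ideal.mem_map_of_mem _ ?_)
      have h2 := Ideal.pow_mem_pow hap 2
      rw [← pow_mul] at h2
      exact Ideal.pow_le_pow_right (by omega) h2
    have h3 : c' * (1 + a * t) - c = (c' - c) * (1 - c' * u * t) := by
      rw [ha]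
      ring
    have h4 : c' * (1 + a * t) - c ∈ p ^ (k + 1 + 1) := by
      rw [h3, pow_succ]
      refine Ideal.mul_mem_mul hc' ?_
      have : 1 - c' * u * t = -((c' * u - 1) * t + (t - 1)) := by ring
      rw [this]
      exact neg_mem (add_mem (Ideal.mul_mem_right _ _ hu) ht)
    have := add_mem h1 h4
    rwa [sub_add_sub_cancel] at this

/-- A norm approximating `c` modulo `p ^ k` can be chosen to approximate `1` modulo `m`: take
`y` near `p` and `1` near `m`. -/
theorem Ideal.exists_prod_smul_eq_of_inertia_eq_bot_of_isCoprime [Module.FaithfullyFlat A B]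
    (hP : P.inertia G = ⊥) {c : A} (hc : c ∉ P.under A) {k : ℕ} (hk : k ≠ 0) {m : Ideal A}
    (hm : IsCoprime (P.under A ^ k) m) (hcm : c - 1 ∈ m) :
    ∃ (y : B) (c' : A), algebraMap A B c' = ∏ σ : G, σ • y ∧ c' - c ∈ P.under A ^ k * m := by
  obtain ⟨k, rfl⟩ := Nat.exists_eq_succ_of_ne_zero hk
  obtain ⟨y, c', hy, hc'⟩ := Ideal.exists_prod_smul_eq_of_inertia_eq_bot_of_notMem P hP hc k
  obtain ⟨a, ha, b, hb, hab⟩ := Ideal.isCoprime_iff_exists.1 hm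
  let y' := algebraMap A B b * y + algebraMap A B a
  obtain ⟨c'', hc''⟩ := Algebra.IsInvariant.isInvariant (A := A) (G := G) (∏ σ : G, σ • y')
    fun g => by
      rw [Finset.smul_prod']
      exact Fintype.prod_equiv (Equiv.mulLeft g) _ _ fun σ => by simp [mul_smul]
  have hab' : algebraMap A B a + algebraMap A B b = 1 := by rw [← map_add, hab, map_one]
  refine ⟨y', c'', hc'', ?_⟩
  rw [Ideal.mul_eq_inf_of_coprime (Ideal.isCoprime_iff_sup_eq.1 hm)]
  constructor
  · have h1 : c'' - c' ∈ P.under A ^ (k + 1) := by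
      rw [← Ideal.comap_map_eq_self_of_faithfullyFlat (B := B) (P.under A ^ (k + 1)),
        Ideal.mem_comap, map_sub, hc'', hy]
      refine Ideal.prod_smul_sub_prod_smul_mem_map ?_
      have : y' - y = algebraMap A B a * (1 - y) := by
        simp only [y']
        linear_combination (y) * hab'
      rw [this]
      exact Ideal.mul_mem_right _ _ (Ideal.mem_map_of_mem _ ha)
    have := add_mem h1 hc'
    rwa [sub_add_sub_cancel] at this
  · have h1 : c'' - 1 ∈ m := by
      have h2 : ∏ σ : G, σ • (1 : B) = 1 := by simp
      rw [← Ideal.comap_map_eq_self_of_faithfullyFlat (B := B) m, Ideal.mem_comap, map_sub, hc'',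
        map_one, ← h2]
      refine Ideal.prod_smul_sub_prod_smul_mem_map ?_
      have : y' - 1 = algebraMap A B b * (y - 1) := by
        simp only [y']
        linear_combination hab'
      rw [this]
      exact Ideal.mul_mem_right _ _ (Ideal.mem_map_of_mem _ hb)
    have := sub_mem h1 hcm
    rwa [sub_sub_sub_cancel_right] at this

end residue

end norm

/-! ### Principal ideals prime to the modulus -/

section coprime

variable {R : Type*} [CommRing R] {n : Ideal R}

theorem isCoprime_span_mul {c d : R} (hc : IsCoprime (Ideal.span {c}) n)
    (hd : IsCoprime (Ideal.span {d}) n) : IsCoprime (Ideal.span {c * d}) n := by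
  rw [← Ideal.span_singleton_mul_span_singleton]
  exact hc.mul_left hd

theorem isCoprime_span_iff {c : R} :
    IsCoprime (Ideal.span {c}) n ↔ ∃ d, c * d - 1 ∈ n := by
  rw [Ideal.isCoprime_iff_exists]
  constructor
  · rintro ⟨i, hi, j, hj, h⟩
    obtain ⟨d, rfl⟩ := Ideal.mem_span_singleton'.1 hi
    exact ⟨d, by rw [← h, mul_comm, sub_add_cancel_left]; exact neg_mem hj⟩
  · rintro ⟨d, hd⟩
    refine ⟨c * d, Ideal.mul_mem_right _ _ (Ideal.mem_span_singleton_self c), -(c * d - 1),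
      neg_mem hd, by ring⟩

end coprime

section principal

variable {K : Type*} [Field K] [NumberField K] {n m : Ideal (𝓞 K)}

theorem Ideal.isCoprime_of_forall_not_dvd {I : Ideal (𝓞 K)} (hn : n ≠ ⊥)
    (h : ∀ v : HeightOneSpectrum (𝓞 K), v.asIdeal ∣ n → ¬ v.asIdeal ∣ I) : IsCoprime I n := by
  rw [Ideal.isCoprime_iff_sup_eq]
  by_contra hne
  obtain ⟨M, hM, hle⟩ := Ideal.exists_le_maximal _ hne
  have hnM : n ≤ M := le_sup_right.trans hle
  exact h ⟨M, hM.isPrime, fun h0 => hn (le_bot_iff.1 (h0 ▸ hnM))⟩ (Ideal.dvd_iff_le.2 hnM)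
    (Ideal.dvd_iff_le.2 (le_sup_left.trans hle))

theorem FractionalIdeal.count_coe_ne_zero_of_dvd {v : HeightOneSpectrum (𝓞 K)} {I : Ideal (𝓞 K)}
    (hI : I ≠ ⊥) (hv : v.asIdeal ∣ I) :
    FractionalIdeal.count K v (I : FractionalIdeal (𝓞 K)⁰ K) ≠ 0 := by
  classical
  rw [FractionalIdeal.count_coe K v hI]
  exact_mod_cast (Associates.count_ne_zero_iff_dvd hI v.irreducible).2 hv

theorem FractionalIdeal.dvd_of_count_coe_ne_zero {v : HeightOneSpectrum (𝓞 K)} {I : Ideal (𝓞 K)}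
    (hI : I ≠ ⊥) (h : FractionalIdeal.count K v (I : FractionalIdeal (𝓞 K)⁰ K) ≠ 0) :
    v.asIdeal ∣ I := by
  classical
  rw [FractionalIdeal.count_coe K v hI] at h
  exact (Associates.count_ne_zero_iff_dvd hI v.irreducible).1 (by exact_mod_cast h)

/-- The nonzero principal ideal `(c)`, as an element of `I_n`. -/
noncomputable def principalPrimeTo (c : 𝓞 K) (h0 : c ≠ 0) (hc : IsCoprime (Ideal.span {c}) n) :
    idealsPrimeTo K n :=
  primeToIdeal (Ideal.span {c}) (by rwa [Ne, Ideal.span_singleton_eq_bot]) hc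

theorem coe_principalPrimeTo {c : 𝓞 K} {h0 : c ≠ 0} {hc : IsCoprime (Ideal.span {c}) n} :
    ((principalPrimeTo c h0 hc : idealsPrimeTo K n) : (FractionalIdeal (𝓞 K)⁰ K)ˣ) =
      toPrincipalIdeal (𝓞 K) K (Units.mk0 (c : K) (RingOfIntegers.coe_ne_zero_iff.2 h0)) := by
  refine Units.ext ?_
  rw [coe_toPrincipalIdeal]
  exact FractionalIdeal.coeIdeal_span_singleton c

theorem exists_ne_zero_mul_sub_one_mem {c : 𝓞 K} (hc : IsCoprime (Ideal.span {c}) n) :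
    ∃ d, d ≠ 0 ∧ IsCoprime (Ideal.span {d}) n ∧ c * d - 1 ∈ n := by
  obtain ⟨d, hd⟩ := isCoprime_span_iff.1 hc
  by_cases h0 : d = 0
  · have hn : n = ⊤ := by
      rw [Ideal.eq_top_iff_one, ← neg_mem_iff]
      simpa [h0] using hd
    subst hn
    exact ⟨1, one_ne_zero, by simp [Ideal.isCoprime_iff_sup_eq], Submodule.mem_top⟩
  · exact ⟨d, h0, isCoprime_span_iff.2 ⟨c, by rwa [mul_comm]⟩, hd⟩

/-- A principal ideal prime to `n` is the quotient of two integers prime to `n`. -/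
theorem exists_eq_div_of_toPrincipalIdeal_mem (hn : n ≠ ⊥) {x : Kˣ}
    (hx : toPrincipalIdeal (𝓞 K) K x ∈ idealsPrimeTo K n) :
    ∃ a b : 𝓞 K, a ≠ 0 ∧ b ≠ 0 ∧ IsCoprime (Ideal.span {a}) n ∧ IsCoprime (Ideal.span {b}) n ∧
      (x : K) = (a : K) / (b : K) := by
  obtain ⟨r, s, hs0, hxrs⟩ := IsFractionRing.div_surjective (A := 𝓞 K) (x : K)
  replace hs0 : s ≠ 0 := nonZeroDivisors.ne_zero hs0
  have hsK : (s : K) ≠ 0 := RingOfIntegers.coe_ne_zero_iff.2 hs0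
  have hr0 : r ≠ 0 := by
    rintro rfl
    exact x.ne_zero (by rw [← hxrs, map_zero, zero_div])
  -- Remove the common divisor of numerator and denominator.
  set g : Ideal (𝓞 K) := Ideal.span {r} ⊔ Ideal.span {s} with hg
  have hg0 : g ≠ ⊥ := fun h => hs0 (by
    rw [← Ideal.mem_bot, ← h]
    exact Ideal.mem_sup_right (Ideal.mem_span_singleton_self s))
  obtain ⟨I, hI⟩ : g ∣ Ideal.span {r} := Ideal.dvd_iff_le.2 le_sup_left
  obtain ⟨I', hI'⟩ : g ∣ Ideal.span {s} := Ideal.dvd_iff_le.2 le_sup_right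
  have hII' : I ⊔ I' = ⊤ := by
    have h1 : g * (I ⊔ I') = g * ⊤ := by rw [Ideal.mul_sup, ← hI, ← hI', Ideal.mul_top]
    exact mul_left_cancel₀ (by simpa using hg0) h1
  have hI0 : I ≠ ⊥ := by
    rintro rfl
    rw [Ideal.mul_bot, Ideal.span_singleton_eq_bot] at hI
    exact hr0 hI
  have hI'0 : I' ≠ ⊥ := by
    rintro rfl
    rw [Ideal.mul_bot, Ideal.span_singleton_eq_bot] at hI'
    exact hs0 hI'
  have hrel : (toPrincipalIdeal (𝓞 K) K x : FractionalIdeal (𝓞 K)⁰ K) * I' = I := by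
    have hg0' : (g : FractionalIdeal (𝓞 K)⁰ K) ≠ 0 := FractionalIdeal.coeIdeal_ne_zero.2 hg0
    apply mul_left_cancel₀ hg0'
    rw [mul_left_comm, ← FractionalIdeal.coeIdeal_mul, ← FractionalIdeal.coeIdeal_mul, ← hI, ← hI',
      FractionalIdeal.coeIdeal_span_singleton, FractionalIdeal.coeIdeal_span_singleton,
      coe_toPrincipalIdeal, FractionalIdeal.spanSingleton_mul_spanSingleton, ← hxrs,
      div_mul_cancel₀ _ hsK]
  have hcop : IsCoprime I' n := by
    refine Ideal.isCoprime_of_forall_not_dvd hn fun v hv hvI' => ?_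
    have h1 := FractionalIdeal.count_coe_ne_zero_of_dvd hI'0 hvI'
    have h2 := FractionalIdeal.count_mul K v (toPrincipalIdeal (𝓞 K) K x).ne_zero
      (FractionalIdeal.coeIdeal_ne_zero.2 hI'0)
    rw [hrel, hx v hv, zero_add] at h2
    rw [← h2] at h1
    have h3 := FractionalIdeal.dvd_of_count_coe_ne_zero hI0 h1
    exact v.isPrime.ne_top
      (top_le_iff.1 (hII' ▸ sup_le (Ideal.le_of_dvd h3) (Ideal.le_of_dvd hvI')))
  obtain ⟨b, hb, hb0, hbn⟩ : ∃ b ∈ I', b ≠ 0 ∧ IsCoprime (Ideal.span {b}) n := by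
    obtain ⟨i, hi, j, hj, hij⟩ := Ideal.isCoprime_iff_exists.1 hcop
    by_cases h0 : i = 0
    · have hntop : n = ⊤ := by
        rw [h0, zero_add] at hij
        rwa [Ideal.eq_top_iff_one, ← hij]
      obtain ⟨b, hb, hb0⟩ := Submodule.exists_mem_ne_zero_of_ne_bot hI'0
      exact ⟨b, hb, hb0, by simp [Ideal.isCoprime_iff_sup_eq, hntop]⟩
    · refine ⟨i, hi, h0, isCoprime_span_iff.2 ⟨1, ?_⟩⟩
      rw [mul_one, ← hij, sub_add_cancel_left]
      exact neg_mem hj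
  obtain ⟨a, ha, hax⟩ : ∃ a ∈ I, (a : K) = x * (b : K) := by
    have h1 : (x : K) * (b : K) ∈ (I : FractionalIdeal (𝓞 K)⁰ K) := by
      rw [← hrel]
      refine FractionalIdeal.mul_mem_mul ?_ (FractionalIdeal.mem_coeIdeal_of_mem _ hb)
      rw [coe_toPrincipalIdeal]
      exact FractionalIdeal.mem_spanSingleton_self _ _
    obtain ⟨a, ha, h⟩ := (FractionalIdeal.mem_coeIdeal _).1 h1
    exact ⟨a, ha, h⟩
  have hbK : (b : K) ≠ 0 := RingOfIntegers.coe_ne_zero_iff.2 hb0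
  have ha0 : a ≠ 0 := by
    rintro rfl
    replace hax : algebraMap (𝓞 K) K 0 = x * (b : K) := hax
    rw [map_zero, eq_comm, mul_eq_zero] at hax
    exact hax.elim x.ne_zero hbK
  refine ⟨a, b, ha0, hb0, ?_, hbn, by rw [hax, mul_div_cancel_right₀ _ hbK]⟩
  refine Ideal.isCoprime_of_forall_not_dvd hn fun v hv hva => ?_
  have ha0' : Ideal.span {a} ≠ ⊥ := by rwa [Ne, Ideal.span_singleton_eq_bot]
  have hb0' : Ideal.span {b} ≠ ⊥ := by rwa [Ne, Ideal.span_singleton_eq_bot]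
  have h1 : ((Ideal.span {a} : Ideal (𝓞 K)) : FractionalIdeal (𝓞 K)⁰ K) =
      (toPrincipalIdeal (𝓞 K) K x : FractionalIdeal (𝓞 K)⁰ K) * (Ideal.span {b} : Ideal (𝓞 K)) := by
    rw [FractionalIdeal.coeIdeal_span_singleton, FractionalIdeal.coeIdeal_span_singleton,
      coe_toPrincipalIdeal, FractionalIdeal.spanSingleton_mul_spanSingleton]
    exact congrArg _ hax
  have h2 := FractionalIdeal.count_coe_ne_zero_of_dvd ha0' hva
  rw [h1, FractionalIdeal.count_mul K v (toPrincipalIdeal (𝓞 K) K x).ne_zero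
      (FractionalIdeal.coeIdeal_ne_zero.2 hb0'), hx v hv, zero_add] at h2
  have h3 := FractionalIdeal.dvd_of_count_coe_ne_zero hb0' h2
  rw [Ideal.isCoprime_iff_sup_eq] at hbn
  exact v.isPrime.ne_top (top_le_iff.1 (hbn ▸ sup_le (Ideal.le_of_dvd h3) (Ideal.le_of_dvd hv)))

variable [IsTotallyComplex K]

/-- Without real embeddings the positivity condition in `R_n` is void. -/
theorem toPrincipalIdeal_mem_rayIdeals {x : Kˣ} (hx : ModEqOne n (x : K)) :
    toPrincipalIdeal (𝓞 K) K x ∈ rayIdeals K n := by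
  refine ⟨x, rfl, hx, fun σ => ?_⟩
  have h1 := IsTotallyComplex.isComplex (InfinitePlace.mk ((algebraMap ℝ ℂ).comp σ))
  rw [InfinitePlace.isComplex_mk_iff] at h1
  refine absurd ?_ h1
  rw [ComplexEmbedding.isReal_iff]
  ext y
  simp [ComplexEmbedding.conjugate]

section artin

variable {L : Type*} [Field L] [Algebra K L] {φ : idealsPrimeTo K n →* Gal(L/K)}

/-- The Artin symbol of a principal ideal prime to `n` depends on a generator modulo `n`. -/
theorem map_eq_principalPrimeTo
    (hker : ∀ J : idealsPrimeTo K n, φ J = 1 ↔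
      (J : (FractionalIdeal (𝓞 K)⁰ K)ˣ) ∈ rayIdeals K n)
    {J : idealsPrimeTo K n} {x : Kˣ} {a b c : 𝓞 K}
    (hJ : (J : (FractionalIdeal (𝓞 K)⁰ K)ˣ) = toPrincipalIdeal (𝓞 K) K x)
    (hx : (x : K) = (a : K) / (b : K)) (hb0 : b ≠ 0) (ha : IsCoprime (Ideal.span {a}) n)
    (hb : IsCoprime (Ideal.span {b}) n) (hc0 : c ≠ 0) (hc : IsCoprime (Ideal.span {c}) n)
    (h : a - b * c ∈ n) : φ J = φ (principalPrimeTo c hc0 hc) := by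
  rw [← mul_inv_eq_one, ← map_inv, ← map_mul, hker]
  have : ((J * (principalPrimeTo c hc0 hc)⁻¹ : idealsPrimeTo K n) :
      (FractionalIdeal (𝓞 K)⁰ K)ˣ) = toPrincipalIdeal (𝓞 K) K
        (x * (Units.mk0 (c : K) (RingOfIntegers.coe_ne_zero_iff.2 hc0))⁻¹) := by
    rw [map_mul, map_inv, ← coe_principalPrimeTo (hc := hc), ← hJ]
    rfl
  rw [this]
  refine toPrincipalIdeal_mem_rayIdeals ⟨a, b * c, mul_ne_zero hb0 hc0, ha,
    isCoprime_span_mul hb hc, h, ?_⟩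
  rw [Units.val_mul, hx, Units.val_inv_eq_inv_val, Units.val_mk0, ← div_eq_mul_inv, div_div]
  exact congrArg _ (map_mul (algebraMap (𝓞 K) K) b c).symm

theorem map_principalPrimeTo_eq_of_sub_mem
    (hker : ∀ J : idealsPrimeTo K n, φ J = 1 ↔
      (J : (FractionalIdeal (𝓞 K)⁰ K)ˣ) ∈ rayIdeals K n)
    {c d : 𝓞 K} (hc0 : c ≠ 0) (hd0 : d ≠ 0)
    (hc : IsCoprime (Ideal.span {c}) n) (hd : IsCoprime (Ideal.span {d}) n) (h : c - d ∈ n) :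
    φ (principalPrimeTo c hc0 hc) = φ (principalPrimeTo d hd0 hd) := by
  refine map_eq_principalPrimeTo hker (x := Units.mk0 (c : K) _) coe_principalPrimeTo
    (a := c) (b := 1) ?_ one_ne_zero hc ?_ hd0 hd (by rwa [one_mul])
  · simp
  · exact isCoprime_span_iff.2 ⟨1, by simp⟩

/-- Every ideal in `R_m` prime to `n` has the Artin symbol of an integer `c ≡ 1 mod m`. -/
theorem exists_map_eq_principalPrimeTo
    (hker : ∀ J : idealsPrimeTo K n, φ J = 1 ↔
      (J : (FractionalIdeal (𝓞 K)⁰ K)ˣ) ∈ rayIdeals K n)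
    (hn : n ≠ ⊥) (h : m ∣ n) {J : idealsPrimeTo K n}
    (hJ : (J : (FractionalIdeal (𝓞 K)⁰ K)ˣ) ∈ rayIdeals K m) :
    ∃ (c : 𝓞 K) (hc0 : c ≠ 0) (hc : IsCoprime (Ideal.span {c}) n), c - 1 ∈ m ∧
      φ J = φ (principalPrimeTo c hc0 hc) := by
  obtain ⟨x, hJx, ⟨a', b', hb'0, ha', hb', hab', hx'⟩, -⟩ := hJ
  obtain ⟨a, b, ha0, hb0, ha, hb, hx⟩ := exists_eq_div_of_toPrincipalIdeal_mem hn (hJx ▸ J.2)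
  have hbK : (b : K) ≠ 0 := RingOfIntegers.coe_ne_zero_iff.2 hb0
  have hb'K : (b' : K) ≠ 0 := RingOfIntegers.coe_ne_zero_iff.2 hb'0
  have hcross : a * b' = a' * b := by
    rw [hx, div_eq_div_iff hbK hb'K, ← map_mul, ← map_mul] at hx'
    exact RingOfIntegers.coe_injective hx'
  have hab : a - b ∈ m := by
    obtain ⟨d, hd⟩ := isCoprime_span_iff.1 hb'
    have : a - b = (a' - b') * (b * d) - (b' * d - 1) * (a - b) := by
      linear_combination (d) * hcross
    rw [this]
    exact sub_mem (Ideal.mul_mem_right _ _ hab') (Ideal.mul_mem_right _ _ hd)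
  obtain ⟨d, hd0, hd, hbd⟩ := exists_ne_zero_mul_sub_one_mem hb
  refine ⟨a * d, mul_ne_zero ha0 hd0, isCoprime_span_mul ha hd, ?_,
    map_eq_principalPrimeTo hker hJx hx hb0 ha hb _ _ ?_⟩
  · have : a * d - 1 = (a - b) * d + (b * d - 1) := by ring
    rw [this]
    exact add_mem (Ideal.mul_mem_right _ _ hab) (Ideal.le_of_dvd h hbd)
  · have : a - b * (a * d) = -((b * d - 1) * a) := by ring
    rw [this]
    exact neg_mem (Ideal.mul_mem_right _ _ hbd)

end artin

end principal

/-! ### Norms are killed by the Artin map -/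

section norm

variable {K M : Type*} [Field K] [Field M] [Algebra K M]

theorem IsArithFrobAt.pow_smul_sub_pow_mem {σ : Gal(M/K)} {Q : Ideal (𝓞 M)}
    (h : IsArithFrobAt (𝓞 K) σ Q) (k : ℕ) (x : 𝓞 M) :
    σ ^ k • x - x ^ Nat.card (𝓞 K ⧸ Q.under (𝓞 K)) ^ k ∈ Q := by
  induction k generalizing x with
  | zero => simp
  | succ k ih =>
    have h1 := ih (σ • x)
    have h2 : σ • x - x ^ Nat.card (𝓞 K ⧸ Q.under (𝓞 K)) ∈ Q := h x
    rw [← Ideal.Quotient.eq] at h1 h2 ⊢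
    rw [pow_succ σ, mul_smul, h1, map_pow, h2, map_pow, map_pow, ← pow_mul, pow_succ']

variable [NumberField K] [NumberField M] {n : Ideal (𝓞 K)}

theorem IsArithFrobAt.pow_inertiaDeg_mem_inertia {σ : Gal(M/K)} {Q : Ideal (𝓞 M)} [Q.IsMaximal]
    (h : IsArithFrobAt (𝓞 K) σ Q) : σ ^ Q.inertiaDeg (𝓞 K) ∈ Q.inertia Gal(M/K) := by
  intro x
  have hqmax : (Q.under (𝓞 K)).IsMaximal := Ideal.IsMaximal.under (𝓞 K) Q
  have hcard : Nat.card (𝓞 K ⧸ Q.under (𝓞 K)) ^ Q.inertiaDeg (𝓞 K) = Nat.card (𝓞 M ⧸ Q) :=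
    ((Ideal.absNorm_eq_pow_inertiaDeg'_of_liesOver Q (Q.under (𝓞 K)) inferInstance
      (NeZero.ne _)).trans (by
        rw [Ideal.inertiaDeg'_eq_inertiaDeg]
        rfl)).symm
  have h1 := h.pow_smul_sub_pow_mem (Q.inertiaDeg (𝓞 K)) x
  have hfin : Finite (𝓞 M ⧸ Q) := Ideal.finiteQuotientOfFreeOfNeBot Q (NeZero.ne Q)
  let _ : Field (𝓞 M ⧸ Q) := Ideal.Quotient.field Q
  have := Fintype.ofFinite (𝓞 M ⧸ Q)
  rw [hcard, ← Ideal.Quotient.eq, map_pow, Nat.card_eq_fintype_card, FiniteField.pow_card] at h1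
  exact Ideal.Quotient.eq.1 h1

theorem primeToIdeal_mul {I J : Ideal (𝓞 K)} (hI : I ≠ ⊥) (hJ : J ≠ ⊥) (hIn : IsCoprime I n)
    (hJn : IsCoprime J n) (hIJ : I * J ≠ ⊥) (hIJn : IsCoprime (I * J) n) :
    primeToIdeal (I * J) hIJ hIJn = primeToIdeal I hI hIn * primeToIdeal J hJ hJn :=
  Subtype.ext (Units.ext (FractionalIdeal.coeIdeal_mul I J))

theorem primeToIdeal_pow {I : Ideal (𝓞 K)} (hI : I ≠ ⊥) (hIn : IsCoprime I n) (k : ℕ)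
    (hIk : I ^ k ≠ ⊥) (hIkn : IsCoprime (I ^ k) n) :
    primeToIdeal (I ^ k) hIk hIkn = primeToIdeal I hI hIn ^ k :=
  Subtype.ext (Units.ext (FractionalIdeal.coeIdeal_pow _ K I k))

/-- The Artin symbol of the norm of an ideal is trivial: the norm of a prime `Q` over `q` is
`q ^ f`, and the `f`-th power of the Frobenius acts trivially on the residue field of `Q`. -/
theorem IsArtinMap.map_relNorm_eq_one {φ : idealsPrimeTo K n →* Gal(M/K)} (hφ : IsArtinMap φ)
    (hu : UnramifiedOutside n M) (I : Ideal (𝓞 M)) (hI : Ideal.relNorm (𝓞 K) I ≠ ⊥)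
    (hIn : IsCoprime (Ideal.relNorm (𝓞 K) I) n) :
    φ (primeToIdeal (Ideal.relNorm (𝓞 K) I) hI hIn) = 1 := by
  induction I using UniqueFactorizationMonoid.induction_on_prime with
  | h₁ => exact absurd (Ideal.relNorm_bot (𝓞 K)) hI
  | h₂ I hunit =>
    obtain rfl : I = ⊤ := by rwa [Ideal.isUnit_iff] at hunit
    rw [← map_one φ]
    refine congrArg φ (Subtype.ext (Units.ext ?_))
    rw [coe_primeToIdeal, Ideal.relNorm_top, FractionalIdeal.coeIdeal_top]
    rfl
  | h₃ I Q hI0 hQ ih =>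
    have hQprime : Q.IsPrime := Ideal.isPrime_of_prime hQ
    have hQmax : Q.IsMaximal := hQprime.isMaximal hQ.ne_zero
    have hqmax : (Q.under (𝓞 K)).IsMaximal := Ideal.IsMaximal.under (𝓞 K) Q
    let v : HeightOneSpectrum (𝓞 K) := ⟨Q.under (𝓞 K), hqmax.isPrime, NeZero.ne _⟩
    have hf : Q.inertiaDeg (𝓞 K) ≠ 0 := (Ideal.inertiaDeg_pos Q (𝓞 K)).ne'
    have hnorm : Ideal.relNorm (𝓞 K) (Q * I) =
        v.asIdeal ^ Q.inertiaDeg (𝓞 K) * Ideal.relNorm (𝓞 K) I := by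
      rw [map_mul, Ideal.relNorm_eq_pow_of_isMaximal Q (Q.under (𝓞 K))]
    have hIn' : IsCoprime (v.asIdeal ^ Q.inertiaDeg (𝓞 K) * Ideal.relNorm (𝓞 K) I) n :=
      hnorm ▸ hIn
    have hvfn := hIn'.of_mul_left_left
    have hvn : IsCoprime v.asIdeal n := (IsCoprime.pow_left_iff (Nat.pos_of_ne_zero hf)).1 hvfn
    have hvf : v.asIdeal ^ Q.inertiaDeg (𝓞 K) ≠ ⊥ := pow_ne_zero _ v.ne_bot
    have hI' : Ideal.relNorm (𝓞 K) I ≠ ⊥ := by rwa [Ne, Ideal.relNorm_eq_bot_iff]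
    have h1 : primeToIdeal (Ideal.relNorm (𝓞 K) (Q * I)) hI hIn =
        primeToIdeal v.asIdeal v.ne_bot hvn ^ Q.inertiaDeg (𝓞 K) *
          primeToIdeal (Ideal.relNorm (𝓞 K) I) hI' hIn'.of_mul_left_right := by
      rw [← primeToIdeal_pow v.ne_bot hvn _ hvf hvfn,
        ← primeToIdeal_mul hvf hI' hvfn hIn'.of_mul_left_right (hnorm ▸ hI) hIn']
      exact Subtype.ext (Units.ext (congrArg FractionalIdeal.coeIdeal hnorm))
    rw [h1, map_mul, ih, mul_one, map_pow, ← Subgroup.mem_bot, ← hu Q hQmax]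
    · exact (hφ _ v rfl Q hQmax rfl).pow_inertiaDeg_mem_inertia
    · intro hd
      rw [Ideal.isCoprime_iff_sup_eq] at hvn
      exact hqmax.ne_top (top_le_iff.1 (hvn ▸ sup_le le_rfl (Ideal.le_of_dvd hd)))

theorem IsArtinMap.map_eq_one_of_eq_prod_smul [IsGalois K M] {φ : idealsPrimeTo K n →* Gal(M/K)}
    (hφ : IsArtinMap φ) (hu : UnramifiedOutside n M) {y : 𝓞 M} {c : 𝓞 K} (hc0 : c ≠ 0)
    (hc : IsCoprime (Ideal.span {c}) n) (h : algebraMap (𝓞 K) (𝓞 M) c = ∏ σ : Gal(M/K), σ • y) :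
    φ (principalPrimeTo c hc0 hc) = 1 := by
  have h1 : Algebra.intNorm (𝓞 K) (𝓞 M) y = c := by
    apply RingOfIntegers.coe_injective
    apply (algebraMap K M).injective
    have h2 := Algebra.algebraMap_intNorm (A := 𝓞 K) (K := K) (L := M) (B := 𝓞 M) y
    rw [h2, Algebra.norm_eq_prod_automorphisms]
    have h3 := congrArg (algebraMap (𝓞 M) M) h
    rw [map_prod] at h3
    exact h3.symm
  have h2 : Ideal.relNorm (𝓞 K) (Ideal.span {y}) = Ideal.span {c} := by
    rw [Ideal.relNorm_singleton, h1]
  have h3 : Ideal.span {c} ≠ ⊥ := by rwa [Ne, Ideal.span_singleton_eq_bot]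
  rw [← hφ.map_relNorm_eq_one hu (Ideal.span {y}) (h2 ▸ h3) (h2 ▸ hc)]
  exact congrArg φ (Subtype.ext (Units.ext (congrArg FractionalIdeal.coeIdeal h2.symm)))

end norm

/-! ### Inertia groups in ray class fields -/

section inertia

variable {K : Type*} [Field K] [NumberField K] {n m : Ideal (𝓞 K)}

theorem IsArtinMap.restrictNormalHom {L M : Type*} [Field L] [Field M] [Algebra K L]
    [Algebra K M] [Algebra M L] [IsScalarTower K M L] [Normal K M] [NumberField M] [NumberField L]
    {φ : idealsPrimeTo K n →* Gal(L/K)} (hφ : IsArtinMap φ) :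
    IsArtinMap ((AlgEquiv.restrictNormalHom M).comp φ) := by
  intro J v hJ Q hQ hQv
  obtain ⟨Q', hQ', hQQ'⟩ := Ideal.exists_maximal_ideal_liesOver_of_isIntegral (S := 𝓞 L) Q
  have hover : Q'.under (𝓞 M) = Q := hQQ'.over.symm
  rw [← hover]
  refine (hφ J v hJ Q' hQ' ?_).restrictNormalHom
  rw [← Ideal.under_under (B := 𝓞 M), hover, hQv]

theorem UnramifiedOutside.of_tower {L M : Type*} [Field L] [Field M] [Algebra K L]
    [Algebra K M] [Algebra M L] [IsScalarTower K M L] [IsGalois K L] [IsGalois K M]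
    [NumberField M] [NumberField L] (hu : UnramifiedOutside n L) : UnramifiedOutside n M := by
  intro Q hQ hQn
  obtain ⟨Q', hQ', hQQ'⟩ := Ideal.exists_maximal_ideal_liesOver_of_isIntegral (S := 𝓞 L) Q
  have hover : Q'.under (𝓞 M) = Q := hQQ'.over.symm
  have hin := hu Q' hQ' (by rwa [← Ideal.under_under (B := 𝓞 M), hover])
  rw [eq_bot_iff]
  intro σ hσ
  obtain ⟨τ, rfl⟩ := AlgEquiv.restrictNormalHom_surjective L (K₁ := M) σ
  rw [← hover] at hσ
  obtain ⟨τ', hτ', heq⟩ := exists_mem_inertia_restrictNormalHom_eq hσ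
  rw [hin, Subgroup.mem_bot] at hτ'
  rw [Subgroup.mem_bot, ← heq, hτ', map_one]

/-- If `n = v ^ e * m` with `m` prime to `v`, the Artin symbol of an integer `c ≡ 1 mod m` lies in
the inertia group at `v`: modulo `n`, `c` is a norm from the inertia field. -/
theorem IsArtinMap.map_principalPrimeTo_mem_inertia [IsTotallyComplex K] {L : Type*} [Field L]
    [Algebra K L] [FiniteDimensional K L] [IsAbelianGalois K L]
    {φ : idealsPrimeTo K n →* Gal(L/K)} (hφ : IsArtinMap φ) (hu : UnramifiedOutside n L)
    (hker : ∀ J : idealsPrimeTo K n, φ J = 1 ↔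
      (J : (FractionalIdeal (𝓞 K)⁰ K)ˣ) ∈ rayIdeals K n)
    {Q : Ideal (𝓞 L)} [Q.IsMaximal] {e : ℕ} (he : e ≠ 0) (hnm : n = Q.under (𝓞 K) ^ e * m)
    (hcop : IsCoprime (Q.under (𝓞 K) ^ e) m) {c : 𝓞 K} (hc0 : c ≠ 0)
    (hc : IsCoprime (Ideal.span {c}) n) (hcm : c - 1 ∈ m) :
    φ (principalPrimeTo c hc0 hc) ∈ Q.inertia Gal(L/K) := by
  have : NumberField L := NumberField.of_module_finite K L
  let M := IntermediateField.fixedField (Q.inertia Gal(L/K))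
  have : NumberField M := NumberField.of_module_finite K M
  have hfix : ∀ τ : Gal(L/K), AlgEquiv.restrictNormalHom M τ = 1 ↔ τ ∈ Q.inertia Gal(L/K) := by
    intro τ
    rw [← MonoidHom.mem_ker, IntermediateField.restrictNormalHom_ker,
      IntermediateField.fixingSubgroup_fixedField]
  have hPmax : (Q.under (𝓞 M)).IsMaximal := Ideal.IsMaximal.under (𝓞 M) Q
  have hP : (Q.under (𝓞 M)).inertia Gal(M/K) = ⊥ := by
    rw [eq_bot_iff]
    intro σ hσ
    obtain ⟨τ, rfl⟩ := AlgEquiv.restrictNormalHom_surjective L (K₁ := M) σ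
    obtain ⟨τ', hτ', heq⟩ := exists_mem_inertia_restrictNormalHom_eq hσ
    rw [Subgroup.mem_bot, ← heq, hfix]
    exact hτ'
  have hqmax : (Q.under (𝓞 K)).IsMaximal := Ideal.IsMaximal.under (𝓞 K) Q
  have hnQ : n ≤ Q.under (𝓞 K) := by
    rw [hnm]
    exact Ideal.mul_le_left.trans (Ideal.pow_le_self he)
  have hcop' : ∀ d : 𝓞 K, IsCoprime (Ideal.span {d}) n → d ∉ Q.under (𝓞 K) := by
    intro d hd hdQ
    rw [Ideal.isCoprime_iff_sup_eq] at hd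
    refine hqmax.ne_top (top_le_iff.1 (hd ▸ sup_le ?_ hnQ))
    rwa [Ideal.span_singleton_le_iff_mem]
  have : Finite (𝓞 M ⧸ Q.under (𝓞 M)) :=
    Ideal.finiteQuotientOfFreeOfNeBot _ (NeZero.ne (Q.under (𝓞 M)))
  have hunder : (Q.under (𝓞 M)).under (𝓞 K) = Q.under (𝓞 K) := Ideal.under_under Q
  obtain ⟨y, c', hy, hc'⟩ := Ideal.exists_prod_smul_eq_of_inertia_eq_bot_of_isCoprime
    (A := 𝓞 K) (G := Gal(M/K)) (Q.under (𝓞 M)) hP (c := c) (by rw [hunder]; exact hcop' c hc) he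
    (m := m) (by rwa [hunder]) hcm
  rw [hunder, ← hnm] at hc'
  have hc'n : IsCoprime (Ideal.span {c'}) n := by
    obtain ⟨d, hd⟩ := isCoprime_span_iff.1 hc
    refine isCoprime_span_iff.2 ⟨d, ?_⟩
    have : c' * d - 1 = (c' - c) * d + (c * d - 1) := by ring
    rw [this]
    exact add_mem (Ideal.mul_mem_right _ _ hc') hd
  have hc'0 : c' ≠ 0 := fun h0 => hcop' c' hc'n (h0 ▸ zero_mem _)
  rw [← map_principalPrimeTo_eq_of_sub_mem hker hc'0 hc0 hc'n hc hc', ← hfix]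
  exact (hφ.restrictNormalHom (M := M)).map_eq_one_of_eq_prod_smul hu.of_tower hc'0 hc'n hy

/-- If `n = v ^ e * m` with `m` prime to `v`, the inertia group at `v` of the ray class field modulo
`n` consists of the Artin symbols of the integers `≡ 1 mod m`. -/
theorem IsRayClassField.mem_inertia_iff [IsTotallyComplex K] {Ω : Type*} [Field Ω] [Algebra K Ω]
    {Lm Ln : IntermediateField K Ω} (hn : n ≠ ⊥) (hLm : IsRayClassField K m Lm)
    (hLn : IsRayClassField K n Ln) {φ : idealsPrimeTo K n →* Gal(Ln/K)} (hφ : IsArtinMap φ)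
    (hsurj : Function.Surjective φ)
    (hker : ∀ J : idealsPrimeTo K n, φ J = 1 ↔
      (J : (FractionalIdeal (𝓞 K)⁰ K)ˣ) ∈ rayIdeals K n)
    {Q : Ideal (𝓞 Ln)} (hQ : Q.IsMaximal) {e : ℕ} (he : e ≠ 0)
    (hnm : n = Q.under (𝓞 K) ^ e * m) (hcop : IsCoprime (Q.under (𝓞 K) ^ e) m) {σ : Gal(Ln/K)} :
    σ ∈ Q.inertia Gal(Ln/K) ↔ ∃ (c : 𝓞 K) (hc0 : c ≠ 0) (hc : IsCoprime (Ideal.span {c}) n),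
      c - 1 ∈ m ∧ σ = φ (principalPrimeTo c hc0 hc) := by
  have := hLm.finite
  have := hLn.finite
  have := hLm.abelian
  have := hLn.abelian
  have : NumberField Lm := NumberField.of_module_finite K Lm
  have : NumberField Ln := NumberField.of_module_finite K Ln
  have hmn : m ∣ n := ⟨_, hnm.trans (mul_comm _ _)⟩
  constructor
  · intro hσ
    obtain ⟨hle, hmem⟩ := IsRayClassField.le_and_mem_galOver_iff hn hmn hLm hLn hφ hker
    let _ : Algebra Lm Ln := (IntermediateField.inclusion hle).toAlgebra
    have : IsScalarTower K Lm Ln := IsScalarTower.of_algebraMap_eq' rfl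
    have hmax : (Q.under (𝓞 Lm)).IsMaximal := Ideal.IsMaximal.under (𝓞 Lm) Q
    have hqmax : (Q.under (𝓞 K)).IsMaximal := Ideal.IsMaximal.under (𝓞 K) Q
    have h1 := restrictNormalHom_mem_inertia (M := Lm) hσ
    rw [hLm.unramified _ hmax, Subgroup.mem_bot] at h1
    · obtain ⟨J, rfl⟩ := hsurj σ
      have h2 : φ J ∈ galOver Lm Ln := by
        rw [mem_galOver_iff]
        intro x hx
        have h3 := AlgEquiv.restrictNormal_commutes (φ J) Lm ⟨x, hx⟩
        have h4 := congrArg (algebraMap Lm Ln) (DFunLike.congr_fun h1 ⟨x, hx⟩)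
        exact h3.symm.trans h4
      obtain ⟨c, hc0, hc, hcm, h⟩ := exists_map_eq_principalPrimeTo hker hn hmn ((hmem J).1 h2)
      exact ⟨c, hc0, hc, hcm, h⟩
    · rw [Ideal.under_under]
      intro hd
      rw [IsCoprime.pow_left_iff (Nat.pos_of_ne_zero he), Ideal.isCoprime_iff_sup_eq] at hcop
      exact hqmax.ne_top (top_le_iff.1 (hcop ▸ sup_le le_rfl (Ideal.le_of_dvd hd)))
  · rintro ⟨c, hc0, hc, hcm, rfl⟩
    exact hφ.map_principalPrimeTo_mem_inertia hLn.unramified hker he hnm hcop hc0 hc hcm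

end inertia

/-! ### Units of imaginary quadratic fields -/

section units

variable {K : Type*} [Field K] [NumberField K]

/-- An imaginary quadratic field has unit rank `0`, so its units form the cyclic group of roots of
unity. -/
theorem exists_orderOf_eq_torsionOrder (hK : Module.finrank ℚ K = 2) [IsTotallyComplex K] :
    ∃ ζ : (𝓞 K)ˣ, orderOf ζ = Units.torsionOrder K ∧ ∀ u, u ∈ Subgroup.zpowers ζ := by
  classical
  have hplaces : Fintype.card (InfinitePlace K) = 1 := by
    have h1 := IsTotallyComplex.finrank (K := K)
    have h2 := InfinitePlace.card_eq_nrRealPlaces_add_nrComplexPlaces (K := K)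
    rw [IsTotallyComplex.nrRealPlaces_eq_zero] at h2
    omega
  have hrank : Units.rank K = 0 := by rw [Units.rank, hplaces]
  have htop : Units.torsion K = ⊤ := by
    have : IsEmpty (Fin (Units.rank K)) := by rw [hrank]; infer_instance
    have h := Units.closure_fundSystem_sup_torsion_eq_top K
    rwa [Set.range_eq_empty, Subgroup.closure_empty, bot_sup_eq] at h
  obtain ⟨ζ, hζ⟩ := IsCyclic.exists_generator (α := Units.torsion K)
  refine ⟨ζ, ?_, fun u => ?_⟩
  · rw [Subgroup.orderOf_coe, orderOf_eq_card_of_forall_mem_zpowers hζ, Units.torsionOrder]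
  · obtain ⟨k, hk⟩ := hζ ⟨u, htop ▸ Subgroup.mem_top u⟩
    exact ⟨k, congrArg Subtype.val hk⟩

/-- Roots of unity remain distinct modulo an ideal prime to their order, as `1 - η` divides the
order of a root of unity `η ≠ 1`. -/
theorem orderOf_units_map_mk_eq {R : Type*} [CommRing R] [IsDomain R] {ζ : Rˣ} {w : ℕ}
    (hw : w ≠ 0) (hζ : orderOf ζ = w) {I : Ideal R} (hI : I ≠ ⊤)
    (hIw : IsCoprime I (Ideal.span {(w : R)})) :
    orderOf (Units.map (Ideal.Quotient.mk I : R →* R ⧸ I) ζ) = w := by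
  refine Nat.dvd_antisymm (hζ ▸ orderOf_map_dvd _ ζ) ?_
  set k := orderOf (Units.map (Ideal.Quotient.mk I : R →* R ⧸ I) ζ) with hk
  have hkmem : 1 - ((ζ ^ k : Rˣ) : R) ∈ I := by
    rw [← Ideal.Quotient.eq, map_one]
    have h1 := congrArg Units.val
      (pow_orderOf_eq_one (Units.map (Ideal.Quotient.mk I : R →* R ⧸ I) ζ))
    rw [← map_pow] at h1
    exact h1.symm
  rw [← hζ]
  refine orderOf_dvd_of_pow_eq_one ?_
  by_contra hne
  set η : R := ((ζ ^ k : Rˣ) : R) with hη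
  have hηne : η ≠ 1 := fun h => hne (Units.ext h)
  have hdw : orderOf η ∣ w := by
    rw [hη, orderOf_units, ← hζ]
    exact orderOf_pow_dvd k
  have hprim := IsPrimitiveRoot.orderOf η
  obtain ⟨j, hj⟩ : ∃ j, orderOf η = j + 1 + 1 := by
    have h0 : orderOf η ≠ 0 := fun h => hw (Nat.eq_zero_of_zero_dvd (h ▸ hdw))
    have h1 : orderOf η ≠ 1 := fun h => hηne (orderOf_eq_one_iff.1 h)
    exact ⟨orderOf η - 2, by omega⟩
  rw [hj] at hprim
  have hprod := hprim.prod_one_sub_pow_eq_order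
  have hmem : ((j + 1 + 1 : ℕ) : R) ∈ I := by
    rw [Nat.cast_succ, ← hprod, Finset.prod_range_succ', zero_add, pow_one]
    exact Ideal.mul_mem_left _ _ hkmem
  have hwI : (w : R) ∈ I := by
    obtain ⟨l, hl⟩ := hj ▸ hdw
    rw [hl, Nat.cast_mul]
    exact Ideal.mul_mem_right _ _ hmem
  rw [Ideal.isCoprime_iff_sup_eq, sup_eq_left.2 ((Ideal.span_singleton_le_iff_mem I).2 hwI)] at hIw
  exact hI hIw

end units

/-! ### The Artin map on residue classes -/

theorem Ideal.mem_prod_iff_of_pairwise_isCoprime {ι R : Type*} [CommRing R] [IsDedekindDomain R]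
    {f : ι → Ideal R} (hf : Pairwise (Function.onFun IsCoprime f)) {s : Finset ι} {x : R} :
    x ∈ ∏ i ∈ s, f i ↔ ∀ i ∈ s, x ∈ f i := by
  constructor
  · intro hx i hi
    exact Ideal.le_of_dvd (Finset.dvd_prod_of_mem f hi) hx
  · intro h
    rw [← Ideal.dvd_span_singleton]
    exact Finset.prod_dvd_of_coprime (fun i _ j _ hij => hf hij)
      fun i hi => Ideal.dvd_span_singleton.2 (h i hi)

section residues

variable {K : Type*} [Field K] [NumberField K] {n : Ideal (𝓞 K)} {ι : Type*} [Fintype ι]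
  {f : ι → Ideal (𝓞 K)}

/-- Chinese remainder theorem: residue classes prime to `n` lift to a nonzero integer. -/
theorem exists_lift_units (hn : n ≠ ⊥) (hf : Pairwise (Function.onFun IsCoprime f))
    (hprod : ∏ i, f i = n) (a : ∀ i, (𝓞 K ⧸ f i)ˣ) :
    ∃ c : 𝓞 K, c ≠ 0 ∧ IsCoprime (Ideal.span {c}) n ∧ ∀ i, Ideal.Quotient.mk (f i) c = a i := by
  obtain ⟨c, hc⟩ := Ideal.pi_quotient_surjective hf fun i => (a i : 𝓞 K ⧸ f i)
  obtain ⟨d, hd⟩ := Ideal.pi_quotient_surjective hf fun i => (((a i)⁻¹ : (𝓞 K ⧸ f i)ˣ) : 𝓞 K ⧸ f i)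
  have hmem : ∀ x : 𝓞 K, (∀ i, x ∈ f i) → x ∈ n := fun x hx => by
    rw [← hprod, Ideal.mem_prod_iff_of_pairwise_isCoprime hf]
    exact fun i _ => hx i
  have hcop : IsCoprime (Ideal.span {c}) n := by
    refine isCoprime_span_iff.2 ⟨d, hmem _ fun i => ?_⟩
    rw [← Ideal.Quotient.eq, map_mul, map_one]
    exact (congrArg₂ _ (hc i) (hd i)).trans (Units.mul_inv _)
  by_cases h0 : c = 0
  · obtain ⟨x, hx, hx0⟩ := Submodule.exists_mem_ne_zero_of_ne_bot hn
    have hfx : ∀ i, x ∈ f i := fun i =>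
      Ideal.le_of_dvd (hprod ▸ Finset.dvd_prod_of_mem f (Finset.mem_univ i)) hx
    refine ⟨x, hx0, isCoprime_span_iff.2 ⟨0, ?_⟩, fun i => ?_⟩
    · obtain ⟨d, hd⟩ := isCoprime_span_iff.1 hcop
      rwa [h0, zero_mul, ← mul_zero x] at hd
    · rw [← hc i, h0, Ideal.Quotient.eq_zero_iff_mem.2 (hfx i)]
      rfl
  · exact ⟨c, h0, hcop, hc⟩

variable [IsTotallyComplex K] {L : Type*} [Field L] [Algebra K L]
  {φ : idealsPrimeTo K n →* Gal(L/K)}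

/-- The Artin map on principal ideals, as a homomorphism on residue classes. -/
theorem exists_hom_units_eq_map_principalPrimeTo
    (hker : ∀ J : idealsPrimeTo K n, φ J = 1 ↔
      (J : (FractionalIdeal (𝓞 K)⁰ K)ˣ) ∈ rayIdeals K n)
    (hn : n ≠ ⊥) (hf : Pairwise (Function.onFun IsCoprime f)) (hprod : ∏ i, f i = n) :
    ∃ ψ : (∀ i, (𝓞 K ⧸ f i)ˣ) →* Gal(L/K), ∀ (a : ∀ i, (𝓞 K ⧸ f i)ˣ) (c : 𝓞 K) (hc0 : c ≠ 0)
      (hc : IsCoprime (Ideal.span {c}) n), (∀ i, Ideal.Quotient.mk (f i) c = a i) →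
        ψ a = φ (principalPrimeTo c hc0 hc) := by
  choose c hc0 hc hca using exists_lift_units hn hf hprod
  have heq : ∀ (x y : 𝓞 K) (hx0 : x ≠ 0) (hx : IsCoprime (Ideal.span {x}) n) (hy0 : y ≠ 0)
      (hy : IsCoprime (Ideal.span {y}) n),
      (∀ i, Ideal.Quotient.mk (f i) x = Ideal.Quotient.mk (f i) y) →
        φ (principalPrimeTo x hx0 hx) = φ (principalPrimeTo y hy0 hy) := by
    intro x y hx0 hx hy0 hy h
    refine map_principalPrimeTo_eq_of_sub_mem hker hx0 hy0 hx hy ?_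
    rw [← hprod, Ideal.mem_prod_iff_of_pairwise_isCoprime hf]
    exact fun i _ => Ideal.Quotient.eq.1 (h i)
  refine ⟨MonoidHom.mk' (fun a => φ (principalPrimeTo (c a) (hc0 a) (hc a))) fun a b => ?_,
    fun a d hd0 hd hda => heq _ _ _ _ _ _ fun i => by rw [hca, hda]⟩
  rw [← map_mul, heq (c (a * b)) (c a * c b) _ _ (mul_ne_zero (hc0 a) (hc0 b))
    (isCoprime_span_mul (hc a) (hc b)) fun i => by rw [map_mul, hca, hca, hca]; rfl]
  refine congrArg φ (Subtype.ext (Units.ext ?_))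
  refine Eq.trans ?_ (FractionalIdeal.coeIdeal_mul _ _)
  rw [Ideal.span_singleton_mul_span_singleton]
  rfl

/-- The Artin symbol of `(c)` is trivial just when `c` is congruent to a unit. -/
theorem map_principalPrimeTo_eq_one_iff
    (hker : ∀ J : idealsPrimeTo K n, φ J = 1 ↔
      (J : (FractionalIdeal (𝓞 K)⁰ K)ˣ) ∈ rayIdeals K n)
    {c : 𝓞 K} (hc0 : c ≠ 0) (hc : IsCoprime (Ideal.span {c}) n) :
    φ (principalPrimeTo c hc0 hc) = 1 ↔ ∃ u : (𝓞 K)ˣ, c - u ∈ n := by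
  constructor
  · intro h
    obtain ⟨x, hJ, ⟨a, b, hb0, ha, hb, hab, hx⟩, -⟩ := (hker _).1 h
    have hbK : (b : K) ≠ 0 := RingOfIntegers.coe_ne_zero_iff.2 hb0
    have h1 : Ideal.span {c * b} = Ideal.span {a} := by
      have h2 := congrArg Units.val hJ
      rw [coe_toPrincipalIdeal, hx] at h2
      replace h2 : ((Ideal.span {c} : Ideal (𝓞 K)) : FractionalIdeal (𝓞 K)⁰ K) = _ := h2
      rw [← FractionalIdeal.coeIdeal_inj (K := K), ← Ideal.span_singleton_mul_span_singleton,
        FractionalIdeal.coeIdeal_mul, h2, FractionalIdeal.coeIdeal_span_singleton,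
        FractionalIdeal.coeIdeal_span_singleton, FractionalIdeal.spanSingleton_mul_spanSingleton]
      exact congrArg _ (div_mul_cancel₀ _ hbK)
    obtain ⟨u, hu⟩ := Ideal.span_singleton_eq_span_singleton.1 h1
    refine ⟨u⁻¹, ?_⟩
    obtain ⟨d, hd⟩ := isCoprime_span_iff.1 hb
    have hu' : (u : 𝓞 K) * ((u⁻¹ : (𝓞 K)ˣ) : 𝓞 K) = 1 := u.mul_inv
    set u' : 𝓞 K := ((u⁻¹ : (𝓞 K)ˣ) : 𝓞 K)
    have h3 : c - u' = (a - b) * (d * u') - (b * d - 1) * (c - u') := by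
      linear_combination (d * u') * hu - (c * b * d) * hu'
    rw [h3]
    exact sub_mem (Ideal.mul_mem_right _ _ hab) (Ideal.mul_mem_right _ _ hd)
  · rintro ⟨u, hu⟩
    have hun : IsCoprime (Ideal.span {(u : 𝓞 K)}) n :=
      isCoprime_span_iff.2 ⟨((u⁻¹ : (𝓞 K)ˣ) : 𝓞 K), by simp⟩
    rw [map_principalPrimeTo_eq_of_sub_mem hker hc0 u.ne_zero hc hun hu, ← map_one φ]
    refine congrArg φ (Subtype.ext (Units.ext ?_))
    refine (congrArg FractionalIdeal.coeIdeal (Ideal.span_singleton_eq_top.2 u.isUnit)).trans ?_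
    rw [FractionalIdeal.coeIdeal_top]
    rfl

end residues

/-! ### The inertia trace ideal of a ray class field -/

section presentation

/-- The factorization of `n`, with its prime divisors indexed by `Fin (numPrimeDivisors n)`. -/
theorem exists_eq_prod_pow {K : Type*} [Field K] [NumberField K] {n : Ideal (𝓞 K)} (hn : n ≠ ⊥) :
    ∃ (v : Fin (numPrimeDivisors n) → HeightOneSpectrum (𝓞 K))
      (e : Fin (numPrimeDivisors n) → ℕ), Function.Injective v ∧
        (∀ w : HeightOneSpectrum (𝓞 K), w.asIdeal ∣ n ↔ w ∈ Set.range v) ∧ (∀ i, e i ≠ 0) ∧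
          ∏ i, (v i).asIdeal ^ e i = n := by
  classical
  have hfin : {v : HeightOneSpectrum (𝓞 K) | v.asIdeal ∣ n}.Finite := Ideal.finite_factors hn
  have := hfin.to_subtype
  have := Fintype.ofFinite {v : HeightOneSpectrum (𝓞 K) | v.asIdeal ∣ n}
  let E := (Finite.equivFinOfCardEq
    (Nat.card_coe_set_eq {v : HeightOneSpectrum (𝓞 K) | v.asIdeal ∣ n})).symm
  refine ⟨fun i => E i, fun i =>
    (Associates.mk (E i).1.asIdeal).count (Associates.mk n).factors, ?_, ?_, ?_, ?_⟩
  · exact Subtype.val_injective.comp E.injective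
  · intro w
    constructor
    · intro hw
      exact ⟨E.symm ⟨w, hw⟩, by simp⟩
    · rintro ⟨i, rfl⟩
      exact (E i).2
  · intro i
    exact (Associates.count_ne_zero_iff_dvd hn (E i).1.irreducible).2 (E i).2
  · have hsupp : Function.mulSupport (fun v : HeightOneSpectrum (𝓞 K) => v.maxPowDividing n) ⊆
        {v | v.asIdeal ∣ n} := by
      intro w hw
      by_contra h
      refine hw ?_
      have h0 : (Associates.mk w.asIdeal).count (Associates.mk n).factors = 0 :=
        not_not.1 fun h' => h ((Associates.count_ne_zero_iff_dvd hn w.irreducible).1 h')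
      change w.asIdeal ^ _ = 1
      rw [h0, pow_zero]
    refine Eq.trans ?_ ((finprod_eq_prod_of_mulSupport_subset_of_finite _ hsupp hfin).symm.trans
      (Ideal.finprod_heightOneSpectrum_factorization hn))
    rw [Finset.prod_subtype _ (fun w => hfin.mem_toFinset)]
    exact E.prod_comp fun w : {v : HeightOneSpectrum (𝓞 K) | v.asIdeal ∣ n} =>
      w.1.maxPowDividing n

theorem exists_units_eq_mk {R ι : Type*} [CommRing R] {n : Ideal R} {f : ι → Ideal R} {c : R}
    (hc : IsCoprime (Ideal.span {c}) n) (hf : ∀ i, f i ∣ n) :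
    ∃ a : ∀ i, (R ⧸ f i)ˣ, ∀ i, Ideal.Quotient.mk (f i) c = a i := by
  obtain ⟨d, hd⟩ := isCoprime_span_iff.1 hc
  have h : ∀ i, Ideal.Quotient.mk (f i) c * Ideal.Quotient.mk (f i) d = 1 := fun i => by
    rw [← map_mul, ← map_one (Ideal.Quotient.mk (f i)), Ideal.Quotient.eq]
    exact Ideal.le_of_dvd (hf i) hd
  exact ⟨fun i => ⟨Ideal.Quotient.mk (f i) c, Ideal.Quotient.mk (f i) d, h i,
    by rw [mul_comm, h i]⟩, fun i => rfl⟩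

/-- The Galois group `Γ` of the ray class field modulo `n` over the Hilbert class field is the
quotient of the product of the groups `(𝓞 K ⧸ v ^ e)ˣ`, over the prime powers `v ^ e` exactly
dividing `n`, by the image of the group of roots of unity, and the inertia groups are the images of
the factors. -/
theorem IsRayClassField.exists_presentation {K : Type*} [Field K] [NumberField K]
    (hK : Module.finrank ℚ K = 2) [IsTotallyComplex K] {Ω : Type*} [Field Ω] [Algebra K Ω]
    {rayField : Ideal (𝓞 K) → IntermediateField K Ω}
    (hray : ∀ u : Ideal (𝓞 K), u ≠ ⊥ → IsRayClassField K u (rayField u))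
    {n : Ideal (𝓞 K)} (hn : n ≠ ⊥)
    (hnw : IsCoprime n (Ideal.span {(Units.torsionOrder K : 𝓞 K)})) :
    ∃ (f : Fin (numPrimeDivisors n) → Ideal (𝓞 K)) (_ : ∀ i, Finite (𝓞 K ⧸ f i)ˣ)
      (ψ : (∀ i, (𝓞 K ⧸ f i)ˣ) →* galOver (rayField ⊤) (rayField n)) (γ : ∀ i, (𝓞 K ⧸ f i)ˣ),
      (∀ i, orderOf (γ i) = Units.torsionOrder K) ∧ Function.Surjective ψ ∧
        ψ.ker = Subgroup.zpowers γ ∧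
        inertiaTraceIdeal n (galOver (rayField ⊤) (rayField n)) =
          Ideal.span (Set.range fun i => elementSum (Set.range fun x => ψ (Pi.mulSingle i x))) := by
  classical
  obtain ⟨v, e, hvinj, hv, he, hprod⟩ := exists_eq_prod_pow hn
  set f : Fin (numPrimeDivisors n) → Ideal (𝓞 K) := fun i => (v i).asIdeal ^ e i with hfdef
  have hf : Pairwise (Function.onFun IsCoprime f) := fun i j hij =>
    (v i).isCoprime_pow_of_ne (v j) (fun h => hij (hvinj h)) _ _
  have hfn : ∀ i, f i ∣ n := fun i => hprod ▸ Finset.dvd_prod_of_mem f (Finset.mem_univ i)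
  have hmemn : ∀ x, x ∈ n ↔ ∀ i, x ∈ f i := fun x => by
    have h := Ideal.mem_prod_iff_of_pairwise_isCoprime hf (s := Finset.univ) (x := x)
    rw [hprod] at h
    simpa using h
  have hfbot : ∀ i, f i ≠ ⊥ := fun i => pow_ne_zero _ (v i).ne_bot
  have hftop : ∀ i, f i ≠ ⊤ := fun i h =>
    (v i).isPrime.ne_top (top_le_iff.1 (h ▸ Ideal.pow_le_self (he i)))
  have hfinite : ∀ i, Finite (𝓞 K ⧸ f i) := fun i =>
    Ideal.finiteQuotientOfFreeOfNeBot (f i) (hfbot i)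
  have hLn := hray n hn
  have htop := hray ⊤ top_ne_bot
  have htopn : (⊤ : Ideal (𝓞 K)) ∣ n := by
    rw [← Ideal.one_eq_top]
    exact one_dvd n
  obtain ⟨φ, hφ, hsurj, hker⟩ := hLn.artin
  replace hφ : IsArtinMap φ := hφ
  have hΓ := (IsRayClassField.le_and_mem_galOver_iff hn htopn htop hLn hφ hker).2
  have hprincipal : ∀ (c : 𝓞 K) (hc0 : c ≠ 0) (hc : IsCoprime (Ideal.span {c}) n),
      φ (principalPrimeTo c hc0 hc) ∈ galOver (rayField ⊤) (rayField n) := by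
    intro c hc0 hc
    rw [hΓ, coe_principalPrimeTo]
    refine toPrincipalIdeal_mem_rayIdeals ⟨c, 1, one_ne_zero, ?_, ?_, Submodule.mem_top, ?_⟩
    · simp [Ideal.isCoprime_iff_sup_eq]
    · simp [Ideal.isCoprime_iff_sup_eq]
    · simp
  obtain ⟨ψ₀, hψ₀⟩ := exists_hom_units_eq_map_principalPrimeTo hker hn hf hprod
  have hψ₀mem : ∀ a, ψ₀ a ∈ galOver (rayField ⊤) (rayField n) := fun a => by
    obtain ⟨c, hc0, hc, hca⟩ := exists_lift_units hn hf hprod a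
    rw [hψ₀ a c hc0 hc hca]
    exact hprincipal c hc0 hc
  let ψ := ψ₀.codRestrict (galOver (rayField ⊤) (rayField n)) hψ₀mem
  obtain ⟨ζ, hζ, hζgen⟩ := exists_orderOf_eq_torsionOrder hK
  let γ : ∀ i, (𝓞 K ⧸ f i)ˣ := fun i =>
    Units.map (Ideal.Quotient.mk (f i) : 𝓞 K →* 𝓞 K ⧸ f i) ζ
  have hker₀ : ∀ a, ψ₀ a = 1 ↔ a ∈ Subgroup.zpowers γ := by
    intro a
    obtain ⟨c, hc0, hc, hca⟩ := exists_lift_units hn hf hprod a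
    rw [hψ₀ a c hc0 hc hca, map_principalPrimeTo_eq_one_iff hker hc0 hc]
    have hpow : ∀ (k : ℤ) i, (((γ ^ k) i : (𝓞 K ⧸ f i)ˣ) : 𝓞 K ⧸ f i) =
        Ideal.Quotient.mk (f i) ((ζ ^ k : (𝓞 K)ˣ) : 𝓞 K) := fun k i => by
      rw [Pi.pow_apply, ← map_zpow]
      rfl
    constructor
    · rintro ⟨u, hu⟩
      obtain ⟨k, rfl⟩ := hζgen u
      refine ⟨k, funext fun i => Units.ext ?_⟩
      refine (hpow k i).trans ?_
      rw [← hca i, eq_comm, Ideal.Quotient.eq]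
      exact (hmemn _).1 hu i
    · rintro ⟨k, rfl⟩
      refine ⟨ζ ^ k, (hmemn _).2 fun i => ?_⟩
      rw [← Ideal.Quotient.eq, hca i]
      exact hpow k i
  have hγ : ∀ i, orderOf (γ i) = Units.torsionOrder K := fun i =>
    orderOf_units_map_mk_eq (Units.torsionOrder_ne_zero K) hζ (hftop i)
      (hnw.of_isCoprime_of_dvd_left (hfn i))
  have hψsurj : Function.Surjective ψ := by
    rintro ⟨g, hg⟩
    obtain ⟨J, rfl⟩ := hsurj g
    obtain ⟨c, hc0, hc, -, h⟩ := exists_map_eq_principalPrimeTo hker hn htopn ((hΓ J).1 hg)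
    obtain ⟨a, ha⟩ := exists_units_eq_mk hc hfn
    exact ⟨a, Subtype.ext ((hψ₀ a c hc0 hc ha).trans h.symm)⟩
  have hψker : ψ.ker = Subgroup.zpowers γ := by
    ext a
    rw [MonoidHom.mem_ker, ← hker₀, Subtype.ext_iff]
    rfl
  have hinertia : ∀ (i : Fin (numPrimeDivisors n)) (Q : Ideal (𝓞 (rayField n))), Q.IsMaximal →
      Q.under (𝓞 K) = (v i).asIdeal →
      {g : galOver (rayField ⊤) (rayField n) |
        (g : Gal(rayField n/K)) ∈ Q.inertia Gal(rayField n/K)} =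
        Set.range fun x => ψ (Pi.mulSingle i x) := by
    intro i Q hQ hQi
    let m : Ideal (𝓞 K) := ∏ j ∈ Finset.univ.erase i, f j
    have hm0 : m ≠ ⊥ := Finset.prod_ne_zero_iff.2 fun j _ => hfbot j
    have hnm : n = Q.under (𝓞 K) ^ e i * m := by
      rw [hQi, ← hprod]
      exact (Finset.mul_prod_erase _ f (Finset.mem_univ i)).symm
    have hcop : IsCoprime (Q.under (𝓞 K) ^ e i) m := by
      rw [hQi]
      exact IsCoprime.prod_right fun j hj => hf (Finset.ne_of_mem_erase hj).symm
    have hmemm : ∀ x, x ∈ m ↔ ∀ j, j ≠ i → x ∈ f j := fun x => by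
      rw [Ideal.mem_prod_iff_of_pairwise_isCoprime hf]
      simp
    ext g
    rw [Set.mem_ofPred_eq,
      IsRayClassField.mem_inertia_iff hn (hray m hm0) hLn hφ hsurj hker hQ (he i) hnm hcop]
    constructor
    · rintro ⟨c, hc0, hc, hcm, hg⟩
      obtain ⟨a, ha⟩ := exists_units_eq_mk hc hfn
      refine ⟨a i, Subtype.ext (Eq.trans ?_ hg.symm)⟩
      refine hψ₀ _ c hc0 hc fun j => ?_
      by_cases hj : j = i
      · subst hj
        rw [Pi.mulSingle_eq_same]
        exact ha j
      · rw [Pi.mulSingle_eq_of_ne hj, Units.val_one, ← map_one (Ideal.Quotient.mk (f j)),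
          Ideal.Quotient.eq]
        exact (hmemm _).1 hcm j hj
    · rintro ⟨x, rfl⟩
      obtain ⟨c, hc0, hc, hca⟩ := exists_lift_units hn hf hprod (Pi.mulSingle i x)
      refine ⟨c, hc0, hc, (hmemm _).2 fun j hj => ?_, hψ₀ _ c hc0 hc hca⟩
      rw [← Ideal.Quotient.eq, hca j, Pi.mulSingle_eq_of_ne hj, Units.val_one, map_one]
  refine ⟨f, fun i => inferInstance, ψ, γ, hγ, hψsurj, hψker, ?_⟩
  have := hLn.finite
  have : NumberField (rayField n) := NumberField.of_module_finite K (rayField n)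
  refine congrArg Ideal.span (Set.ext fun x => ⟨?_, ?_⟩)
  · rintro ⟨Q, hQ, hQn, rfl⟩
    have hqmax : (Q.under (𝓞 K)).IsMaximal := Ideal.IsMaximal.under (𝓞 K) Q
    obtain ⟨i, hi⟩ := (hv ⟨Q.under (𝓞 K), hqmax.isPrime, NeZero.ne _⟩).1 hQn
    exact ⟨i, congrArg elementSum
      (hinertia i Q hQ (congrArg HeightOneSpectrum.asIdeal hi).symm).symm⟩
  · rintro ⟨i, rfl⟩
    have := (v i).isMaximal
    obtain ⟨Q, hQ, hQv⟩ := Ideal.exists_maximal_ideal_liesOver_of_isIntegral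
      (S := 𝓞 (rayField n)) (v i).asIdeal
    have hQi : Q.under (𝓞 K) = (v i).asIdeal := hQv.over.symm
    refine ⟨Q, hQ, ?_, congrArg elementSum (hinertia i Q hQ hQi).symm⟩
    rw [hQi]
    exact (hv (v i)).2 ⟨i, rfl⟩

end presentation

theorem mainTheorem2
    (K : Type*) [Field K] [NumberField K] (hK : Module.finrank ℚ K = 2) [IsTotallyComplex K]
    (Ω : Type*) [Field Ω] [Algebra K Ω] [IsAlgClosure K Ω]
    (rayField : Ideal (𝓞 K) → IntermediateField K Ω)
    (hray : ∀ u : Ideal (𝓞 K), u ≠ ⊥ → IsRayClassField K u (rayField u))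
    (n : Ideal (𝓞 K)) (hn : n ≠ ⊥)
    (hnw : IsCoprime n (Ideal.span {(NumberField.Units.torsionOrder K : 𝓞 K)})) :
    ((numPrimeDivisors n = 1 ∨ Even (numPrimeDivisors n)) →
      AddCommGroup.torsion (MonoidAlgebra ℤ (galOver (rayField ⊤) (rayField n)) ⧸
        inertiaTraceIdeal n (galOver (rayField ⊤) (rayField n))) = ⊥) ∧
    (¬ (numPrimeDivisors n = 1 ∨ Even (numPrimeDivisors n)) →
      Nonempty (AddCommGroup.torsion (MonoidAlgebra ℤ (galOver (rayField ⊤) (rayField n)) ⧸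
        inertiaTraceIdeal n (galOver (rayField ⊤) (rayField n))) ≃+
          ZMod (NumberField.Units.torsionOrder K))) := by
  obtain ⟨f, _, ψ, γ, hγ, hψ, hker, hS⟩ := IsRayClassField.exists_presentation hK hray hn hnw
  have := fun i => Fintype.ofFinite (𝓞 K ⧸ f i)ˣ
  have key := fun ht => nonempty_torsion_quotient_equiv (Units.torsionOrder_ne_zero K) ht hγ hψ
    hker hS
  constructor
  · intro h
    by_cases ht : numPrimeDivisors n = 1
    · have := (hray n hn).finite
      let i₀ : Fin (numPrimeDivisors n) := ⟨0, by omega⟩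
      have hi : ∀ i, i = i₀ := fun i => Fin.ext (by have := i.2; simp only [i₀]; omega)
      -- The single inertia group is the whole group.
      have hS' : inertiaTraceIdeal n (galOver (rayField ⊤) (rayField n)) =
          Ideal.span {elementSum Set.univ} := by
        rw [hS]
        congr 1
        have huniv : ∀ i, (Set.range fun x => ψ (Pi.mulSingle i x)) = Set.univ := by
          intro i
          refine Set.eq_univ_of_forall fun g => ?_
          obtain ⟨a, rfl⟩ := hψ g
          refine ⟨a i, congrArg ψ (funext fun j => ?_)⟩
          obtain rfl : j = i := (hi j).trans (hi i).symm
          rw [Pi.mulSingle_eq_same]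
        simp only [huniv]
        have : Nonempty (Fin (numPrimeDivisors n)) := ⟨i₀⟩
        exact Set.range_const
      rw [hS']
      exact torsion_quotient_span_elementSum_univ
    · obtain ⟨E⟩ := key ht
      rw [if_pos (h.resolve_left ht)] at E
      have : Subsingleton (AddCommGroup.torsion
          (MonoidAlgebra ℤ (galOver (rayField ⊤) (rayField n)) ⧸
            inertiaTraceIdeal n (galOver (rayField ⊤) (rayField n)))) :=
        E.injective.subsingleton
      exact AddSubgroup.eq_bot_of_subsingleton _
  · intro h
    rw [not_or] at h
    obtain ⟨E⟩ := key h.1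
    rw [if_neg h.2] at E
    exact ⟨E⟩
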